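/- **Setting.** Let $M$ be a compact $3$-manifold (possibly with boundary) with a locally trivial fibration $q:M\to S^1$ whose fiber $\Sigma$ is a compact connected surface (possibly with boundary). Write $\pi=\pi_1(M,x_0)$, let $\phi:\pi\to\mathbb Z$ be the homomorphism induced by $q$, let $F=\ker\phi$, and fix $t_0\in\pi$ with $\phi(t_0)=1$. Let $<$ be a bi-ordering of $\pi$ (a total order invariant under left and right multiplication); all subgroups of $\pi$ carry the restricted order. Let $f:\pi\to G$ be a surjective homomorphism onto a finite group, with corresponding finite cover $\widetilde M\to M$, i.e. $\pi_1(\widetilde M)=\ker f$; let $d\ge 1$ be the integer with $\phi(\ker f)=d\mathbb Z$, let $\widetilde F=F\cap\ker f$ be the fiber group of $\widetilde M$, and fix $\tilde t_0\in\ker f$ with $\phi(\tilde t_0)=d$. The monodromies act on $F$ and $\widetilde F$ by $x\mapsto t_0^{-1}xt_0$ and $x\mapsto \tilde t_0^{-1}x\tilde t_0$. For a bi-ordered group $(N,<)$ let $C_N$ be the intersection of all convex subgroups of $N$ containing $[N,N]$, and let $A(N)=N/C_N$ be its maximal ordered abelian quotient. Let $\Delta,\widetilde\Delta\in\mathbb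 Q[t]$ be the characteristic polynomials of the monodromies on $H_1(F;\mathbb Q)$ and $H_1(\widetilde F;\mathbb Q)$, and let $\chi,\widetilde\chi\in\mathbb Q[t]$ be the characteristic polynomials of the maps that they induce on $A(F)\otimes\mathbb Q$ and $A(\widetilde F)\otimes\mathbb Q$. For a representation $\alpha:\pi\to \mathrm{GL}(V)$ on a finite-dimensional $\mathbb Q$-vector space, let $\Delta_M^{\alpha\otimes\phi}\in\mathbb Q[t,t^{-1}]$ be the twisted Alexander polynomial: the order of the $\mathbb Q[t,t^{-1}]$-module $H_1(M;V\otimes\mathbb Q[t,t^{-1}])$, where $g\in\pi$ acts on the coefficients by $v\otimes t^i\mapsto\alpha(g)v\otimes t^{i+\phi(g)}$. It is defined up to units of $\mathbb Q[t,t^{-1}]$, and $\doteq$ denotes equality up to units. The classical Alexander polynomial $\Delta_M^{\phi}$ is the case of the trivial representation on $\mathbb Q$. Let $\alpha_G:\pi\to\mathrm{GL}(\mathbb QG)$ be the composition of $f$ with the regular representation, and let $\beta:\pi\to G\to\mathrm{GL}(V)$ be any finite-dimensional rational representation that factors through $f$ (every representation with finite image arises in this way). **Theorem.** The map $\pi_1(q^{-1}(q(x_0)),x_0)\to\pi$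 is injective with image $F$, the four vector spaces above are finite-dimensional, and: 1. $\Delta_M^{\phi}(t)\doteq\Delta(t)$ and $\Delta_M^{\alpha_G\otimes\phi}(t)\doteq\widetilde\Delta(t^d)$; the polynomial $\Delta_M^{\beta\otimes\phi}$ exists and divides $\bigl(\Delta_M^{\alpha_G\otimes\phi}\bigr)^{\dim V}$ in $\mathbb Q[t,t^{-1}]$. 2. $\chi$ divides $\Delta$ and $\widetilde\chi$ divides $\widetilde\Delta$; thus $\chi(t)$ and $\widetilde\chi(t^d)$ are factors of $\Delta_M^\phi(t)$ and of $\Delta_M^{\alpha_G\otimes\phi}(t)$ (their essential factors, which carry the information about the bi-ordering). 3. The essential factor of the twisted polynomial is determined by that of the classical one: if $\chi(t)=\prod_i(t-\lambda_i)$ over $\mathbb C$, then $\widetilde\chi(t^d)=\prod_i(t^d-\lambda_i^d)$. 4. $\chi(t)$ divides $\widetilde\chi(t^d)$ and $\Delta(t)$ divides $\widetilde\Delta(t^d)$. In particular every positive real root of $\Delta_M^\phi$ is a root of $\Delta_M^{\alpha_G\otimes\phi}$, and every positive real root of $\chi(t)$ is a root of $\widetilde\chi(t^d)$, so the twisted polynomials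 give no stronger obstruction to bi-orderability than the condition of Clay and Rolfsen that $\Delta_M^\phi$ has a positive real root. -/

import Mathlib

open scoped TensorProduct LaurentPolynomial unitInterval

noncomputable section

/-! ## The maximal ordered abelian quotient of a bi-ordered group

A bi-ordered group is a group with a linear order that is monotone under multiplication on both
sides; a subgroup carries the restricted order. -/

section Ordered

/-- The convex commutator subgroup: the intersection of all convex subgroups that contain the
commutator subgroup. -/
def convexCommutator (G : Type*) [Group G] [LinearOrder G] : Subgroup G :=
  sInf {K : Subgroup G | commutator G ≤ K ∧ (K : Set G).OrdConnected}

theorem commutator_le_convexCommutator (G : Type*) [Group G] [LinearOrder G] :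
    commutator G ≤ convexCommutator G :=
  le_sInf fun _ hK => hK.1

instance convexCommutator_normal (G : Type*) [Group G] [LinearOrder G] :
    (convexCommutator G).Normal where
  conj_mem n hn g := by
    have h : g * n * g⁻¹ * n⁻¹ ∈ convexCommutator G :=
      commutator_le_convexCommutator G
        (Subgroup.commutator_mem_commutator (Subgroup.mem_top g) (Subgroup.mem_top n))
    simpa using mul_mem h hn

/-- An order-preserving homomorphism maps the convex commutator subgroup into the convex
commutator subgroup. -/
theorem convexCommutator_le_comap {G H : Type*} [Group G] [LinearOrder G] [Group H]
    [LinearOrder H] (θ : G →* H) (hθ : Monotone θ) :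
    convexCommutator G ≤ (convexCommutator H).comap θ := by
  intro x hx
  refine Subgroup.mem_comap.2 (Subgroup.mem_sInf.2 fun K hK => ?_)
  refine Subgroup.mem_sInf.1 hx (K.comap θ) ⟨?_, ⟨fun a ha b hb c hc => ?_⟩⟩
  · rw [← Subgroup.map_le_iff_le_comap, commutator_def, Subgroup.map_commutator]
    exact le_trans (Subgroup.commutator_mono le_top le_top) hK.1
  · exact hK.2.out ha hb ⟨hθ hc.1, hθ hc.2⟩

/-- The (group underlying the) maximal ordered abelian quotient `A(G, <)` of a bi-ordered group. -/
abbrev MaxOrderedAbelianQuotient (G : Type*) [Group G] [LinearOrder G] : Type _ :=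
  G ⧸ convexCommutator G

instance MaxOrderedAbelianQuotient.instCommGroup (G : Type*) [Group G] [LinearOrder G] :
    CommGroup (MaxOrderedAbelianQuotient G) where
  __ := QuotientGroup.Quotient.group (convexCommutator G)
  mul_comm a b := by
    induction a using QuotientGroup.induction_on with | H a =>
    induction b using QuotientGroup.induction_on with | H b =>
    refine QuotientGroup.eq.2 (commutator_le_convexCommutator G ?_)
    have h := Subgroup.commutator_mem_commutator (Subgroup.mem_top b⁻¹) (Subgroup.mem_top a⁻¹)
    rw [commutatorElement_def] at h
    simpa [mul_assoc, commutator_def] using h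

/-- The homomorphism `A(G, <) → A(H, <)` induced by an order-preserving homomorphism. -/
def MaxOrderedAbelianQuotient.map {G H : Type*} [Group G] [LinearOrder G] [Group H]
    [LinearOrder H] (θ : G →* H) (hθ : Monotone θ) :
    MaxOrderedAbelianQuotient G →* MaxOrderedAbelianQuotient H :=
  QuotientGroup.map (convexCommutator G) (convexCommutator H) θ (convexCommutator_le_comap θ hθ)

/-- Conjugation by an element of a bi-ordered group preserves the order of a normal subgroup. -/
theorem conjNormal_monotone {P : Type*} [Group P] [LinearOrder P] [MulLeftMono P] [MulRightMono P]
    (N : Subgroup P) [N.Normal] (g : P) : Monotone (MulAut.conjNormal g : N ≃* N) := by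
  intro a b hab
  refine Subtype.coe_le_coe.1 ?_
  rw [MulAut.conjNormal_apply, MulAut.conjNormal_apply]
  exact mul_le_mul_left (mul_le_mul_right (Subtype.coe_le_coe.2 hab) g) g⁻¹

end Ordered

/-! ## Monodromy maps

If `N` is the fiber group of a fibration over the circle, regarded as a normal subgroup of the
fundamental group `P` of the total space, and `t ∈ P` is sent to the generator of `ℤ`, then the
monodromy acts on `N` by `x ↦ t⁻¹ * x * t`. -/

section Monodromy

/-- First rational homology `H₁(N; ℚ)` of a group. -/
abbrev RationalH1 (N : Type*) [Group N] : Type _ :=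
  ℚ ⊗[ℤ] Additive (Abelianization N)

/-- The rational vector space `A(N, <) ⊗ ℚ`. -/
abbrev RationalA (N : Type*) [Group N] [LinearOrder N] : Type _ :=
  ℚ ⊗[ℤ] Additive (MaxOrderedAbelianQuotient N)

/-- The map on `H₁(N; ℚ)` induced by `x ↦ t⁻¹ * x * t`. -/
def monodromyH1 {P : Type*} [Group P] (N : Subgroup P) [N.Normal] (t : P) :
    RationalH1 N →ₗ[ℚ] RationalH1 N :=
  LinearMap.baseChange ℚ
    (MonoidHom.toAdditive
      (Abelianization.map (MulAut.conjNormal t⁻¹ : N ≃* N).toMonoidHom)).toIntLinearMap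

/-- The map on `A(N, <) ⊗ ℚ` induced by `x ↦ t⁻¹ * x * t`. -/
def monodromyA {P : Type*} [Group P] [LinearOrder P] [MulLeftMono P] [MulRightMono P]
    (N : Subgroup P) [N.Normal] (t : P) : RationalA N →ₗ[ℚ] RationalA N :=
  LinearMap.baseChange ℚ
    (MonoidHom.toAdditive
      (MaxOrderedAbelianQuotient.map (MulAut.conjNormal t⁻¹ : N ≃* N).toMonoidHom
        (conjNormal_monotone N t⁻¹))).toIntLinearMap

end Monodromy

/-! ## Homology with twisted coefficients

Let `X̃` be the universal cover of `X`, that is, the space of homotopy classes of paths that start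
at `x₀`. By unique lifting, a singular simplex of `X̃` is the same as a singular simplex `σ` of `X`
together with a homotopy class of paths from `x₀` to the first vertex of `σ`.
Since `g * h` in Mathlib's `FundamentalGroup` is the class of `h` followed by `g`, the rule
`(σ, c) · g = (σ, g followed by c)` is a right action of `FundamentalGroup X x₀`. -/

section TwistedHomology

/-- The straight path between two points of a standard simplex. -/
def simplexSegment {n : ℕ} (a b : stdSimplex ℝ (Fin (n + 1))) : Path a b where
  toFun s := ⟨AffineMap.lineMap (k := ℝ) a.1 b.1 (s : ℝ),
    (convex_stdSimplex ℝ (Fin (n + 1))).lineMap_mem a.2 b.2 s.2⟩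
  continuous_toFun :=
    Continuous.subtype_mk (by
      simp only [AffineMap.lineMap_apply_module]
      fun_prop) _
  source' := by simp
  target' := by simp

/-- The inclusion of the `i`-th face of the standard `(n + 1)`-simplex. -/
def simplexFace (n : ℕ) (i : Fin (n + 2)) :
    C(stdSimplex ℝ (Fin (n + 1)), stdSimplex ℝ (Fin (n + 2))) :=
  ⟨stdSimplex.map i.succAbove, stdSimplex.continuous_map _⟩

variable {X : Type*} [TopologicalSpace X]

/-- Singular `n`-simplices of the universal cover of `(X, x₀)`. -/
structure LiftedSimplex (x₀ : X) (n : ℕ) where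
  /-- the projection to `X` -/
  simplex : C(stdSimplex ℝ (Fin (n + 1)), X)
  /-- the lift of the first vertex -/
  path : Path.Homotopic.Quotient x₀ (simplex (stdSimplex.vertex 0))

namespace LiftedSimplex

variable {x₀ : X} {n : ℕ}

/-- The right action of the fundamental group on the simplices of the universal cover. -/
def act (s : LiftedSimplex x₀ n) (g : FundamentalGroup X x₀) : LiftedSimplex x₀ n :=
  ⟨s.simplex, (FundamentalGroup.toPath g).trans s.path⟩

/-- The `i`-th face of a simplex of the universal cover. -/
def face (i : Fin (n + 2)) (s : LiftedSimplex x₀ (n + 1)) : LiftedSimplex x₀ n :=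
  ⟨s.simplex.comp (simplexFace n i),
    s.path.trans (Path.Homotopic.Quotient.mk
      ((simplexSegment (stdSimplex.vertex 0) (simplexFace n i (stdSimplex.vertex 0))).map
        s.simplex.continuous))⟩

theorem act_mul (s : LiftedSimplex x₀ n) (g h : FundamentalGroup X x₀) :
    s.act (g * h) = (s.act g).act h :=
  congrArg (LiftedSimplex.mk _) (Path.Homotopic.Quotient.trans_assoc _ _ _)

theorem face_act (i : Fin (n + 2)) (s : LiftedSimplex x₀ (n + 1)) (g : FundamentalGroup X x₀) :
    face i (s.act g) = (face i s).act g :=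
  congrArg (LiftedSimplex.mk _) (Path.Homotopic.Quotient.trans_assoc _ _ _)

end LiftedSimplex

variable {R W : Type*} [CommRing R] [AddCommGroup W] [Module R W]
variable {x₀ : X}

/-- The relations `(s · g) ⊗ w = s ⊗ (g w)` of the tensor product over the group ring. -/
def twistedRelations (ρ : Representation R (FundamentalGroup X x₀) W) (n : ℕ) :
    Submodule R (LiftedSimplex x₀ n →₀ W) :=
  Submodule.span R {z | ∃ (s : LiftedSimplex x₀ n) (g : FundamentalGroup X x₀) (w : W),
    z = Finsupp.single (s.act g) w - Finsupp.single s (ρ g w)}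

/-- The chain modules `C_n(X̃) ⊗_{π₁(X)} W`. -/
abbrev TwistedChains (ρ : Representation R (FundamentalGroup X x₀) W) (n : ℕ) : Type _ :=
  (LiftedSimplex x₀ n →₀ W) ⧸ twistedRelations ρ n

/-- The boundary map of `C_*(X̃)` with coefficients in `W`, before passing to the tensor product
over the group ring. -/
def liftedBoundary (R W : Type*) [CommRing R] [AddCommGroup W] [Module R W] (x₀ : X) (n : ℕ) :
    (LiftedSimplex x₀ (n + 1) →₀ W) →ₗ[R] (LiftedSimplex x₀ n →₀ W) :=
  ∑ i : Fin (n + 2), (-1 : R) ^ (i : ℕ) • Finsupp.lmapDomain W R (LiftedSimplex.face (x₀ := x₀) i)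

theorem twistedRelations_le_comap (ρ : Representation R (FundamentalGroup X x₀) W) (n : ℕ) :
    twistedRelations ρ (n + 1) ≤ (twistedRelations ρ n).comap (liftedBoundary R W x₀ n) := by
  refine Submodule.span_le.2 ?_
  rintro z ⟨s, g, w, rfl⟩
  simp only [SetLike.mem_coe, Submodule.mem_comap, liftedBoundary, LinearMap.sum_apply,
    LinearMap.smul_apply, map_sub, Finsupp.lmapDomain_apply, Finsupp.mapDomain_single]
  rw [← Finset.sum_sub_distrib]
  refine Submodule.sum_mem _ fun i _ => ?_
  rw [← smul_sub]
  refine Submodule.smul_mem _ _ (Submodule.subset_span ?_)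
  exact ⟨s.face i, g, w, by rw [LiftedSimplex.face_act]⟩

/-- The boundary map `C_{n+1}(X̃) ⊗_{π₁(X)} W → C_n(X̃) ⊗_{π₁(X)} W`. -/
def twistedBoundary (ρ : Representation R (FundamentalGroup X x₀) W) (n : ℕ) :
    TwistedChains ρ (n + 1) →ₗ[R] TwistedChains ρ n :=
  Submodule.mapQ _ _ (liftedBoundary R W x₀ n) (twistedRelations_le_comap ρ n)

/-- The first homology `H₁(X; W)` with twisted coefficients: cycles modulo boundaries. -/
abbrev TwistedH1 (ρ : Representation R (FundamentalGroup X x₀) W) : Type _ :=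
  LinearMap.ker (twistedBoundary ρ 0) ⧸
    (LinearMap.range (twistedBoundary ρ 1)).comap (LinearMap.ker (twistedBoundary ρ 0)).subtype

end TwistedHomology

/-! ## Twisted Alexander polynomials -/

section Alexander

/-- The representation `α ⊗ φ` on `V ⊗ ℚ[t, t⁻¹]`, where `g` acts by
`v ⊗ t ^ i ↦ α(g) v ⊗ t ^ (i + φ(g))`. -/
def twistByLaurent {P V : Type*} [Group P] [AddCommGroup V] [Module ℚ V]
    (α : Representation ℚ P V) (φ : P →* Multiplicative ℤ) :
    Representation ℚ[T;T⁻¹] P (ℚ[T;T⁻¹] ⊗[ℚ] V) where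
  toFun g := (LaurentPolynomial.T (Multiplicative.toAdd (φ g)) : ℚ[T;T⁻¹]) •
    LinearMap.baseChange ℚ[T;T⁻¹] (α g)
  map_one' := by
    ext v
    simp
  map_mul' g h := by
    rw [map_mul φ, map_mul α, toAdd_mul, LaurentPolynomial.T_add, LinearMap.baseChange_mul,
      smul_mul_smul_comm]

/-- `Δ` is an order of the `ℚ[t, t⁻¹]`-module `H`: there is an isomorphism
`H ≅ ℚ[t, t⁻¹]^k ⊕ ⨁ᵢ ℚ[t, t⁻¹] / (pᵢ)`, and, up to a unit, `Δ` is the product of the `pᵢ` if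
`k = 0`, and `0` otherwise. (The product does not depend on the decomposition; the `pᵢ` themselves
would become unique up to units if `pᵢ ∣ pᵢ₊₁` were required.) -/
def IsModuleOrder (H : Type*) [AddCommGroup H] [Module ℚ[T;T⁻¹] H] (Δ : ℚ[T;T⁻¹]) : Prop :=
  ∃ (k m : ℕ) (p : Fin m → ℚ[T;T⁻¹]),
    Nonempty (H ≃ₗ[ℚ[T;T⁻¹]]
      (Fin k → ℚ[T;T⁻¹]) × ((i : Fin m) → ℚ[T;T⁻¹] ⧸ Ideal.span {p i})) ∧
    (∀ i, p i ≠ 0) ∧ Associated Δ (if k = 0 then ∏ i, p i else 0)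

/-- `Δ` is a (first) twisted Alexander polynomial `Δ_X^{α ⊗ φ}` (which is only defined up to units
of `ℚ[t, t⁻¹]`). -/
def IsTwistedAlexanderPolynomial {X V : Type*} [TopologicalSpace X] {x₀ : X} [AddCommGroup V]
    [Module ℚ V] (α : Representation ℚ (FundamentalGroup X x₀) V)
    (φ : FundamentalGroup X x₀ →* Multiplicative ℤ) (Δ : ℚ[T;T⁻¹]) : Prop :=
  IsModuleOrder (TwistedH1 (twistByLaurent α φ)) Δ

end Alexander

/-! ## Fibrations over the circle -/

section Fibration

/-- `q : M → ℝ/ℤ` is a locally trivial fiber bundle with fiber `S`. -/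
def IsFiberBundleOverCircle (S : Type*) [TopologicalSpace S] {M : Type*} [TopologicalSpace M]
    (q : C(M, AddCircle (1 : ℝ))) : Prop :=
  ∀ b : AddCircle (1 : ℝ), ∃ e : Bundle.Trivialization S q, b ∈ e.baseSet

/-- `φ` is the homomorphism `π₁(M) → π₁(ℝ/ℤ) = ℤ` induced by `q : M → ℝ/ℤ`: the value of `φ` on
the class of a loop `γ` is the winding number of `q ∘ γ`. -/
def IsInducedByMapToCircle {M : Type*} [TopologicalSpace M] (q : C(M, AddCircle (1 : ℝ))) {x₀ : M}
    (φ : FundamentalGroup M x₀ →* Multiplicative ℤ) : Prop :=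
  ∀ (γ : Path x₀ x₀) (l : C(I, ℝ)), (∀ s, ((l s : ℝ) : AddCircle (1 : ℝ)) = q (γ s)) →
    ((Multiplicative.toAdd
      (φ (FundamentalGroup.fromPath (Path.Homotopic.Quotient.mk γ))) : ℤ) : ℝ) = l 1 - l 0

/-- The homomorphism `π₁(q⁻¹(q(x₀)), x₀) → π₁(M, x₀)` induced by the inclusion of the fiber. -/
def fiberInclusion {M B : Type*} [TopologicalSpace M] [TopologicalSpace B] (q : C(M, B)) (x₀ : M) :
    FundamentalGroup (q ⁻¹' {q x₀}) ⟨x₀, rfl⟩ →* FundamentalGroup M x₀ :=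
  FundamentalGroup.map (⟨Subtype.val, continuous_subtype_val⟩ : C(q ⁻¹' {q x₀}, M)) ⟨x₀, rfl⟩

end Fibration

end

/-! The proof has a topological half, which turns twisted homology into group homology of a fiber
group with its monodromy, and an algebraic half, which compares `F` with `F̃`.

Topology. The bundle becomes trivial after pulling back to an interval in `ℝ`, so homotopies and
loops of winding number zero can be transported into one fiber (`fiberInclusion_injective`,
`fiberInclusion_range_eq_ker`). The fiber is a compact manifold, so `F` is finitely generated; so is
`F̃`, which has finite index in `F`, and all four vector spaces are finite-dimensional. The group
permutes the basis `t ^ n ⊗ x` of `ℚ[t, t⁻¹] ⊗ ℚG` with all stabilizers equal to `F̃` and with `d`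
orbits. Shapiro's lemma, done by hand on singular chains (`OrbitBasis.exists_addEquiv`), identifies
the twisted homology with `d` copies of `H₁(F̃; ℚ)`. Multiplication by `t` permutes the copies
cyclically and applies the monodromy once per turn, so its characteristic polynomial is `Δ̃(t ^ d)`
(`LinearMap.charpoly_eq_expand_of_cyclic`). For a module of finite dimension over `ℚ` this
polynomial is the order (`isModuleOrder_iff_charpoly`). The trivial representation is the case of
the trivial group, and `β` is a summand of `dim V` copies of the regular representation.

Algebra. With `n = |G|`, all `n`-th powers of elements of `F` lie in `F̃`, so `H₁(F̃; ℚ) → H₁(F; ℚ)`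
is onto. Since `F` acts trivially on its homology, `s` acts on the target as the `d`-th power of the
monodromy `B` of `t`. As the characteristic polynomial of `B` divides that of `B ^ d` evaluated at
`t ^ d`, it follows that `Δ(t)` divides `Δ̃(t ^ d)`. For the ordered quotient more is true. In a
bi-ordered group, `a ^ n ≡ b ^ n` modulo a convex subgroup forces `a ≡ b`, so commutators of `n`-th
powers control all commutators. Hence the convex commutator subgroup of `F̃` is the trace of that of
`F` (`mem_convexCommutator_iff_inclusion`), and `A(F̃) ⊗ ℚ` and `A(F) ⊗ ℚ` agree. So `χ̃` belongs to
the `d`-th power of the operator that gives `χ`, and its roots are `d`-th powers. -/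

noncomputable section

/-! ### Characteristic polynomials of quotients, powers and cyclic block operators -/

section CharacteristicPolynomials

open Polynomial Matrix

/-- The characteristic polynomial of an endomorphism is divisible by that of any quotient of it. -/
theorem LinearMap.charpoly_dvd_of_surjective {K U U' : Type*} [Field K] [AddCommGroup U]
    [Module K U] [FiniteDimensional K U] [AddCommGroup U'] [Module K U'] [FiniteDimensional K U']
    (g : U →ₗ[K] U') (hg : Function.Surjective g) (f : Module.End K U) (f' : Module.End K U')
    (h : g ∘ₗ f = f' ∘ₗ g) : f'.charpoly ∣ f.charpoly := by
  obtain ⟨s, hs⟩ := g.exists_rightInverse_of_surjective (LinearMap.range_eq_top.2 hg)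
  have hgs (x : U') : g (s x) = x := LinearMap.congr_fun hs x
  have hgf (x : U) : g (f x) = f' (g x) := LinearMap.congr_fun h x
  let r : U →ₗ[K] LinearMap.ker g :=
    LinearMap.codRestrict _ (LinearMap.id - s ∘ₗ g) fun x => by simp [hgs]
  let e : U ≃ₗ[K] LinearMap.ker g × U' :=
    LinearEquiv.ofLinearMap (r.prod g) ((LinearMap.ker g).subtype.coprod s)
      (by
        refine LinearMap.ext fun x => Prod.ext (Subtype.ext ?_) ?_
        · have := x.1.2
          rw [LinearMap.mem_ker] at this
          simp [r, hgs, this]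
        · have := x.1.2
          rw [LinearMap.mem_ker] at this
          simp [hgs, this])
      (by ext x; simp [r])
  let b₁ := Module.finBasis K (LinearMap.ker g)
  let b₂ := Module.finBasis K U'
  let b := (b₁.prod b₂).map e.symm
  have he (x : U) : (e x).2 = g x := rfl
  have hsymm (x : LinearMap.ker g × U') : e.symm x = x.1 + s x.2 := rfl
  have hblock : (LinearMap.toMatrix b b f).toBlocks₂₁ = 0 := by
    ext i j
    simp [b, Matrix.toBlocks₂₁, LinearMap.toMatrix_apply, he, hsymm, hgf]
  have hquot : (LinearMap.toMatrix b b f).toBlocks₂₂ = LinearMap.toMatrix b₂ b₂ f' := by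
    ext i j
    simp [b, Matrix.toBlocks₂₂, LinearMap.toMatrix_apply, he, hsymm, hgf, hgs]
  rw [← LinearMap.charpoly_toMatrix f b, ← LinearMap.charpoly_toMatrix f' b₂,
    ← Matrix.fromBlocks_toBlocks (LinearMap.toMatrix b b f), hblock, hquot,
    Matrix.charpoly_fromBlocks_zero₂₁]
  exact dvd_mul_left _ _

variable {n : Type*} [Fintype n] [DecidableEq n]

/-- Substituting `X ^ d` for `X` is a ring homomorphism, so it can be applied to the entries before
the determinant is taken. The difference of `d`-th powers on the right is then factored in two ways.
-/
theorem Matrix.expand_charpoly_pow {R : Type*} [CommRing R] (B : Matrix n n R) (d : ℕ) :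
    expand R d (B ^ d).charpoly =
      (algebraMap R[X] (Matrix n n R[X]) X ^ d - (C.mapMatrix B) ^ d).det := by
  have h : ((expand R d : R[X] →ₐ[R] R[X]) : R[X] →+* R[X]) (B ^ d).charpoly =
      (((expand R d : R[X] →ₐ[R] R[X]) : R[X] →+* R[X]).mapMatrix (B ^ d).charmatrix).det := by
    rw [Matrix.charpoly, RingHom.map_det]
  refine Eq.trans h (congrArg Matrix.det ?_)
  rw [Matrix.charmatrix, map_sub, ← map_pow, ← map_pow]
  congr 1
  · ext i j : 1
    by_cases hij : i = j <;> simp [hij, Matrix.algebraMap_matrix_apply]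
  · ext i j : 1
    simp

/-- The scalar matrix `X` commutes with `B`, so `X - B` is a factor of `X ^ d - B ^ d`. -/
theorem Matrix.charpoly_dvd_expand_charpoly_pow {R : Type*} [CommRing R] (B : Matrix n n R)
    (d : ℕ) : B.charpoly ∣ expand R d (B ^ d).charpoly := by
  have hc : Commute (algebraMap R[X] (Matrix n n R[X]) X) (C.mapMatrix B) := Algebra.commutes _ _
  rw [expand_charpoly_pow, ← hc.mul_geom_sum₂, Matrix.det_mul]
  exact dvd_mul_right _ _

/-- This is the identity `Y ^ d - Z ^ d = ∏ (Y - μ Z)` over the `d`-th roots of unity, with the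
scalar matrix `X` for `Y` and `B` for `Z`, after taking determinants. -/
theorem Matrix.expand_charpoly_pow_eq_prod {K : Type*} [Field K] (B : Matrix n n K) {d : ℕ}
    (hd : 0 < d) {ζ : K} (hζ : IsPrimitiveRoot ζ d) :
    expand K d (B ^ d).charpoly = ∏ μ ∈ nthRootsFinset d (1 : K), (μ • B).charpoly := by
  classical
  -- The outer variable stands for `B`, the inner one for the indeterminate of the characteristic
  -- polynomial.
  let A : K[X][X] →ₐ[K[X]] Matrix n n K[X] := aeval (C.mapMatrix B)
  let D : K[X][X] →* K[X] := (Matrix.detMonoidHom).comp (A : K[X][X] →* Matrix n n K[X])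
  have hζ' : IsPrimitiveRoot (C (C ζ) : K[X][X]) d :=
    hζ.map_of_injective (f := (C : K[X] →+* K[X][X]).comp C) (C_injective.comp C_injective)
  have key := hζ'.pow_sub_pow_eq_prod_sub_mul (C X : K[X][X]) X hd
  -- The constants already supply `d` roots of unity, so there are no others in `K[X][X]`.
  have hroots : nthRootsFinset d (1 : K[X][X]) =
      (nthRootsFinset d (1 : K)).image fun μ => C (C μ) := by
    symm
    refine Finset.eq_of_subset_of_card_le ?_ ?_
    · intro x hx
      obtain ⟨μ, hμ, rfl⟩ := Finset.mem_image.1 hx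
      rw [mem_nthRootsFinset hd] at hμ ⊢
      rw [← C_pow, ← C_pow, hμ, C_1, C_1]
    · rw [Finset.card_image_of_injective _ fun x y h => C_injective (C_injective h),
        hζ.card_nthRootsFinset, hζ'.card_nthRootsFinset]
  rw [hroots, Finset.prod_image fun x _ y _ h => C_injective (C_injective h)] at key
  have h := congrArg D key
  rw [map_prod] at h
  rw [expand_charpoly_pow]
  refine Eq.trans (congrArg Matrix.det ?_) (h.trans (Finset.prod_congr rfl fun μ _ =>
    congrArg Matrix.det ?_))
  · simp [A]
  · rw [Matrix.charmatrix]
    change A _ = _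
    simp only [A, map_sub, map_mul, aeval_C, aeval_X]
    congr 1
    rw [← Algebra.smul_def]
    ext i j : 1
    simp

/-- The determinant of `X - μ B` is `μ ^ n` times the characteristic polynomial of `B` at `X / μ`;
one factor `μ` goes into each linear factor. -/
theorem Matrix.charpoly_smul_eq_prod {K : Type*} [Field K] [IsAlgClosed K] (B : Matrix n n K)
    {μ : K} (hμ : μ ≠ 0) :
    (μ • B).charpoly = (B.charpoly.roots.map fun z => X - C (μ * z)).prod := by
  have h₁ : (μ • B).charpoly = C (μ ^ Fintype.card n) * B.charpoly.comp (C μ⁻¹ * X) := by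
    rw [← coe_compRingHom_apply, Matrix.charpoly, Matrix.charpoly, RingHom.map_det, C_pow,
      ← Matrix.det_smul]
    congr 1
    ext i j : 1
    have hC : C μ * C μ⁻¹ = 1 := by rw [← C_mul, mul_inv_cancel₀ hμ, C_1]
    by_cases hij : i = j
    · subst hij
      simp [Matrix.charmatrix_apply_eq, mul_sub, ← mul_assoc, hC]
    · simp [Matrix.charmatrix_apply_ne _ _ _ hij]
  have hsplit := IsAlgClosed.splits B.charpoly
  have h₂ : B.charpoly = (B.charpoly.roots.map fun z => X - C z).prod :=
    hsplit.eq_prod_roots_of_monic B.charpoly_monic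
  have hcard : Multiset.card B.charpoly.roots = Fintype.card n := by
    rw [← hsplit.natDegree_eq_card_roots, B.charpoly_natDegree_eq_dim]
  rw [h₁]
  nth_rw 1 [h₂]
  rw [multiset_prod_comp, Multiset.map_map, ← hcard, ← Multiset.card_map (fun z => X - C (μ * z)),
    C_pow]
  rw [Multiset.card_map, ← Multiset.prod_replicate, ← Multiset.map_const', ← Multiset.prod_map_mul]
  congr 1
  refine Multiset.map_congr rfl fun z _ => ?_
  have hC : C μ * C μ⁻¹ = 1 := by rw [← C_mul, mul_inv_cancel₀ hμ, C_1]
  simp [mul_sub, ← mul_assoc, hC]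

/-- In the double product of `X - μ z` over roots of unity `μ` and eigenvalues `z`, the factors with
a fixed `z` multiply to `X ^ d - z ^ d`. -/
theorem Matrix.expand_charpoly_pow_eq_prod_roots {K : Type*} [Field K] [IsAlgClosed K]
    [CharZero K] (B : Matrix n n K) {d : ℕ} (hd : 0 < d) :
    expand K d (B ^ d).charpoly = (B.charpoly.roots.map fun z => X ^ d - C (z ^ d)).prod := by
  have : NeZero d := ⟨hd.ne'⟩
  obtain ⟨ζ, hζ⟩ := HasEnoughRootsOfUnity.exists_primitiveRoot K d
  have hζ' : IsPrimitiveRoot (C ζ) d := hζ.map_of_injective C_injective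
  rw [expand_charpoly_pow_eq_prod B hd hζ, Finset.prod_congr rfl fun μ hμ =>
    Matrix.charpoly_smul_eq_prod B (ne_zero_of_mem_nthRootsFinset one_ne_zero hμ),
    Finset.prod_eq_multiset_prod, Multiset.prod_map_prod_map]
  congr 1
  refine Multiset.map_congr rfl fun z _ => ?_
  rw [← Finset.prod_eq_multiset_prod, C_pow, hζ'.pow_sub_pow_eq_prod_sub_mul X (C z) hd]
  refine Finset.prod_nbij C (fun μ hμ => ?_) C_injective.injOn (fun x hx => ?_)
    fun μ _ => by rw [C_mul]
  · rw [mem_nthRootsFinset hd] at hμ ⊢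
    rw [← C_pow, hμ, C_1]
  -- A root of unity in `K[X]` has degree zero, hence comes from `K`.
  · rw [Finset.mem_coe, mem_nthRootsFinset hd] at hx
    have hdeg : x.natDegree = 0 := by
      have := congrArg natDegree hx
      rw [natDegree_pow, natDegree_one] at this
      exact (Nat.mul_eq_zero.1 this).resolve_left hd.ne'
    rw [natDegree_eq_zero] at hdeg
    obtain ⟨y, rfl⟩ := hdeg
    refine ⟨y, ?_, rfl⟩
    rw [Finset.mem_coe, mem_nthRootsFinset hd]
    exact C_injective (by rw [C_pow, hx, C_1])

theorem LinearMap.charpoly_dvd_expand_charpoly_pow {K U : Type*} [Field K] [AddCommGroup U]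
    [Module K U] [FiniteDimensional K U] (B : Module.End K U) (d : ℕ) :
    B.charpoly ∣ expand K d (B ^ d).charpoly := by
  have b := Module.finBasis K U
  rw [← LinearMap.charpoly_toMatrix B b, ← LinearMap.charpoly_toMatrix (B ^ d) b,
    ← LinearMap.toMatrix_pow]
  exact Matrix.charpoly_dvd_expand_charpoly_pow _ d

theorem LinearMap.map_expand_charpoly_pow_eq_prod {K L U : Type*} [Field K] [Field L]
    [IsAlgClosed L] [CharZero L] [Algebra K L] [AddCommGroup U] [Module K U]
    [FiniteDimensional K U] (B : Module.End K U) {d : ℕ} (hd : 0 < d) :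
    (expand K d (B ^ d).charpoly).map (algebraMap K L) =
      ((B.charpoly.aroots L).map fun z => X ^ d - C (z ^ d)).prod := by
  have b := Module.finBasis K U
  have h := Matrix.expand_charpoly_pow_eq_prod_roots
    ((algebraMap K L).mapMatrix (LinearMap.toMatrix b b B)) hd
  rw [← map_pow, RingHom.mapMatrix_apply, RingHom.mapMatrix_apply, Matrix.charpoly_map,
    Matrix.charpoly_map, LinearMap.charpoly_toMatrix, LinearMap.toMatrix_pow,
    LinearMap.charpoly_toMatrix] at h
  rw [map_expand, h, aroots]

/-- The block matrix of `(u₀, …, u_{d-1}) ↦ (A u_{d-1}, u₀, …, u_{d-2})`. -/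
def Matrix.cyclicBlock {R : Type*} [Zero R] [One R] (A : Matrix n n R) (d : ℕ) :
    Matrix (Fin d × n) (Fin d × n) R := fun i j =>
  if (j.1 : ℕ) + 1 = i.1 then (1 : Matrix n n R) i.2 j.2
  else if (i.1 : ℕ) = 0 ∧ (j.1 : ℕ) + 1 = d then A i.2 j.2 else 0

theorem Matrix.cyclicBlock_mulVec {R : Type*} [CommRing R] (A : Matrix n n R) {d : ℕ} (hd : 0 < d)
    (u : Fin d × n → R) (i : Fin d × n) :
    (A.cyclicBlock d *ᵥ u) i = if (i.1 : ℕ) = 0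
      then (A *ᵥ fun b => u (⟨d - 1, Nat.sub_lt hd one_pos⟩, b)) i.2
      else u (⟨i.1 - 1, by omega⟩, i.2) := by
  obtain ⟨⟨i, hi⟩, a⟩ := i
  rw [Matrix.mulVec, dotProduct, Fintype.sum_prod_type]
  split_ifs with h
  · obtain rfl : i = 0 := h
    rw [Finset.sum_eq_single ⟨d - 1, Nat.sub_lt hd one_pos⟩]
    · have : d - 1 + 1 = d := Nat.sub_add_cancel hd
      simp [Matrix.cyclicBlock, Matrix.mulVec, dotProduct, this, hd.ne']
    · intro j _ hj
      refine Finset.sum_eq_zero fun b _ => ?_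
      have : ¬((j : ℕ) + 1 = d) := fun hjd => hj (Fin.ext (by simp; omega))
      simp [Matrix.cyclicBlock, this]
    · simp
  · have h : i ≠ 0 := h
    rw [Finset.sum_eq_single ⟨i - 1, by omega⟩]
    · have : i - 1 + 1 = i := by omega
      simp [Matrix.cyclicBlock, this, Matrix.one_apply]
    · intro j _ hj
      refine Finset.sum_eq_zero fun b _ => ?_
      have : ¬((j : ℕ) + 1 = i) := fun hjd => hj (Fin.ext (by simp; omega))
      simp [Matrix.cyclicBlock, this, h]
    · simp

/-- The `k`-th power shifts by `k` places, and `A` acts on the coordinates that wrap around. The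
bound `k ≤ d` ensures that nothing wraps twice. -/
theorem Matrix.cyclicBlock_pow_mulVec {R : Type*} [CommRing R] (A : Matrix n n R) {d : ℕ}
    (hd : 0 < d) (u : Fin d × n → R) (k : ℕ) (hk : k ≤ d) (i : Fin d × n) :
    (A.cyclicBlock d ^ k *ᵥ u) i = if h : (i.1 : ℕ) < k
      then (A *ᵥ fun b => u (⟨i.1 + d - k, by omega⟩, b)) i.2
      else u (⟨i.1 - k, by omega⟩, i.2) := by
  induction k generalizing i with
  | zero => simp
  | succ k ih =>
    have ih := ih (by omega)
    rw [pow_succ', ← Matrix.mulVec_mulVec, Matrix.cyclicBlock_mulVec A hd]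
    obtain ⟨⟨i, hi⟩, a⟩ := i
    by_cases h0 : i = 0
    · subst h0
      have h1 : ¬(d - 1 < k) := by omega
      simp only [ih, h1, if_true, dite_false]
      rw [dif_pos (Nat.succ_pos k)]
      have : (⟨d - 1 - k, by omega⟩ : Fin d) = ⟨0 + d - (k + 1), by omega⟩ :=
        Fin.ext (show d - 1 - k = 0 + d - (k + 1) by omega)
      exact congrArg (fun x : Fin d => (A *ᵥ fun b => u (x, b)) a) this
    · simp only [ih, h0, if_false]
      by_cases h1 : i - 1 < k
      · rw [dif_pos h1, dif_pos (show i < k + 1 by omega)]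
        exact congrArg (fun x : Fin d => (A *ᵥ fun b => u (x, b)) a)
          (Fin.ext (by simp only; omega))
      · rw [dif_neg h1, dif_neg (show ¬(i < k + 1) by omega)]
        exact congrArg (fun x : Fin d => u (x, a)) (Fin.ext (by simp only; omega))

/-- After `d` shifts every coordinate is back in its place and has met `A` exactly once. -/
theorem Matrix.cyclicBlock_pow {R : Type*} [CommRing R] (A : Matrix n n R) {d : ℕ}
    (hd : 0 < d) : A.cyclicBlock d ^ d =
      (Matrix.blockDiagonal fun _ : Fin d => A).reindex (Equiv.prodComm _ _)
        (Equiv.prodComm _ _) := by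
  refine Matrix.ext_of_mulVec_single fun j => funext fun i => ?_
  rw [Matrix.cyclicBlock_pow_mulVec A hd _ d le_rfl, dif_pos i.1.2, Matrix.mulVec_single_one]
  obtain ⟨i, a⟩ := i
  obtain ⟨j, b⟩ := j
  by_cases hij : i = j
  · subst hij
    simp [Matrix.mulVec, dotProduct, Matrix.blockDiagonal_apply, Pi.single_apply]
  · simp [Matrix.mulVec, dotProduct, Matrix.blockDiagonal_apply, hij]

theorem Matrix.charpoly_blockDiagonal_const {R : Type*} [CommRing R] (A : Matrix n n R) (d : ℕ) :
    (Matrix.blockDiagonal fun _ : Fin d => A).charpoly = A.charpoly ^ d := by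
  have : (Matrix.blockDiagonal fun _ : Fin d => A).charmatrix =
      Matrix.blockDiagonal fun _ : Fin d => A.charmatrix := by
    ext ⟨i, k⟩ ⟨j, l⟩ : 1
    by_cases hij : i = j <;> by_cases hkl : k = l <;>
      simp [Matrix.blockDiagonal_apply, hij, hkl]
  rw [Matrix.charpoly, this, Matrix.det_blockDiagonal, Finset.prod_const, Finset.card_univ,
    Fintype.card_fin, Matrix.charpoly]

theorem Polynomial.Monic.eq_of_pow_eq {K : Type*} [Field K] {p q : K[X]} (hp : p.Monic)
    (hq : q.Monic) {d : ℕ} (hd : d ≠ 0) (h : p ^ d = q ^ d) : p = q := by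
  have h₁ : p ∣ q := (IsIntegrallyClosed.pow_dvd_pow_iff hd).1 h.dvd
  have h₂ : q ∣ p := (IsIntegrallyClosed.pow_dvd_pow_iff hd).1 h.symm.dvd
  exact eq_of_monic_of_associated hp hq (associated_of_dvd_dvd h₁ h₂)

/-- For a `d`-th root of unity `μ`, the cyclic block matrix `T` is conjugate to `μ T`, so all `d`
factors in the product formula for `T ^ d` coincide. Since `T ^ d` consists of `d` diagonal blocks
`A`, the two sides have equal `d`-th powers, and both are monic. -/
theorem Matrix.charpoly_cyclicBlock_of_isAlgClosed {K : Type*} [Field K] [IsAlgClosed K]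
    [CharZero K] (A : Matrix n n K) {d : ℕ} (hd : 0 < d) :
    (A.cyclicBlock d).charpoly = expand K d A.charpoly := by
  have : NeZero d := ⟨hd.ne'⟩
  obtain ⟨ζ, hζ⟩ := HasEnoughRootsOfUnity.exists_primitiveRoot K d
  have hroot (μ : K) (hμ : μ ∈ nthRootsFinset d (1 : K)) :
      (μ • A.cyclicBlock d).charpoly = (A.cyclicBlock d).charpoly := by
    have h0 := ne_zero_of_mem_nthRootsFinset one_ne_zero hμ
    rw [mem_nthRootsFinset hd] at hμ
    let D (ν : K) : Matrix (Fin d × n) (Fin d × n) K := Matrix.diagonal fun i => ν ^ (i.1 : ℕ)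
    have hD (ν : K) (hν : ν ≠ 0) : D ν * D ν⁻¹ = 1 := by
      rw [Matrix.diagonal_mul_diagonal, ← Matrix.diagonal_one]
      congr 1
      ext i
      rw [← mul_pow, mul_inv_cancel₀ hν, one_pow]
    let U : (Matrix (Fin d × n) (Fin d × n) K)ˣ :=
      ⟨D μ, D μ⁻¹, hD μ h0, by simpa using hD μ⁻¹ (inv_ne_zero h0)⟩
    rw [← Matrix.charpoly_units_conj U (A.cyclicBlock d)]
    congr 1
    rw [← Matrix.coe_units_inv]
    change μ • A.cyclicBlock d = D μ * A.cyclicBlock d * D μ⁻¹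
    ext ⟨⟨i, hi⟩, a⟩ ⟨⟨j, hj⟩, b⟩
    rw [Matrix.mul_diagonal, Matrix.diagonal_mul, Matrix.smul_apply]
    simp only [Matrix.cyclicBlock, smul_eq_mul]
    split_ifs with h1 h2
    · subst h1
      rw [pow_succ', inv_pow]
      field_simp
    -- Conjugation multiplies the corner block by `μ ^ (-(d - 1))`, which is `μ` because `μ ^ d =
    -- 1`.
    · obtain ⟨rfl, rfl⟩ := h2
      rw [pow_succ'] at hμ
      rw [inv_pow, pow_zero, one_mul, ← eq_inv_of_mul_eq_one_left hμ, mul_comm]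
    · simp
  refine (Matrix.charpoly_monic _).eq_of_pow_eq (A.charpoly_monic.expand hd) hd.ne' ?_
  have h := Matrix.expand_charpoly_pow_eq_prod (A.cyclicBlock d) hd hζ
  rw [Finset.prod_congr rfl hroot, Finset.prod_const, hζ.card_nthRootsFinset,
    Matrix.cyclicBlock_pow A hd, Matrix.charpoly_reindex, Matrix.charpoly_blockDiagonal_const,
    map_pow] at h
  exact h.symm

theorem Matrix.charpoly_cyclicBlock {K : Type*} [Field K] [CharZero K] (A : Matrix n n K) {d : ℕ}
    (hd : 0 < d) : (A.cyclicBlock d).charpoly = expand K d A.charpoly := by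
  let L := AlgebraicClosure K
  have := charZero_of_injective_algebraMap (algebraMap K L).injective
  refine Polynomial.map_injective (algebraMap K L) (algebraMap K L).injective ?_
  rw [← Matrix.charpoly_map, map_expand, ← Matrix.charpoly_map,
    ← Matrix.charpoly_cyclicBlock_of_isAlgClosed _ hd]
  congr 1
  ext i j
  simp only [Matrix.cyclicBlock, Matrix.map_apply, Matrix.one_apply]
  split_ifs <;> simp

/-- The operator `(u₀, …, u_{d-1}) ↦ (A u_{d-1}, u₀, …, u_{d-2})`. -/
theorem LinearMap.charpoly_eq_expand_of_cyclic {K U : Type*} [Field K] [CharZero K]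
    [AddCommGroup U] [Module K U] [FiniteDimensional K U] (A : Module.End K U) {d : ℕ} (hd : 0 < d)
    (T : Module.End K (Fin d → U))
    (hT₀ : ∀ u (i : Fin d), (i : ℕ) = 0 → T u i = A (u ⟨d - 1, Nat.sub_lt hd one_pos⟩))
    (hT : ∀ u (i : Fin d), (i : ℕ) ≠ 0 → T u i = u ⟨i - 1, by omega⟩) :
    T.charpoly = expand K d A.charpoly := by
  let b := Module.finBasis K U
  let e : (Fin d → U) ≃ₗ[K] (Fin d × Fin (Module.finrank K U) → K) :=
    (LinearEquiv.piCongrRight fun _ => b.equivFun).trans (LinearEquiv.curry K K _ _).symm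
  rw [← LinearMap.charpoly_toMatrix A b, ← Matrix.charpoly_cyclicBlock _ hd,
    ← e.charpoly_conj, ← Matrix.charpoly_toLin']
  congr 1
  refine LinearMap.ext fun u => funext fun i => ?_
  obtain ⟨v, rfl⟩ := e.surjective u
  have he (v : Fin d → U) (i) (a) : e v (i, a) = b.repr (v i) a := rfl
  rw [LinearEquiv.conj_apply_apply, e.symm_apply_apply, Matrix.toLin'_apply,
    Matrix.cyclicBlock_mulVec _ hd]
  obtain ⟨i, a⟩ := i
  split_ifs with h
  · simp only [he, hT₀ _ _ h]
    exact (congrFun (LinearMap.toMatrix_mulVec_repr b b A _) a).symm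
  · simp only [he, hT _ _ h]

end CharacteristicPolynomials

/-! ### Orders of Laurent modules of finite rational dimension -/

section ModuleOrder

open Polynomial

/-- In a localization of `K[X]` every ideal is extended from its contraction. The instance makes the
structure theorem over a principal ideal domain available. -/
instance LaurentPolynomial.isPrincipalIdealRing {K : Type*} [Field K] :
    IsPrincipalIdealRing K[T;T⁻¹] where
  principal J := by
    rw [← IsLocalization.map_under (Submonoid.powers (X : K[X])) K[T;T⁻¹] J]
    obtain ⟨g, hg⟩ := (IsPrincipalIdealRing.principal (J.under K[X])).principal
    refine ⟨algebraMap K[X] K[T;T⁻¹] g, ?_⟩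
    rw [hg]
    exact (Ideal.map_span _ _).trans (by rw [Set.image_singleton])

/-- Multiplication by `t` on a `ℚ[t, t⁻¹]`-module. -/
def mulT (H : Type*) [AddCommGroup H] [Module ℚ H] [Module ℚ[T;T⁻¹] H]
    [IsScalarTower ℚ ℚ[T;T⁻¹] H] : Module.End ℚ H :=
  Algebra.lsmul ℚ ℚ H (LaurentPolynomial.T 1 : ℚ[T;T⁻¹])

section MulT

variable {H H' : Type*} [AddCommGroup H] [Module ℚ H] [Module ℚ[T;T⁻¹] H]
  [IsScalarTower ℚ ℚ[T;T⁻¹] H] [AddCommGroup H'] [Module ℚ H'] [Module ℚ[T;T⁻¹] H']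
  [IsScalarTower ℚ ℚ[T;T⁻¹] H']

@[simp]
theorem mulT_apply (x : H) : mulT H x = (LaurentPolynomial.T 1 : ℚ[T;T⁻¹]) • x := rfl

theorem charpoly_mulT_congr [FiniteDimensional ℚ H] [FiniteDimensional ℚ H']
    (e : H ≃ₗ[ℚ[T;T⁻¹]] H') : (mulT H).charpoly = (mulT H').charpoly := by
  rw [← (e.restrictScalars ℚ).charpoly_conj]
  congr 1
  ext x
  simp [LinearEquiv.conj_apply_apply]

theorem charpoly_mulT_prod [FiniteDimensional ℚ H] [FiniteDimensional ℚ H'] :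
    (mulT (H × H')).charpoly = (mulT H).charpoly * (mulT H').charpoly := by
  rw [← LinearMap.charpoly_prodMap]
  congr 1

end MulT

theorem LaurentPolynomial.not_finite : ¬ Module.Finite ℚ ℚ[T;T⁻¹] := fun _ =>
  Polynomial.not_finite (R := ℚ)
    (Module.Finite.of_injective (toLaurentAlg (R := ℚ)).toLinearMap toLaurent_injective)

/-- Clearing denominators, removing powers of `X` and normalizing the leading coefficient all amount
to multiplication by units. The nonzero constant term makes `X` invertible modulo `g`. -/
theorem LaurentPolynomial.exists_associated_toLaurent {p : ℚ[T;T⁻¹]} (hp : p ≠ 0) :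
    ∃ g : ℚ[X], g.Monic ∧ g.coeff 0 ≠ 0 ∧ Associated p g.toLaurent := by
  obtain ⟨n, f, hf⟩ := p.exists_T_pow
  have hf0 : f ≠ 0 := by
    rintro rfl
    rw [map_zero] at hf
    exact hp ((isUnit_T n).mul_left_eq_zero.1 hf.symm)
  obtain ⟨g, hg, hX⟩ := exists_eq_pow_rootMultiplicity_mul_and_not_dvd f hf0 0
  rw [Polynomial.C_0, sub_zero] at hg hX
  rw [X_dvd_iff] at hX
  have hg0 : g ≠ 0 := by
    rintro rfl
    exact hX (coeff_zero 0)
  have hlc : g.leadingCoeff ≠ 0 := leadingCoeff_ne_zero.2 hg0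
  refine ⟨g * Polynomial.C g.leadingCoeff⁻¹, monic_mul_leadingCoeff_inv hg0,
    by simpa using ⟨hX, hg0⟩, ?_⟩
  have h₁ : Associated p f.toLaurent := by
    rw [hf]
    exact associated_mul_unit_right p _ (isUnit_T _)
  refine h₁.trans ?_
  rw [hg, map_mul, map_mul, map_pow, toLaurent_X, toLaurent_C]
  refine (associated_unit_mul_left _ _ ((isUnit_T 1).pow _)).trans
    (associated_mul_unit_right _ _ ?_)
  exact (isUnit_iff_ne_zero.2 (inv_ne_zero hlc)).map (LaurentPolynomial.C (R := ℚ))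

/-- Inverting the variable does not change the quotient by a polynomial with nonzero constant
coefficient. -/
theorem LaurentPolynomial.quotientMap_bijective {g : ℚ[X]} (hg : g.coeff 0 ≠ 0) :
    Function.Bijective (Ideal.quotientMapₐ (Ideal.span {toLaurent g}) (toLaurentAlg (R := ℚ))
      ((Ideal.span_singleton_le_iff_mem _).2 (Ideal.mem_comap.2
        (Ideal.mem_span_singleton_self (toLaurent g)))) :
        ℚ[X] ⧸ Ideal.span {g} →ₐ[ℚ] ℚ[T;T⁻¹] ⧸ Ideal.span {toLaurent g}) := by
  have hcop : IsCoprime g X := by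
    refine (irreducible_X.coprime_iff_not_dvd.2 ?_).symm
    rwa [X_dvd_iff]
  constructor
  · rw [injective_iff_map_eq_zero]
    intro x hx
    obtain ⟨f, rfl⟩ := Ideal.Quotient.mk_surjective x
    change Ideal.Quotient.mk _ (toLaurent f) = 0 at hx
    rw [Ideal.Quotient.eq_zero_iff_dvd] at hx ⊢
    obtain ⟨r, hr⟩ := hx
    obtain ⟨n, r', hr'⟩ := r.exists_T_pow
    refine (hcop.pow_right (n := n)).dvd_of_dvd_mul_right ⟨r', toLaurent_injective ?_⟩
    rw [map_mul, map_mul, hr', hr, map_pow, toLaurent_X, T_pow, mul_one, mul_assoc]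
  · intro y
    obtain ⟨r, rfl⟩ := Ideal.Quotient.mk_surjective y
    obtain ⟨n, r', hr'⟩ := r.exists_T_pow
    obtain ⟨a, b, hab⟩ := hcop
    refine ⟨Ideal.Quotient.mk _ (r' * b ^ n), ?_⟩
    change Ideal.Quotient.mk _ (toLaurent (r' * b ^ n)) = _
    -- The Bézout coefficient `b` is an inverse of `X` modulo `g`, so it can replace the negative
    -- powers of `T`.
    have hbX : Ideal.Quotient.mk (Ideal.span {toLaurent g}) (toLaurent (b * X)) = 1 := by
      rw [← map_one (Ideal.Quotient.mk _), Ideal.Quotient.eq, Ideal.mem_span_singleton]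
      refine ⟨-toLaurent a, ?_⟩
      rw [← map_one toLaurent, ← hab, ← map_sub, ← map_neg, ← map_mul]
      congr 1
      ring
    have : r = r * T n * T (-n) := by
      rw [mul_assoc, ← T_add, add_neg_cancel, T_zero, mul_one]
    have h2 : toLaurent (r' * b ^ n) = r * toLaurent (b * X) ^ n := by
      rw [map_mul, hr', map_pow, map_mul, toLaurent_X, mul_pow, T_pow, mul_one]
      ring
    rw [h2, map_mul, map_pow, hbX, one_pow, mul_one]

/-- After normalization the quotient is `ℚ[X] / (g)`, where multiplication by the root has
characteristic polynomial equal to its minimal polynomial `g`. -/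
theorem LaurentPolynomial.finite_quotient {p : ℚ[T;T⁻¹]} (hp : p ≠ 0) :
    ∃ _ : FiniteDimensional ℚ (ℚ[T;T⁻¹] ⧸ Ideal.span {p}),
      Associated p (mulT (ℚ[T;T⁻¹] ⧸ Ideal.span {p})).charpoly.toLaurent := by
  obtain ⟨g, hg, hg0, hpg⟩ := exists_associated_toLaurent hp
  have hspan : Ideal.span {p} = Ideal.span {toLaurent g} :=
    Ideal.span_singleton_eq_span_singleton.2 hpg
  rw [hspan]
  let θ : AdjoinRoot g ≃ₐ[ℚ] (ℚ[T;T⁻¹] ⧸ Ideal.span {toLaurent g}) :=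
    AlgEquiv.ofBijective _ (quotientMap_bijective hg0)
  let pb := AdjoinRoot.powerBasis hg.ne_zero
  have hfin : FiniteDimensional ℚ (AdjoinRoot g) := pb.finite
  have hfin' := Module.Finite.equiv θ.toLinearEquiv
  refine ⟨hfin', hpg.trans (Associated.of_eq (congrArg toLaurent ?_))⟩
  have h := charpoly_leftMulMatrix pb
  rw [AdjoinRoot.minpoly_powerBasis_gen_of_monic hg] at h
  refine h.symm.trans ?_
  have h2 : (LinearMap.toMatrix pb.basis pb.basis
      (LinearMap.mulLeft ℚ (AdjoinRoot.root g))).charpoly = _ :=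
    LinearMap.charpoly_toMatrix _ pb.basis
  refine Eq.trans ?_ (h2.trans ?_)
  · rfl
  · rw [← θ.toLinearEquiv.charpoly_conj (LinearMap.mulLeft ℚ (AdjoinRoot.root g))]
    congr 1
    refine LinearMap.ext fun x => ?_
    obtain ⟨y, rfl⟩ := θ.surjective x
    have : θ.toLinearEquiv.symm (θ y) = y := θ.toLinearEquiv.symm_apply_apply y
    rw [LinearEquiv.conj_apply_apply, this]
    change θ (AdjoinRoot.root g * y) = _
    rw [map_mul]
    have : θ (AdjoinRoot.root g) = Ideal.Quotient.mk _ (T 1) := by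
      change Ideal.Quotient.mk _ (toLaurent X) = _
      rw [toLaurent_X]
    rw [this, mulT_apply]
    rfl

theorem LaurentPolynomial.finite_pi_quotient (m : ℕ) (p : Fin m → ℚ[T;T⁻¹]) (hp : ∀ i, p i ≠ 0) :
    ∃ _ : FiniteDimensional ℚ ((i : Fin m) → ℚ[T;T⁻¹] ⧸ Ideal.span {p i}),
      Associated (∏ i, p i)
        (mulT ((i : Fin m) → ℚ[T;T⁻¹] ⧸ Ideal.span {p i})).charpoly.toLaurent := by
  have hfin (i) := (finite_quotient (hp i)).1
  refine ⟨inferInstance, ?_⟩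
  induction m with
  | zero =>
    rw [Finset.univ_eq_empty, Finset.prod_empty]
    have : (mulT ((i : Fin 0) → ℚ[T;T⁻¹] ⧸ Ideal.span {p i})).charpoly = 1 := by
      refine (LinearMap.charpoly_monic _).natDegree_eq_zero.1 ?_
      rw [LinearMap.charpoly_natDegree, Module.finrank_zero_of_subsingleton]
    rw [this, map_one]
  | succ m ih =>
    rw [Fin.prod_univ_succ]
    rw [← charpoly_mulT_congr
      (Fin.consLinearEquiv ℚ[T;T⁻¹] fun i => ℚ[T;T⁻¹] ⧸ Ideal.span {p i}), charpoly_mulT_prod,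
      map_mul]
    exact (finite_quotient (hp 0)).2.mul_mul
      (ih (fun i => p i.succ) (fun i => hp _) fun i => hfin i.succ)

/-- Finite dimension excludes a free part, and on cyclic summands the claim is known. This holds for
any decomposition, so the order does not depend on the choice; the structure theorem supplies one.
-/
theorem isModuleOrder_iff_of_finiteDimensional {H : Type*} [AddCommGroup H] [Module ℚ H]
    [Module ℚ[T;T⁻¹] H] [IsScalarTower ℚ ℚ[T;T⁻¹] H] [FiniteDimensional ℚ H] (P : ℚ[T;T⁻¹]) :
    IsModuleOrder H P ↔ Associated P (mulT H).charpoly.toLaurent := by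
  have key (k m : ℕ) (p : Fin m → ℚ[T;T⁻¹]) (e : H ≃ₗ[ℚ[T;T⁻¹]]
      (Fin k → ℚ[T;T⁻¹]) × ((i : Fin m) → ℚ[T;T⁻¹] ⧸ Ideal.span {p i})) (hp : ∀ i, p i ≠ 0) :
      k = 0 ∧ Associated (∏ i, p i) (mulT H).charpoly.toLaurent := by
    obtain ⟨_, hΔ⟩ := LaurentPolynomial.finite_pi_quotient m p hp
    -- A free summand would make `ℚ[T;T⁻¹]` itself finite-dimensional.
    have hk : k = 0 := by
      by_contra hk
      have := Module.Finite.equiv (e.restrictScalars ℚ)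
      let i : Fin k := ⟨0, Nat.pos_of_ne_zero hk⟩
      exact LaurentPolynomial.not_finite (Module.Finite.of_surjective
        (LinearMap.proj i ∘ₗ LinearMap.fst ℚ (Fin k → ℚ[T;T⁻¹])
          ((i : Fin m) → ℚ[T;T⁻¹] ⧸ Ideal.span {p i}))
        fun x => ⟨(fun _ => x, 0), rfl⟩)
    subst hk
    refine ⟨rfl, hΔ.trans (Associated.of_eq (congrArg toLaurent ?_))⟩
    rw [charpoly_mulT_congr (e.trans LinearEquiv.uniqueProd)]
  constructor
  · rintro ⟨k, m, p, ⟨e⟩, hp, hP⟩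
    obtain ⟨rfl, hΔ⟩ := key k m p e hp
    rw [if_pos rfl] at hP
    exact hP.trans hΔ
  · intro hP
    have : Module.Finite ℚ[T;T⁻¹] H := Module.Finite.of_restrictScalars_finite ℚ _ _
    obtain ⟨k, ι, _, q, hq, e, ⟨E⟩⟩ := Module.equiv_free_prod_directSum (R := ℚ[T;T⁻¹]) (M := H)
    classical
    let ε := Fintype.equivFin ι
    let p (i : Fin (Fintype.card ι)) : ℚ[T;T⁻¹] := q (ε.symm i) ^ e (ε.symm i)
    let E' : H ≃ₗ[ℚ[T;T⁻¹]] (Fin k → ℚ[T;T⁻¹]) ×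
        ((i : Fin (Fintype.card ι)) → ℚ[T;T⁻¹] ⧸ Ideal.span {p i}) :=
      E.trans ((Finsupp.linearEquivFunOnFinite _ _ _).prodCongr
        ((DirectSum.linearEquivFunOnFintype _ _ _).trans
          (LinearEquiv.piCongrLeft' ℚ[T;T⁻¹] _ ε)))
    have hp (i) : p i ≠ 0 := pow_ne_zero _ (hq _).ne_zero
    obtain ⟨rfl, hΔ⟩ := key k _ p E' hp
    exact ⟨0, _, p, ⟨E'⟩, hp, by rw [if_pos rfl]; exact hP.trans hΔ.symm⟩

/-- The order of a `ℚ[t, t⁻¹]`-module that is finite-dimensional over `ℚ` is the characteristic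
polynomial of multiplication by `t`. -/
theorem isModuleOrder_iff_charpoly {H U : Type*} [AddCommGroup H] [Module ℚ[T;T⁻¹] H]
    [AddCommGroup U] [Module ℚ U] [FiniteDimensional ℚ U] (e : H ≃+ U) (τ : Module.End ℚ U)
    (he : ∀ x, e ((LaurentPolynomial.T 1 : ℚ[T;T⁻¹]) • x) = τ (e x)) (P : ℚ[T;T⁻¹]) :
    IsModuleOrder H P ↔ Associated P τ.charpoly.toLaurent := by
  let _ : Module ℚ H := Module.compHom H (algebraMap ℚ ℚ[T;T⁻¹])
  have : IsScalarTower ℚ ℚ[T;T⁻¹] H := IsScalarTower.of_algebraMap_smul fun _ _ => rfl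
  -- Additive maps between rational vector spaces are automatically linear, so it suffices to know
  -- how `e` treats `t`.
  let e' : H ≃ₗ[ℚ] U := { e with map_smul' := map_rat_smul e.toAddMonoidHom }
  have := Module.Finite.equiv e'.symm
  rw [isModuleOrder_iff_of_finiteDimensional, ← e'.charpoly_conj]
  have h : e'.conj (mulT H) = τ := by
    refine LinearMap.ext fun x => ?_
    rw [LinearEquiv.conj_apply_apply, mulT_apply]
    refine (he _).trans (congrArg τ ?_)
    exact e'.apply_symm_apply x
  rw [h]

end ModuleOrder

/-! ### Rational homology of groups and the monodromy action -/

section RationalHomology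

/-- The class of a group element in the first rational homology. -/
def RationalH1.of {N : Type*} [Group N] (x : N) : RationalH1 N :=
  1 ⊗ₜ Additive.ofMul (Abelianization.of x)

namespace RationalH1

variable {N N' : Type*} [Group N] [Group N']

theorem of_mul (x y : N) : of (x * y) = of x + of y := by
  simp [of, TensorProduct.tmul_add]

theorem of_one : of (1 : N) = 0 := by simp [of]

theorem of_inv (x : N) : of x⁻¹ = -of x := by
  rw [← add_eq_zero_iff_eq_neg, ← of_mul, inv_mul_cancel, of_one]

theorem of_pow (x : N) (n : ℕ) : of (x ^ n) = (n : ℚ) • of x := by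
  induction n with
  | zero => simp [of_one]
  | succ n ih => rw [pow_succ, of_mul, ih, Nat.cast_succ, add_smul, one_smul]

theorem induction {p : RationalH1 N → Prop} (hof : ∀ x, p (of x))
    (hadd : ∀ x y, p x → p y → p (x + y)) (hsmul : ∀ (a : ℚ) x, p x → p (a • x)) (z) : p z := by
  induction z using TensorProduct.induction_on with
  | zero => simpa using hsmul 0 _ (hof 1)
  | add x y hx hy => exact hadd x y hx hy
  | tmul a x =>
    induction x using Additive.rec with | ofMul x =>
    induction x using QuotientGroup.induction_on with | H x =>
    have h := hsmul a _ (hof x)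
    rwa [of, TensorProduct.smul_tmul', smul_eq_mul, mul_one] at h

theorem hom_ext {U : Type*} [AddCommGroup U] [Module ℚ U] {g h : RationalH1 N →ₗ[ℚ] U}
    (H : ∀ x, g (of x) = h (of x)) : g = h := by
  refine LinearMap.ext fun z => ?_
  induction z using RationalH1.induction with
  | hof x => exact H x
  | hadd x y hx hy => rw [map_add, map_add, hx, hy]
  | hsmul a x hx => rw [map_smul, map_smul, hx]

/-- A homomorphism to the additive group of a rational vector space extends to the first rational
homology. -/
def lift {U : Type*} [AddCommGroup U] [Module ℚ U] (c : N → U) (hc : ∀ x y, c (x * y) = c x + c y) :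
    RationalH1 N →ₗ[ℚ] U :=
  TensorProduct.AlgebraTensorModule.lift
    ((LinearMap.ringLmapEquivSelf ℚ ℚ _).symm
      (MonoidHom.toAdditiveLeft (Abelianization.lift
        { toFun x := Multiplicative.ofAdd (c x)
          map_one' := by
            have := hc 1 1
            rw [mul_one, left_eq_add] at this
            rw [this, ofAdd_zero]
          map_mul' x y := by rw [hc, ofAdd_add] })).toIntLinearMap)

theorem lift_of {U : Type*} [AddCommGroup U] [Module ℚ U] (c : N → U)
    (hc : ∀ x y, c (x * y) = c x + c y) (x : N) : lift c hc (of x) = c x := by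
  simp [lift, of]

/-- The map on first rational homology induced by a group homomorphism. -/
def map (θ : N →* N') : RationalH1 N →ₗ[ℚ] RationalH1 N' :=
  lift (fun x => of (θ x)) fun x y => by rw [map_mul, of_mul]

@[simp]
theorem map_of (θ : N →* N') (x : N) : map θ (of x) = of (θ x) := lift_of _ _ x

/-- The class of `x` is `1 / n` times the class of `x ^ n`, which comes from the source. -/
theorem map_surjective_of_pow_mem (θ : N →* N') {n : ℕ} (hn : n ≠ 0)
    (h : ∀ x : N', x ^ n ∈ θ.range) : Function.Surjective (map θ) := by
  intro z
  induction z using RationalH1.induction with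
  | hof x =>
    obtain ⟨y, hy⟩ := h x
    refine ⟨(n : ℚ)⁻¹ • of y, ?_⟩
    rw [map_smul, map_of, hy, of_pow, smul_smul, inv_mul_cancel₀ (Nat.cast_ne_zero.2 hn), one_smul]
  | hadd x y hx hy =>
    obtain ⟨a, rfl⟩ := hx
    obtain ⟨b, rfl⟩ := hy
    exact ⟨a + b, map_add _ _ _⟩
  | hsmul a x hx =>
    obtain ⟨b, rfl⟩ := hx
    exact ⟨a • b, map_smul _ _ _⟩

theorem finiteDimensional [Group.FG N] : FiniteDimensional ℚ (RationalH1 N) := by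
  have : Group.FG (Abelianization N) := inferInstanceAs (Group.FG (N ⧸ commutator N))
  have : AddGroup.FG (Additive (Abelianization N)) := inferInstance
  have : Module.Finite ℤ (Additive (Abelianization N)) := Module.Finite.iff_addGroup_fg.2 this
  infer_instance

end RationalH1

section Monodromy

variable {P : Type*} [Group P] (N : Subgroup P) [N.Normal]

theorem monodromyH1_of (t : P) (x : N) :
    monodromyH1 N t (RationalH1.of x) = RationalH1.of (MulAut.conjNormal t⁻¹ x) := rfl

theorem monodromyH1_one : monodromyH1 N 1 = 1 :=
  RationalH1.hom_ext fun x => by rw [monodromyH1_of, inv_one, map_one]; rfl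

/-- The order is reversed because `x ↦ t⁻¹ * x * t` is a right action. -/
theorem monodromyH1_mul (s t : P) : monodromyH1 N (s * t) = monodromyH1 N t * monodromyH1 N s :=
  RationalH1.hom_ext fun x => by
    rw [Module.End.mul_apply, monodromyH1_of, monodromyH1_of, monodromyH1_of, mul_inv_rev, map_mul]
    rfl

theorem monodromyH1_pow (t : P) (d : ℕ) : monodromyH1 N (t ^ d) = monodromyH1 N t ^ d := by
  induction d with
  | zero => rw [pow_zero, pow_zero, monodromyH1_one]
  | succ d ih => rw [pow_succ, monodromyH1_mul, ih, pow_succ']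

/-- Inner automorphisms act trivially on homology, so the monodromy depends on `t` only modulo `N`.
-/
theorem monodromyH1_eq_one {t : P} (ht : t ∈ N) : monodromyH1 N t = 1 :=
  RationalH1.hom_ext fun x => by
    have : MulAut.conjNormal t⁻¹ x = (⟨t, ht⟩ : N)⁻¹ * x * ⟨t, ht⟩ := Subtype.ext (by simp)
    rw [monodromyH1_of, this, RationalH1.of_mul, RationalH1.of_mul, RationalH1.of_inv,
      neg_add_cancel_comm]
    rfl

theorem map_inclusion_comp_monodromyH1 {K : Subgroup P} [K.Normal] (h : K ≤ N) (t : P) :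
    RationalH1.map (Subgroup.inclusion h) ∘ₗ monodromyH1 K t =
      monodromyH1 N t ∘ₗ RationalH1.map (Subgroup.inclusion h) :=
  RationalH1.hom_ext fun x => by
    rw [LinearMap.comp_apply, LinearMap.comp_apply, monodromyH1_of, RationalH1.map_of,
      RationalH1.map_of, monodromyH1_of]
    rfl

end Monodromy

end RationalHomology

/-! ### The ordered abelian quotient of a subgroup that contains all `n`-th powers -/

section OrderedQuotient

/-- The class of an element in the rationalized maximal ordered abelian quotient. -/
def RationalA.of {N : Type*} [Group N] [LinearOrder N] (x : N) : RationalA N :=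
  1 ⊗ₜ Additive.ofMul (QuotientGroup.mk x)

namespace RationalA

/-- The projection of the first rational homology onto the rationalized maximal ordered abelian
quotient. -/
def ofH1 (N : Type*) [Group N] [LinearOrder N] : RationalH1 N →ₗ[ℚ] RationalA N :=
  RationalH1.lift RationalA.of fun x y => by
    rw [RationalA.of, RationalA.of, RationalA.of, ← TensorProduct.tmul_add]
    rfl

theorem ofH1_of {N : Type*} [Group N] [LinearOrder N] (x : N) :
    ofH1 N (RationalH1.of x) = RationalA.of x :=
  RationalH1.lift_of _ _ x

theorem ofH1_surjective (N : Type*) [Group N] [LinearOrder N] :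
    Function.Surjective (ofH1 N) := by
  intro z
  induction z using TensorProduct.induction_on with
  | zero => exact ⟨0, map_zero _⟩
  | add x y hx hy =>
    obtain ⟨a, rfl⟩ := hx
    obtain ⟨b, rfl⟩ := hy
    exact ⟨a + b, map_add _ _ _⟩
  | tmul a x =>
    induction x using Additive.rec with | ofMul x =>
    induction x using QuotientGroup.induction_on with | H x =>
    refine ⟨a • RationalH1.of x, ?_⟩
    rw [map_smul, ofH1_of, of, TensorProduct.smul_tmul', smul_eq_mul, mul_one]

variable {P : Type*} [Group P] [LinearOrder P] [MulLeftMono P] [MulRightMono P]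

theorem ofH1_comp_monodromyH1 (N : Subgroup P) [N.Normal] (t : P) :
    ofH1 N ∘ₗ monodromyH1 N t = monodromyA N t ∘ₗ ofH1 N :=
  RationalH1.hom_ext fun x => by
    rw [LinearMap.comp_apply, LinearMap.comp_apply, monodromyH1_of, ofH1_of, ofH1_of]
    rfl

/-- Since homology surjects onto the ordered quotient, identities for `monodromyA` are inherited
from `monodromyH1`. -/
theorem hom_ext {N U : Type*} [Group N] [LinearOrder N] [AddCommGroup U] [Module ℚ U]
    {g h : RationalA N →ₗ[ℚ] U} (H : g ∘ₗ ofH1 N = h ∘ₗ ofH1 N) : g = h :=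
  LinearMap.cancel_right (ofH1_surjective N) |>.1 H

theorem monodromyA_pow (N : Subgroup P) [N.Normal] (t : P) (d : ℕ) :
    monodromyA N (t ^ d) = monodromyA N t ^ d := by
  refine hom_ext ?_
  rw [← ofH1_comp_monodromyH1, monodromyH1_pow]
  induction d with
  | zero => rfl
  | succ d ih =>
    rw [pow_succ', pow_succ', Module.End.mul_eq_comp, ← LinearMap.comp_assoc,
      ofH1_comp_monodromyH1, LinearMap.comp_assoc, ih]
    rfl

theorem monodromyA_mul_of_mem (N : Subgroup P) [N.Normal] (t : P) {k : P} (hk : k ∈ N) :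
    monodromyA N (t * k) = monodromyA N t := by
  refine hom_ext ?_
  rw [← ofH1_comp_monodromyH1, monodromyH1_mul, monodromyH1_eq_one N hk, one_mul,
    ofH1_comp_monodromyH1]

end RationalA

variable {P : Type*} [Group P] [LinearOrder P] [MulLeftMono P] [MulRightMono P]

/-- From `b ≤ a` one gets `a * b ^ m ≤ a ^ (m + 1)`; multiply on the right by the inverse of `b ^ (m
+ 1)`. Both sides of the order invariance enter. -/
theorem mul_inv_le_pow_mul_inv_pow {a b : P} (hab : 1 ≤ a * b⁻¹) {n : ℕ} (hn : n ≠ 0) :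
    a * b⁻¹ ≤ a ^ n * (b ^ n)⁻¹ := by
  have hba : b ≤ a := by
    have := mul_le_mul_left hab b
    rwa [one_mul, inv_mul_cancel_right] at this
  obtain ⟨m, rfl⟩ := Nat.exists_eq_succ_of_ne_zero hn
  have h : a * b ^ m ≤ a ^ (m + 1) := by
    rw [pow_succ']
    exact mul_le_mul_right (pow_le_pow_left' hba m) a
  have := mul_le_mul_left h (b ^ (m + 1))⁻¹
  refine le_trans (le_of_eq ?_) this
  rw [pow_succ, mul_inv_rev]
  group

/-- In a bi-ordered group, congruence of `n`-th powers modulo a convex subgroup implies congruence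
of the elements. -/
theorem mul_inv_mem_of_pow_mul_inv_pow_mem {C : Subgroup P} (hC : (C : Set P).OrdConnected)
    {a b : P} {n : ℕ} (hn : n ≠ 0) (h : a ^ n * (b ^ n)⁻¹ ∈ C) : a * b⁻¹ ∈ C := by
  have key (a b : P) (hab : 1 ≤ a * b⁻¹) (h : a ^ n * (b ^ n)⁻¹ ∈ C) : a * b⁻¹ ∈ C :=
    hC.out C.one_mem h ⟨hab, mul_inv_le_pow_mul_inv_pow hab hn⟩
  rcases le_total 1 (a * b⁻¹) with hab | hab
  · exact key a b hab h
  · have h1 := key b a (by simpa using one_le_inv'.2 hab) (by simpa using C.inv_mem h)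
    simpa using C.inv_mem h1

/-- The convex hull of a subgroup of a bi-ordered group. -/
def Subgroup.convexHull (C : Subgroup P) : Subgroup P where
  carrier := {z | ∃ a ∈ C, ∃ b ∈ C, a ≤ z ∧ z ≤ b}
  one_mem' := ⟨1, C.one_mem, 1, C.one_mem, le_rfl, le_rfl⟩
  mul_mem' := by
    rintro x y ⟨a, ha, b, hb, hax, hxb⟩ ⟨a', ha', b', hb', hax', hxb'⟩
    exact ⟨a * a', C.mul_mem ha ha', b * b', C.mul_mem hb hb', mul_le_mul' hax hax',
      mul_le_mul' hxb hxb'⟩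
  inv_mem' := by
    rintro x ⟨a, ha, b, hb, hax, hxb⟩
    exact ⟨b⁻¹, C.inv_mem hb, a⁻¹, C.inv_mem ha, inv_le_inv_iff.2 hxb, inv_le_inv_iff.2 hax⟩

theorem Subgroup.mem_convexHull {C : Subgroup P} {z : P} :
    z ∈ C.convexHull ↔ ∃ a ∈ C, ∃ b ∈ C, a ≤ z ∧ z ≤ b := Iff.rfl

theorem Subgroup.le_convexHull (C : Subgroup P) : C ≤ C.convexHull :=
  fun z hz => ⟨z, hz, z, hz, le_rfl, le_rfl⟩

theorem Subgroup.ordConnected_convexHull (C : Subgroup P) :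
    (C.convexHull : Set P).OrdConnected where
  out' := by
    rintro x ⟨a, ha, b, hb, hax, hxb⟩ y ⟨a', ha', b', hb', hay, hyb⟩ z ⟨hxz, hzy⟩
    exact ⟨a, ha, b', hb', hax.trans hxz, hzy.trans hyb⟩

/-- The convex commutator subgroup of a subgroup `K` that contains the `n`-th powers of a larger
group `N` is the intersection of `K` with the convex commutator subgroup of `N`. -/
theorem mem_convexCommutator_iff_inclusion {N K : Subgroup P} (hKN : K ≤ N) {n : ℕ}
    (hn : n ≠ 0) (hpow : ∀ x ∈ N, x ^ n ∈ K) (x : K) :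
    x ∈ convexCommutator K ↔ Subgroup.inclusion hKN x ∈ convexCommutator N := by
  constructor
  · intro hx
    exact convexCommutator_le_comap (Subgroup.inclusion hKN) (fun a b hab => hab) hx
  intro hx
  refine Subgroup.mem_sInf.2 fun C ⟨hC, hconv⟩ => ?_
  -- The hull is taken in the whole group, since the commutators of `N` to be placed in it need not
  -- lie in `K`.
  let D : Subgroup P := (C.map K.subtype).convexHull
  have hD : (D : Set P).OrdConnected := Subgroup.ordConnected_convexHull _
  have hCD (z : K) (hz : z ∈ C) : (z : P) ∈ D :=
    Subgroup.le_convexHull _ (Subgroup.mem_map_of_mem K.subtype hz)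
  -- Start from the commutator of `x ^ n` and `y ^ n`, which lies in `C`. It compares the `n`-th
  -- powers of `x ^ n * y * (x ^ n)⁻¹` and `y`, so the exponent of `y` can be removed; after
  -- inverting, the exponent of `x` is removed in the same way.
  have hcomm (x y : P) (hx : x ∈ N) (hy : y ∈ N) : x * y * x⁻¹ * y⁻¹ ∈ D := by
    have h₁ : x ^ n * y ^ n * (x ^ n)⁻¹ * (y ^ n)⁻¹ ∈ D := by
      have h := hC (Subgroup.commutator_mem_commutator
        (Subgroup.mem_top (⟨x ^ n, hpow x hx⟩ : K)) (Subgroup.mem_top ⟨y ^ n, hpow y hy⟩))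
      exact hCD _ h
    have h₂ : x ^ n * y * (x ^ n)⁻¹ * y⁻¹ ∈ D :=
      mul_inv_mem_of_pow_mul_inv_pow_mem hD hn (by rwa [conj_pow])
    have h₃ : y * x ^ n * y⁻¹ * (x ^ n)⁻¹ ∈ D := by
      have := D.inv_mem h₂
      simpa only [mul_inv_rev, inv_inv, mul_assoc] using this
    have h₄ : y * x * y⁻¹ * x⁻¹ ∈ D :=
      mul_inv_mem_of_pow_mul_inv_pow_mem hD hn (by rwa [conj_pow])
    have := D.inv_mem h₄
    simpa only [mul_inv_rev, inv_inv, mul_assoc] using this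
  have hx' : (x : P) ∈ D := by
    refine Subgroup.mem_sInf.1 hx (D.comap N.subtype)
      ⟨?_, ⟨fun a ha b hb c hc => hD.out ha hb hc⟩⟩
    rw [commutator_def, Subgroup.commutator_le]
    intro a _ b _
    exact hcomm a b a.2 b.2
  -- An element of `K` in the hull lies between two elements of `C`, hence in `C`, which is convex
  -- in `K`.
  obtain ⟨_, ⟨a, ha, rfl⟩, _, ⟨b, hb, rfl⟩, hax, hxb⟩ := Subgroup.mem_convexHull.1 hx'
  exact hconv.out ha hb ⟨hax, hxb⟩

/-- A subgroup that contains the `n`-th powers of a bi-ordered group has the same rationalized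
maximal ordered abelian quotient. -/
theorem RationalA.exists_equiv_of_pow_mem {N K : Subgroup P} (hKN : K ≤ N) {n : ℕ}
    (hn : n ≠ 0) (hpow : ∀ x ∈ N, x ^ n ∈ K) :
    ∃ e : RationalA K ≃ₗ[ℚ] RationalA N, e.toLinearMap ∘ₗ ofH1 K =
      ofH1 N ∘ₗ RationalH1.map (Subgroup.inclusion hKN) := by
  let ι : MaxOrderedAbelianQuotient K →* MaxOrderedAbelianQuotient N :=
    MaxOrderedAbelianQuotient.map (Subgroup.inclusion hKN) fun a b hab => hab
  let j : RationalA K →ₗ[ℚ] RationalA N :=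
    LinearMap.baseChange ℚ (MonoidHom.toAdditive ι).toIntLinearMap
  have hj : j ∘ₗ ofH1 K = ofH1 N ∘ₗ RationalH1.map (Subgroup.inclusion hKN) :=
    RationalH1.hom_ext fun x => by
      rw [LinearMap.comp_apply, LinearMap.comp_apply, RationalH1.map_of, ofH1_of, ofH1_of]
      rfl
  have hι : Function.Injective ι := by
    rw [injective_iff_map_eq_one]
    intro x hx
    induction x using QuotientGroup.induction_on with | H x =>
    rw [QuotientGroup.eq_one_iff, mem_convexCommutator_iff_inclusion hKN hn hpow]
    exact (QuotientGroup.eq_one_iff _).1 hx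
  refine ⟨LinearEquiv.ofBijective j ⟨?_, ?_⟩, hj⟩
  -- `ℚ` is flat over `ℤ`, so injectivity survives rationalization.
  · exact Module.Flat.lTensor_preserves_injective_linearMap (M := ℚ)
      (MonoidHom.toAdditive ι).toIntLinearMap hι
  · have hs : Function.Surjective (j ∘ₗ ofH1 K) := by
      rw [hj]
      exact (ofH1_surjective N).comp (RationalH1.map_surjective_of_pow_mem _ hn fun x =>
        ⟨⟨x ^ n, hpow x x.2⟩, rfl⟩)
    exact Function.Surjective.of_comp hs

end OrderedQuotient

/-! ### Comparison of the monodromies of a group and of a subgroup -/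

section CharacteristicPolynomials

open Polynomial

variable {P : Type*} [Group P] {N K : Subgroup P} [N.Normal] [K.Normal] {n : ℕ}

/-- On the homology of `N`, `s` acts as the `d`-th power of `t`, and this action is a quotient of
the one on the homology of `K`. -/
theorem charpoly_monodromyH1_dvd_expand (hKN : K ≤ N) (hn : n ≠ 0) (hpow : ∀ x ∈ N, x ^ n ∈ K)
    [FiniteDimensional ℚ (RationalH1 N)] [FiniteDimensional ℚ (RationalH1 K)] {t s : P} {d : ℕ}
    (hs : (t ^ d)⁻¹ * s ∈ N) :
    (monodromyH1 N t).charpoly ∣ expand ℚ d (monodromyH1 K s).charpoly := by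
  have h : monodromyH1 N s = monodromyH1 N t ^ d := by
    rw [← mul_inv_cancel_left (t ^ d) s, monodromyH1_mul, monodromyH1_eq_one N hs, one_mul,
      monodromyH1_pow]
  refine (LinearMap.charpoly_dvd_expand_charpoly_pow _ d).trans (_root_.map_dvd _ ?_)
  rw [← h]
  exact LinearMap.charpoly_dvd_of_surjective (RationalH1.map (Subgroup.inclusion hKN))
    (RationalH1.map_surjective_of_pow_mem _ hn fun x => ⟨⟨x ^ n, hpow x x.2⟩, rfl⟩) _ _
    (map_inclusion_comp_monodromyH1 N hKN s)

variable [LinearOrder P] [MulLeftMono P] [MulRightMono P]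

theorem charpoly_monodromyA_dvd_charpoly_monodromyH1 [FiniteDimensional ℚ (RationalH1 N)]
    [FiniteDimensional ℚ (RationalA N)] (t : P) :
    (monodromyA N t).charpoly ∣ (monodromyH1 N t).charpoly :=
  LinearMap.charpoly_dvd_of_surjective (RationalA.ofH1 N) (RationalA.ofH1_surjective N) _ _
    (RationalA.ofH1_comp_monodromyH1 N t)

/-- Here the comparison map is an isomorphism and not merely onto, so divisibility becomes equality.
-/
theorem charpoly_monodromyA_eq_charpoly_pow (hKN : K ≤ N) (hn : n ≠ 0)
    (hpow : ∀ x ∈ N, x ^ n ∈ K) [FiniteDimensional ℚ (RationalA N)]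
    [FiniteDimensional ℚ (RationalA K)] {t s : P} {d : ℕ} (hs : (t ^ d)⁻¹ * s ∈ N) :
    (monodromyA K s).charpoly = (monodromyA N t ^ d).charpoly := by
  obtain ⟨e, he⟩ := RationalA.exists_equiv_of_pow_mem hKN hn hpow
  have h : monodromyA N s = monodromyA N t ^ d := by
    rw [← mul_inv_cancel_left (t ^ d) s, RationalA.monodromyA_mul_of_mem N _ hs,
      RationalA.monodromyA_pow]
  rw [← h, ← e.charpoly_conj]
  congr 1
  have hc : e.toLinearMap ∘ₗ monodromyA K s = monodromyA N s ∘ₗ e.toLinearMap := by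
    refine RationalA.hom_ext ?_
    rw [LinearMap.comp_assoc, ← RationalA.ofH1_comp_monodromyH1, ← LinearMap.comp_assoc, he,
      LinearMap.comp_assoc, map_inclusion_comp_monodromyH1 N hKN, ← LinearMap.comp_assoc,
      RationalA.ofH1_comp_monodromyH1, LinearMap.comp_assoc, ← he, LinearMap.comp_assoc]
  refine LinearMap.ext fun x => ?_
  rw [LinearEquiv.conj_apply_apply]
  exact (LinearMap.congr_fun hc _).trans (congrArg _ (e.apply_symm_apply x))

end CharacteristicPolynomials

/-! ### Finite generation of the fundamental group of a compact manifold -/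

section FinitelyGenerated

open Topology

theorem unitInterval.quotient_eq {a b : I} (p q : Path a b) :
    Path.Homotopic.Quotient.mk p = Path.Homotopic.Quotient.mk q := by
  have : ContractibleSpace I := (convex_Icc (0 : ℝ) 1).contractibleSpace ⟨0, by simp⟩
  exact Subsingleton.elim _ _

theorem Path.Homotopic.Quotient.trans_mk_cast_refl {X : Type*} [TopologicalSpace X] {a b b' : X}
    (p : Path.Homotopic.Quotient a b) (h : b = b') :
    p.trans (Path.Homotopic.Quotient.mk ((Path.refl b').cast h rfl)) = p.cast rfl h.symm := by
  subst h
  simp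

/-- Instead of subdividing the loop, the proof follows it in time. Being able to close the initial
piece through a nearby point of `T` within `Γ` is a locally constant property of the time, and the
unit interval is connected. -/
theorem FundamentalGroup.mk_mem_of_forall_path_in_ball_mem {X : Type*} [PseudoMetricSpace X]
    {ε : ℝ} (hε : 0 < ε)
    (V : X → Set X) (hV : ∀ x, IsOpen (V x)) (hVc : ∀ x, IsPathConnected (V x))
    (hxV : ∀ x, x ∈ V x) (hVb : ∀ x, V x ⊆ Metric.ball x (ε / 4))
    (T : Set X) (hT : ∀ x, ∃ y ∈ T, x ∈ V y)
    {x₀ : X} (hx₀ : x₀ ∈ T) (c : ∀ x, Path.Homotopic.Quotient x₀ x)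
    (hc : c x₀ = Path.Homotopic.Quotient.refl x₀)
    (Γ : Subgroup (FundamentalGroup X x₀))
    (hΓ : ∀ x ∈ T, ∀ y ∈ T, ∀ e : Path x y, (∀ t, e t ∈ Metric.ball x ε) →
      (((c x).trans (.mk e)).trans (c y).symm : FundamentalGroup X x₀) ∈ Γ)
    (f : C(I, X)) (h0 : f 0 = x₀) (h1 : f 1 = x₀) :
    (Path.Homotopic.Quotient.mk ⟨f, h0, h1⟩ : FundamentalGroup X x₀) ∈ Γ := by
  subst h0
  -- The product in the fundamental group is concatenation in the reverse order.
  have hmul {A B : Path.Homotopic.Quotient (f 0) (f 0)} (hA : (A : FundamentalGroup X (f 0)) ∈ Γ)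
      (hB : (B : FundamentalGroup X (f 0)) ∈ Γ) : (A.trans B : FundamentalGroup X (f 0)) ∈ Γ :=
    Γ.mul_mem hB hA
  have : ContractibleSpace I := (convex_Icc (0 : ℝ) 1).contractibleSpace ⟨0, by simp⟩
  let seg (a b : I) : Path.Homotopic.Quotient (f a) (f b) :=
    .mk ((PathConnectedSpace.somePath a b).map f.continuous)
  have hseg {a b : I} (p : Path a b) : seg a b = .mk (p.map f.continuous) := by
    have := unitInterval.quotient_eq (PathConnectedSpace.somePath a b) p
    exact congrArg (fun q : Path.Homotopic.Quotient a b => q.map f) this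
  have hseg_trans (a b : I) : (seg 0 a).trans (seg a b) = seg 0 b := by
    rw [hseg ((PathConnectedSpace.somePath 0 a).trans (PathConnectedSpace.somePath a b)),
      Path.map_trans]
    rfl
  let good (a : I) : Prop := ∀ y ∈ T, ∀ e : Path (f a) y, (∀ t, e t ∈ V y) →
    (((seg 0 a).trans (.mk e)).trans (c y).symm : FundamentalGroup X (f 0)) ∈ Γ
  have hstep (τ : I) : ∀ᶠ b in 𝓝 τ, good b = good τ := by
    obtain ⟨z, hzT, hz⟩ := hT (f τ)
    have hopen : IsOpen (f ⁻¹' V z) := (hV z).preimage f.continuous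
    have : LocallyPathConnectedSpace I := (convex_Icc (0 : ℝ) 1).locallyPathConnectedSpace
    have hJ : pathComponentIn (f ⁻¹' V z) τ ∈ 𝓝 τ := pathComponentIn_mem_nhds (hopen.mem_nhds hz)
    have hJc : IsPathConnected (pathComponentIn (f ⁻¹' V z) τ) := isPathConnected_pathComponentIn hz
    have key (a b : I) (ha : a ∈ pathComponentIn (f ⁻¹' V z) τ)
        (hb : b ∈ pathComponentIn (f ⁻¹' V z) τ) (hgood : good a) : good b := by
      intro y hy e he
      have haz : f a ∈ V z := Set.mem_preimage.1 (pathComponentIn_subset ha)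
      have hbz : f b ∈ V z := Set.mem_preimage.1 (pathComponentIn_subset hb)
      have hby : f b ∈ V y := by simpa using he 0
      obtain ⟨ea, hea⟩ := (hVc z).joinedIn (f a) haz z (hxV z)
      obtain ⟨j, hj⟩ := hJc.joinedIn a ha b hb
      have hzball : V z ⊆ Metric.ball z ε :=
        (hVb z).trans (Metric.ball_subset_ball (by linarith))
      -- Both sets contain `f b` and have radius `ε / 4`, so points of `V y` have distance less than
      -- `3 ε / 4` from `z`.
      have hyball : V y ⊆ Metric.ball z ε := by
        intro w hw
        have h1 := hVb y hw
        have h2 := hVb y hby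
        have h3 := hVb z hbz
        rw [Metric.mem_ball] at h1 h2 h3 ⊢
        have := dist_triangle4_right w z y (f b)
        have := dist_triangle w y z
        have := dist_triangle y (f b) z
        rw [dist_comm] at h2
        linarith
      -- From `z` back to `f a`, along the loop to `f b`, and on to `y`: a short path, so it
      -- contributes an element of `Γ`.
      let E : Path z y := ea.symm.trans ((j.map f.continuous).trans e)
      have hE : ∀ t, E t ∈ Metric.ball z ε := by
        intro t
        have ht : E t ∈ Set.range E := ⟨t, rfl⟩
        generalize E t = w at ht ⊢
        rw [Path.trans_range, Path.trans_range, Path.symm_range] at ht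
        rcases ht with ⟨t, rfl⟩ | ⟨t, rfl⟩ | ⟨t, rfl⟩
        · exact hzball (hea t)
        · exact hzball (pathComponentIn_subset (hj t) : j t ∈ f ⁻¹' V z)
        · exact hyball (he t)
      have h1 := hgood z hzT ea hea
      have h2 := hmul h1 (hΓ z hzT y hy E hE)
      have heq : (((seg 0 a).trans (.mk ea)).trans (c z).symm).trans
          (((c z).trans (.mk E)).trans (c y).symm) =
          ((seg 0 b).trans (.mk e)).trans (c y).symm := by
        have hE' : Path.Homotopic.Quotient.mk E =
          (Path.Homotopic.Quotient.mk ea).symm.trans ((seg a b).trans (.mk e)) := by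
          rw [hseg j]
          rfl
        rw [hE', ← hseg_trans a b]
        simp only [Path.Homotopic.Quotient.trans_assoc]
        rw [← Path.Homotopic.Quotient.trans_assoc (c z).symm, Path.Homotopic.Quotient.symm_trans,
          Path.Homotopic.Quotient.refl_trans,
          ← Path.Homotopic.Quotient.trans_assoc (Path.Homotopic.Quotient.mk ea),
          Path.Homotopic.Quotient.trans_symm, Path.Homotopic.Quotient.refl_trans]
      rwa [heq] at h2
    filter_upwards [hJ] with b hb
    have hτ := mem_pathComponentIn_self (F := f ⁻¹' V z) hz
    exact propext ⟨key b τ hb hτ, key τ b hτ hb⟩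
  have hconst : good 1 = good 0 :=
    ((IsLocallyConstant.iff_eventually_eq good).2 hstep).apply_eq_of_preconnectedSpace 1 0
  have hgood0 : good 0 := by
    intro y hy e he
    have h0y : f 0 ∈ V y := by simpa using he 0
    have := hΓ (f 0) hx₀ y hy e fun t => by
      have h1 := hVb y (he t)
      have h2 := hVb y h0y
      rw [Metric.mem_ball] at h1 h2 ⊢
      rw [dist_comm] at h2
      have := dist_triangle (e t) y (f 0)
      linarith
    have hs : seg 0 0 = c (f 0) := by
      rw [hc, hseg (Path.refl 0)]
      rfl
    rwa [hs]
  have hgood1 : good 1 := by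
    rw [hconst]
    exact hgood0
  have h := hgood1 (f 0) hx₀ ((Path.refl (f 0)).cast h1 rfl) fun t => hxV (f 0)
  have hsymm : (c (f 0)).symm = Path.Homotopic.Quotient.refl (f 0) := by
    rw [hc]
    rfl
  rw [hsymm, Path.Homotopic.Quotient.trans_refl, Path.Homotopic.Quotient.trans_mk_cast_refl,
    hseg Path.id] at h
  exact h

/-- The fundamental group of a compact path connected space is finitely generated if the space is
locally path connected and every point has a neighborhood that contains no essential loops. -/
theorem FundamentalGroup.fg_of_compactSpace {X : Type*} [PseudoMetricSpace X] [CompactSpace X]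
    [PathConnectedSpace X] [LocallyPathConnectedSpace X]
    (hX : ∀ x : X, ∃ U ∈ 𝓝 x, ∀ (y z : X) (p q : Path y z), (∀ t, p t ∈ U) → (∀ t, q t ∈ U) →
      p.Homotopic q) (x₀ : X) : Group.FG (FundamentalGroup X x₀) := by
  classical
  choose U hU hUloc using hX
  obtain ⟨ε, hε, hball⟩ := lebesgue_number_lemma_of_metric (isCompact_univ (X := X))
    (fun x => isOpen_interior (s := U x))
    fun x _ => Set.mem_iUnion.2 ⟨x, mem_interior_iff_mem_nhds.2 (hU x)⟩
  have hloc (x y z : X) (p q : Path y z) (hp : ∀ t, p t ∈ Metric.ball x ε)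
      (hq : ∀ t, q t ∈ Metric.ball x ε) : p.Homotopic q := by
    obtain ⟨w, hw⟩ := hball x (Set.mem_univ x)
    exact hUloc w y z p q (fun t => interior_subset (hw (hp t)))
      fun t => interior_subset (hw (hq t))
  let V (x : X) : Set X := pathComponentIn (Metric.ball x (ε / 4)) x
  have hxb (x : X) : x ∈ Metric.ball x (ε / 4) := Metric.mem_ball_self (by linarith)
  have hV (x : X) : IsOpen (V x) := Metric.isOpen_ball.pathComponentIn x
  have hxV (x : X) : x ∈ V x := mem_pathComponentIn_self (hxb x)
  obtain ⟨T₀, -, hT₀⟩ := (isCompact_univ (X := X)).elim_nhds_subcover V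
    fun x _ => (hV x).mem_nhds (hxV x)
  let T : Finset X := insert x₀ T₀
  -- The value at `x₀` must be the constant path, so that the closing paths disappear for loops.
  let c : ∀ x, Path.Homotopic.Quotient x₀ x :=
    Function.update (fun x => .mk (PathConnectedSpace.somePath x₀ x)) x₀ (.refl x₀)
  -- Short paths with equal ends are homotopic, so one generator per pair of points of the finite
  -- net suffices.
  let g (z : X × X) : FundamentalGroup X x₀ :=
    if h : ∃ e : Path z.1 z.2, ∀ t, e t ∈ Metric.ball z.1 ε
    then ((c z.1).trans (.mk h.choose)).trans (c z.2).symm else 1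
  let Γ : Subgroup (FundamentalGroup X x₀) := Subgroup.closure ((T ×ˢ T).image g : Finset _)
  have hΓ : ∀ x ∈ T, ∀ y ∈ T, ∀ e : Path x y, (∀ t, e t ∈ Metric.ball x ε) →
      (((c x).trans (.mk e)).trans (c y).symm : FundamentalGroup X x₀) ∈ Γ := by
    intro x hx y hy e he
    have hex : ∃ e : Path x y, ∀ t, e t ∈ Metric.ball x ε := ⟨e, he⟩
    have hg : g (x, y) = ((c x).trans (.mk e)).trans (c y).symm := by
      have hh : Path.Homotopic.Quotient.mk hex.choose = Path.Homotopic.Quotient.mk e :=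
        Path.Homotopic.Quotient.eq.2 (hloc x x y _ _ hex.choose_spec he)
      simp only [g]
      rw [dif_pos hex, hh]
    rw [← hg]
    exact Subgroup.subset_closure (Finset.mem_coe.2 (Finset.mem_image_of_mem g
      (Finset.mem_product.2 ⟨hx, hy⟩)))
  refine Group.fg_def.2 ⟨(T ×ˢ T).image g, ?_⟩
  refine eq_top_iff.2 fun a _ => ?_
  obtain ⟨p, rfl⟩ := Path.Homotopic.Quotient.mk_surjective a
  refine FundamentalGroup.mk_mem_of_forall_path_in_ball_mem hε V hV
    (fun x => isPathConnected_pathComponentIn (hxb x)) hxV (fun x => pathComponentIn_subset)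
    T (fun x => ?_) (Finset.mem_insert_self _ _) c (Function.update_self _ _ _) Γ hΓ
    p.toContinuousMap p.source p.target
  obtain ⟨y, hy, hxy⟩ := Set.mem_iUnion₂.1 (hT₀ (Set.mem_univ x))
  exact ⟨y, Finset.mem_coe.2 (Finset.mem_insert_of_mem hy), hxy⟩

theorem IsSimplyConnected.homotopic {X : Type*} [TopologicalSpace X] {U : Set X}
    (hU : IsSimplyConnected U) {y z : X} (p q : Path y z) (hp : ∀ t, p t ∈ U)
    (hq : ∀ t, q t ∈ U) : p.Homotopic q := by
  have := hU.simplyConnectedSpace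
  let y' : U := ⟨y, by simpa using hp 0⟩
  let z' : U := ⟨z, by simpa using hp 1⟩
  let p' : Path y' z' :=
    { toFun t := ⟨p t, hp t⟩
      source' := Subtype.ext p.source
      target' := Subtype.ext p.target }
  let q' : Path y' z' :=
    { toFun t := ⟨q t, hq t⟩
      source' := Subtype.ext q.source
      target' := Subtype.ext q.target }
  exact (SimplyConnectedSpace.paths_homotopic p' q').map ⟨Subtype.val, continuous_subtype_val⟩

/-- A ball intersected with the half-space is convex; the inverse chart carries it into `X`. -/
theorem exists_isSimplyConnected_mem_nhds {n : ℕ} [NeZero n] {X : Type*} [TopologicalSpace X]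
    [ChartedSpace (EuclideanHalfSpace n) X] (x : X) : ∃ U ∈ 𝓝 x, IsSimplyConnected U := by
  let e := (chartAt (EuclideanHalfSpace n) x).symm
  have hx : chartAt (EuclideanHalfSpace n) x x ∈ e.source := mem_chart_target _ x
  obtain ⟨O, hO, hOe⟩ := isOpen_induced_iff.1 e.open_source
  have hxO : (chartAt (EuclideanHalfSpace n) x x).1 ∈ O := by
    rw [← Set.mem_preimage, hOe]
    exact hx
  obtain ⟨r, hr, hrO⟩ := Metric.isOpen_iff.1 hO _ hxO
  let B := Metric.ball (chartAt (EuclideanHalfSpace n) x x).1 r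
  let W : Set e.source := {h | h.1.1 ∈ B}
  have hW : IsOpen W :=
    Metric.isOpen_ball.preimage (continuous_subtype_val.comp continuous_subtype_val)
  have himage : (fun h : e.source => h.1.1) '' W = {y | 0 ≤ y 0} ∩ B := by
    ext y
    constructor
    · rintro ⟨h, hh, rfl⟩
      exact ⟨h.1.2, hh⟩
    · rintro ⟨hy, hyB⟩
      have : (⟨y, hy⟩ : EuclideanHalfSpace n) ∈ e.source := by
        rw [← hOe]
        exact hrO hyB
      exact ⟨⟨⟨y, hy⟩, this⟩, hyB, rfl⟩
  have hemb : IsEmbedding (fun h : e.source => h.1.1) :=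
    IsEmbedding.subtypeVal.comp IsEmbedding.subtypeVal
  have hWs : IsSimplyConnected W := by
    rw [← hemb.isSimplyConnected_image, himage]
    have hconv : Convex ℝ ({y : EuclideanSpace ℝ (Fin n) | 0 ≤ y 0} ∩ B) :=
      (EuclideanHalfSpace.convex (n := n)).inter (convex_ball _ _)
    have := hconv.contractibleSpace
      ⟨_, (chartAt (EuclideanHalfSpace n) x x).2, Metric.mem_ball_self hr⟩
    exact SimplyConnectedSpace.ofContractible _
  have hopen := e.isOpenEmbedding_restrict
  refine ⟨e.source.domRestrict e '' W, (hopen.isOpenMap _ hW).mem_nhds ?_,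
    hopen.isEmbedding.isSimplyConnected_image.2 hWs⟩
  exact ⟨⟨_, hx⟩, Metric.mem_ball_self hr, (chartAt (EuclideanHalfSpace n) x).left_inv
    (mem_chart_source _ x)⟩

theorem FundamentalGroup.fg_of_chartedSpace_halfSpace {n : ℕ} [NeZero n] {S : Type*}
    [TopologicalSpace S] [T2Space S] [CompactSpace S] [ConnectedSpace S]
    [ChartedSpace (EuclideanHalfSpace n) S] (x : S) : Group.FG (FundamentalGroup S x) := by
  have := Manifold.metrizableSpace (modelWithCornersEuclideanHalfSpace n) S
  let _ := TopologicalSpace.metrizableSpaceMetric S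
  have := ChartedSpace.locallyPathConnectedSpace (EuclideanHalfSpace n) S
  have : PathConnectedSpace S := .of_locallyPathConnectedSpace
  refine FundamentalGroup.fg_of_compactSpace (fun x => ?_) x
  obtain ⟨U, hU, hUs⟩ := exists_isSimplyConnected_mem_nhds (n := n) x
  exact ⟨U, hU, fun y z p q hp hq => hUs.homotopic p q hp hq⟩

end FinitelyGenerated

/-! ### The fiber group as the kernel of the map to the integers -/

section FiberTransport

open Topology Bundle

variable {M S : Type*} [TopologicalSpace M] [TopologicalSpace S]

/-- The fibers of a map to the circle. -/
def CircleFiber (q : C(M, AddCircle (1 : ℝ))) (b : AddCircle (1 : ℝ)) : Type _ := q ⁻¹' {b}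

instance (q : C(M, AddCircle (1 : ℝ))) (b : AddCircle (1 : ℝ)) :
    TopologicalSpace (CircleFiber q b) :=
  inferInstanceAs (TopologicalSpace (q ⁻¹' {b}))

/-- The topology comes from `M`, so that a locally trivial map becomes a `FiberBundle` in the sense
of families of fibers. -/
instance (q : C(M, AddCircle (1 : ℝ))) : TopologicalSpace (TotalSpace S (CircleFiber q)) :=
  .induced (fun z => z.2.1) inferInstance

/-- The total space is the disjoint union of the fibers. -/
def circleTotalSpaceHomeomorph (S : Type*) (q : C(M, AddCircle (1 : ℝ))) :
    TotalSpace S (CircleFiber q) ≃ₜ M where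
  toFun z := z.2.1
  invFun m := ⟨q m, m, rfl⟩
  left_inv := by
    rintro ⟨b, m, rfl⟩
    rfl
  right_inv _ := rfl
  continuous_toFun := continuous_induced_dom
  continuous_invFun := continuous_induced_rng.2 continuous_id

theorem comp_circleTotalSpaceHomeomorph (S : Type*) (q : C(M, AddCircle (1 : ℝ))) :
    q ∘ circleTotalSpaceHomeomorph S q = π S (CircleFiber q) :=
  funext fun z => z.2.2

theorem IsFiberBundleOverCircle.exists_trivialization {q : C(M, AddCircle (1 : ℝ))}
    (hq : IsFiberBundleOverCircle S q) (b : AddCircle (1 : ℝ)) :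
    ∃ e : Trivialization S (π S (CircleFiber q)), b ∈ e.baseSet := by
  obtain ⟨e, he⟩ := hq b
  rw [← comp_circleTotalSpaceHomeomorph S q]
  exact ⟨e.compHomeomorph (circleTotalSpaceHomeomorph S q), he⟩

/-- A locally trivial map to the circle as a fiber bundle. -/
abbrev IsFiberBundleOverCircle.fiberBundle {q : C(M, AddCircle (1 : ℝ))}
    (hq : IsFiberBundleOverCircle S q) : FiberBundle S (CircleFiber q) where
  totalSpaceMk_isInducing' b := by
    have h : IsInducing fun z : TotalSpace S (CircleFiber q) => z.2.1 := ⟨rfl⟩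
    have h' : IsInducing ((fun z : TotalSpace S (CircleFiber q) => z.2.1) ∘
        TotalSpace.mk b) := IsInducing.subtypeVal
    exact h.of_comp_iff.1 h'
  trivializationAtlas' := Set.univ
  trivializationAt' b := (hq.exists_trivialization b).choose
  mem_baseSet_trivializationAt' b := (hq.exists_trivialization b).choose_spec
  trivialization_mem_atlas' _ := Set.mem_univ _

theorem IsFiberBundleOverCircle.surjective [Nonempty S] {q : C(M, AddCircle (1 : ℝ))}
    (hq : IsFiberBundleOverCircle S q) : Function.Surjective q := fun b => by
  obtain ⟨e, he⟩ := hq b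
  exact ⟨_, e.proj_symm_apply' (x := Classical.arbitrary S) he⟩

/-- Over a bounded interval of the universal cover of the circle, points can be transported
between the fibers of a fiber bundle. -/
theorem IsFiberBundleOverCircle.exists_transport [Nonempty S] {q : C(M, AddCircle (1 : ℝ))}
    (hq : IsFiberBundleOverCircle S q) (a b : ℝ) :
    ∃ R : {y : ℝ × M // y.1 ∈ Set.Icc a b ∧ (y.1 : AddCircle (1 : ℝ)) = q y.2} × Set.Icc a b → M,
      Continuous R ∧ (∀ y r, q (R (y, r)) = ((r : ℝ) : AddCircle (1 : ℝ))) ∧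
      ∀ y, R (y, ⟨y.1.1, y.2.1⟩) = y.1.2 := by
  let _ := hq.fiberBundle
  have (b : AddCircle (1 : ℝ)) : Nonempty (CircleFiber q b) :=
    let ⟨m, hm⟩ := hq.surjective b
    ⟨m, hm⟩
  let f : C(ℝ, AddCircle (1 : ℝ)) := ⟨(↑), AddCircle.continuous_mk' 1⟩
  -- The pullback of the bundle to the line is trivial over a compact interval; transport keeps the
  -- fiber coordinate and changes the base point.
  obtain ⟨e, he⟩ := FiberBundle.exists_trivialization_Icc_subset S
    ((f : ℝ → AddCircle (1 : ℝ)) *ᵖ (CircleFiber q)) a b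
  let Y := {y : ℝ × M // y.1 ∈ Set.Icc a b ∧ (y.1 : AddCircle (1 : ℝ)) = q y.2}
  let j (y : Y) : TotalSpace S ((f : ℝ → AddCircle (1 : ℝ)) *ᵖ (CircleFiber q)) :=
    ⟨y.1.1, (⟨y.1.2, y.2.2.symm⟩ : q ⁻¹' {(y.1.1 : AddCircle (1 : ℝ))})⟩
  have hj : Continuous j := by
    rw [(inducing_pullbackTotalSpaceEmbedding S (CircleFiber q) f).continuous_iff]
    exact (continuous_fst.comp continuous_subtype_val).prodMk
      (continuous_induced_rng.2 (continuous_snd.comp continuous_subtype_val))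
  have hjs (y : Y) : j y ∈ e.source := by
    rw [e.mem_source]
    exact he y.2.1
  have ht (r : Set.Icc a b) (s : S) : ((r : ℝ), s) ∈ e.target := e.mem_target.2 (he r.2)
  refine ⟨fun z => (Pullback.lift f (e.toOpenPartialHomeomorph.symm (z.2, (e (j z.1)).2))).2.1,
    ?_, fun y r => ?_, fun y => ?_⟩
  · have h₁ : Continuous fun z : Y × Set.Icc a b => ((z.2 : ℝ), (e (j z.1)).2) :=
      (continuous_subtype_val.comp continuous_snd).prodMk
        (continuous_snd.comp (e.continuousOn.comp_continuous (hj.comp continuous_fst)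
          fun z => hjs z.1))
    have h₂ := e.continuousOn_invFun.comp_continuous h₁ fun z => ht z.2 _
    exact (continuous_induced_dom (f := fun z : TotalSpace S (CircleFiber q) => z.2.1)).comp
      ((Pullback.continuous_lift S (CircleFiber q) f).comp h₂)
  · have h := (Pullback.lift f (e.toOpenPartialHomeomorph.symm ((r : ℝ), (e (j y)).2))).2.2
    have h' : (e.toOpenPartialHomeomorph.symm ((r : ℝ), (e (j y)).2)).proj = r :=
      e.proj_symm_apply (ht r _)
    refine Eq.trans h ?_
    rw [Pullback.lift_proj, h']
    rfl
  · have h : ((y.1.1 : ℝ), (e (j y)).2) = e (j y) :=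
      Prod.ext (e.coe_fst (hjs y)).symm rfl
    simp only
    rw [h]
    have h' : e.toOpenPartialHomeomorph.symm (e (j y)) = j y :=
      e.toOpenPartialHomeomorph.left_inv (hjs y)
    rw [h']
    rfl

variable {q : C(M, AddCircle (1 : ℝ))} {x₀ : M}

theorem AddCircle.exists_lift {A : Type*} [TopologicalSpace A] [SimplyConnectedSpace A]
    [LocallyPathConnectedSpace A] (g : C(A, AddCircle (1 : ℝ))) (a : A) (r : ℝ)
    (hr : (r : AddCircle (1 : ℝ)) = g a) :
    ∃ l : C(A, ℝ), l a = r ∧ ∀ x, ((l x : ℝ) : AddCircle (1 : ℝ)) = g x := by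
  obtain ⟨l, ⟨h₁, h₂⟩, -⟩ :=
    (AddCircle.isCoveringMap_coe (1 : ℝ)).existsUnique_continuousMap_lifts g a r hr
  exact ⟨l, h₁, congrFun h₂⟩

/-- A lift to `ℝ` of a constant map to the circle is constant. -/
theorem AddCircle.lift_eq {A : Type*} [TopologicalSpace A] [PreconnectedSpace A] {l : A → ℝ}
    (hl : Continuous l) (h : ∀ x y, ((l x : ℝ) : AddCircle (1 : ℝ)) = l y) (x y : A) :
    l x = l y :=
  (AddCircle.isCoveringMap_coe (1 : ℝ)).const_of_comp hl h x y

theorem ContinuousMap.exists_forall_mem_Icc {A : Type*} [TopologicalSpace A] [CompactSpace A]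
    (l : C(A, ℝ)) : ∃ a b : ℝ, ∀ x, l x ∈ Set.Icc a b := by
  obtain ⟨a, ha⟩ := (isCompact_range l.continuous).bddBelow
  obtain ⟨b, hb⟩ := (isCompact_range l.continuous).bddAbove
  exact ⟨a, b, fun x => ⟨ha ⟨x, rfl⟩, hb ⟨x, rfl⟩⟩⟩

/-- Lift the projection of a null-homotopy to the line and transport every point of the homotopy to
the fiber over `r₀`. On the boundary of the square the lift is `r₀` already, so nothing moves there.
-/
theorem fiberInclusion_injective [Nonempty S] (hq : IsFiberBundleOverCircle S q) :
    Function.Injective (fiberInclusion q x₀) := by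
  rw [injective_iff_map_eq_one]
  intro p hp
  obtain ⟨γ, rfl⟩ := Path.Homotopic.Quotient.mk_surjective p
  have hγ : (γ.map continuous_subtype_val).Homotopic (Path.refl x₀) :=
    Path.Homotopic.Quotient.exact hp
  obtain ⟨H⟩ := hγ
  have : ContractibleSpace I := (convex_Icc (0 : ℝ) 1).contractibleSpace ⟨0, by simp⟩
  have : LocallyPathConnectedSpace I := (convex_Icc (0 : ℝ) 1).locallyPathConnectedSpace
  obtain ⟨r₀, hr₀⟩ := QuotientAddGroup.mk_surjective (q x₀)
  change (r₀ : AddCircle (1 : ℝ)) = q x₀ at hr₀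
  obtain ⟨l, hl0, hl⟩ := AddCircle.exists_lift (q.comp H.toContinuousMap) (0, 0) r₀ (by
    refine hr₀.trans ?_
    exact congrArg q (H.source 0).symm)
  have hH0 (s : I) : H (0, s) = γ s := H.apply_zero s
  have hH1 (s : I) : H (1, s) = x₀ := H.apply_one s
  have hHs (u : I) : H (u, 0) = x₀ := H.source u
  have hHt (u : I) : H (u, 1) = x₀ := H.target u
  have hl' (z : I × I) : ((l z : ℝ) : AddCircle (1 : ℝ)) = q (H z) := hl z
  -- On each side of the square the projection is constant, hence so is the lift; the four values
  -- agree at common corners.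
  have hl0s (s : I) : l (0, s) = r₀ := by
    rw [← hl0]
    refine AddCircle.lift_eq (l := fun s : I => l (0, s)) (by fun_prop) (fun x y => ?_) s 0
    rw [hl', hl', hH0, hH0]
    exact (γ x).2.trans (γ y).2.symm
  have hlu0 (u : I) : l (u, 0) = r₀ := by
    rw [← hl0]
    refine AddCircle.lift_eq (l := fun u : I => l (u, 0)) (by fun_prop) (fun x y => ?_) u 0
    rw [hl', hl', hHs, hHs]
  have hlu1 (u : I) : l (u, 1) = r₀ := by
    rw [← hl0s 1]
    refine AddCircle.lift_eq (l := fun u : I => l (u, 1)) (by fun_prop) (fun x y => ?_) u 0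
    rw [hl', hl', hHt, hHt]
  have hl1s (s : I) : l (1, s) = r₀ := by
    rw [← hlu0 1]
    refine AddCircle.lift_eq (l := fun s : I => l (1, s)) (by fun_prop) (fun x y => ?_) s 0
    rw [hl', hl', hH1, hH1]
  obtain ⟨a, b, hab⟩ := l.exists_forall_mem_Icc
  obtain ⟨R, hR, hRq, hRy⟩ := hq.exists_transport a b
  have hr₀ab : r₀ ∈ Set.Icc a b := by
    rw [← hl0]
    exact hab _
  let K (z : I × I) : M := R (⟨(l z, H z), hab z, hl' z⟩, ⟨r₀, hr₀ab⟩)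
  have hK : Continuous K := hR.comp (by fun_prop)
  have hKl (z : I × I) (hz : l z = r₀) : K z = H z := by
    have h := hRy ⟨(l z, H z), hab z, hl' z⟩
    refine Eq.trans ?_ h
    exact congrArg (fun r => R (_, r)) (Subtype.ext hz.symm)
  let K' : C(I × I, q ⁻¹' {q x₀}) :=
    ⟨fun z => ⟨K z, (hRq _ _).trans hr₀⟩, Continuous.subtype_mk hK _⟩
  refine Path.Homotopic.Quotient.eq.2 ⟨⟨⟨K', fun s => ?_, fun s => ?_⟩, ?_⟩⟩
  · exact Subtype.ext ((hKl _ (hl0s s)).trans (hH0 s))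
  · exact Subtype.ext ((hKl _ (hl1s s)).trans (hH1 s))
  · rintro u s (rfl | rfl)
    · exact Subtype.ext ((hKl _ (hlu0 u)).trans ((hHs u).trans
        (congrArg Subtype.val γ.source).symm))
    · exact Subtype.ext ((hKl _ (hlu1 u)).trans ((hHt u).trans
        (congrArg Subtype.val γ.target).symm))

/-- A loop of winding number zero has a closed lift, which is contracted linearly to `r₀`; transport
along this contraction pushes the loop into the fiber. -/
theorem fiberInclusion_range_eq_ker [Nonempty S] (hq : IsFiberBundleOverCircle S q)
    {φ : FundamentalGroup M x₀ →* Multiplicative ℤ} (hφ : IsInducedByMapToCircle q φ) :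
    (fiberInclusion q x₀).range = φ.ker := by
  obtain ⟨r₀, hr₀⟩ := QuotientAddGroup.mk_surjective (q x₀)
  change (r₀ : AddCircle (1 : ℝ)) = q x₀ at hr₀
  ext p
  constructor
  · rintro ⟨p, rfl⟩
    obtain ⟨γ, rfl⟩ := Path.Homotopic.Quotient.mk_surjective p
    have h := hφ (γ.map continuous_subtype_val) (.const _ r₀) fun s =>
      hr₀.trans (γ s).2.symm
    rw [ContinuousMap.const_apply, ContinuousMap.const_apply, sub_self, Int.cast_eq_zero,
      toAdd_eq_zero] at h
    exact h
  · intro hp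
    obtain ⟨γ, rfl⟩ := Path.Homotopic.Quotient.mk_surjective p
    have : ContractibleSpace I := (convex_Icc (0 : ℝ) 1).contractibleSpace ⟨0, by simp⟩
    have : LocallyPathConnectedSpace I := (convex_Icc (0 : ℝ) 1).locallyPathConnectedSpace
    obtain ⟨l, hl0, hl⟩ := AddCircle.exists_lift (q.comp γ.toContinuousMap) 0 r₀ (by
      refine hr₀.trans ?_
      exact congrArg q γ.source.symm)
    have hl' (s : I) : ((l s : ℝ) : AddCircle (1 : ℝ)) = q (γ s) := hl s
    have hl1 : l 1 = r₀ := by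
      have h := hφ γ l hl'
      rw [show φ (FundamentalGroup.fromPath (Path.Homotopic.Quotient.mk γ)) = 1 from hp, toAdd_one,
        Int.cast_zero] at h
      linarith
    obtain ⟨a, b, hab⟩ := l.exists_forall_mem_Icc
    obtain ⟨R, hR, hRq, hRy⟩ := hq.exists_transport a b
    have hr₀ab : r₀ ∈ Set.Icc a b := by
      rw [← hl0]
      exact hab _
    have hmem (z : I × I) : (1 - (z.1 : ℝ)) * l z.2 + z.1 * r₀ ∈ Set.Icc a b :=
      (convex_Icc a b) (hab z.2) hr₀ab (sub_nonneg.2 z.1.2.2) z.1.2.1 (by ring)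
    let K (z : I × I) : M :=
      R (⟨(l z.2, γ z.2), hab z.2, hl' z.2⟩, ⟨(1 - (z.1 : ℝ)) * l z.2 + z.1 * r₀, hmem z⟩)
    have hK : Continuous K := hR.comp (by fun_prop)
    have hKl (z : I × I) (hz : (1 - (z.1 : ℝ)) * l z.2 + z.1 * r₀ = l z.2) : K z = γ z.2 := by
      have h := hRy ⟨(l z.2, γ z.2), hab z.2, hl' z.2⟩
      refine Eq.trans ?_ h
      exact congrArg (fun r => R (_, r)) (Subtype.ext hz)
    have hK0 (u : I) : K (u, 0) = x₀ := (hKl _ (by simp only [hl0]; ring)).trans γ.source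
    have hK1 (u : I) : K (u, 1) = x₀ := (hKl _ (by simp only [hl1]; ring)).trans γ.target
    have hKq (s : I) : q (K (1, s)) = q x₀ := by
      refine (hRq _ _).trans (Eq.trans ?_ hr₀)
      simp
    let δ : Path (⟨x₀, rfl⟩ : q ⁻¹' {q x₀}) ⟨x₀, rfl⟩ :=
      { toFun s := ⟨K (1, s), hKq s⟩
        continuous_toFun := Continuous.subtype_mk (by fun_prop) _
        source' := Subtype.ext (hK0 1)
        target' := Subtype.ext (hK1 1) }
    refine ⟨Path.Homotopic.Quotient.mk δ, (Path.Homotopic.Quotient.eq.2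
      ⟨⟨⟨⟨K, hK⟩, fun s => ?_, fun s => ?_⟩, ?_⟩⟩).symm⟩
    · exact hKl _ (by simp)
    · rfl
    · rintro u s (rfl | rfl)
      · exact (hK0 u).trans γ.source.symm
      · exact (hK1 u).trans γ.target.symm

theorem FundamentalGroup.map_surjective_of_homeomorph {X Y : Type*} [TopologicalSpace X]
    [TopologicalSpace Y] (e : X ≃ₜ Y) (x : X) :
    Function.Surjective (FundamentalGroup.map (e : C(X, Y)) x) := by
  intro p
  obtain ⟨γ, rfl⟩ := Path.Homotopic.Quotient.mk_surjective p
  refine ⟨Path.Homotopic.Quotient.mk ((γ.map e.symm.continuous).cast (e.symm_apply_apply x).symm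
    (e.symm_apply_apply x).symm), ?_⟩
  refine congrArg Path.Homotopic.Quotient.mk (Path.ext (funext fun s => ?_))
  exact e.apply_symm_apply (γ s)

/-- The fiber group of a fibration over the circle whose fiber is a compact connected manifold with
boundary is finitely generated. -/
theorem IsFiberBundleOverCircle.fg_ker {n : ℕ} [NeZero n] [T2Space S] [CompactSpace S]
    [ConnectedSpace S] [ChartedSpace (EuclideanHalfSpace n) S] (hq : IsFiberBundleOverCircle S q)
    {φ : FundamentalGroup M x₀ →* Multiplicative ℤ} (hφ : IsInducedByMapToCircle q φ) :
    Group.FG φ.ker := by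
  rw [← fiberInclusion_range_eq_ker hq hφ]
  obtain ⟨e, he⟩ := hq (q x₀)
  let h : S ≃ₜ q ⁻¹' {q x₀} := (e.preimageSingletonHomeomorph he).symm
  have h₁ : Group.FG (FundamentalGroup (q ⁻¹' {q x₀}) ⟨x₀, rfl⟩) := by
    have hfg := FundamentalGroup.fg_of_chartedSpace_halfSpace (n := n) (h.symm ⟨x₀, rfl⟩)
    have := Group.fg_of_surjective (FundamentalGroup.map_surjective_of_homeomorph h
      (h.symm ⟨x₀, rfl⟩))
    have hx : (h : C(S, q ⁻¹' {q x₀})) (h.symm ⟨x₀, rfl⟩) = ⟨x₀, rfl⟩ := h.apply_symm_apply _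
    rwa [hx] at this
  exact Group.fg_of_surjective (fiberInclusion q x₀).rangeRestrict_surjective

end FiberTransport

/-! ### Points and edges of the universal cover -/

section LiftedSimplices

variable {X : Type*} [TopologicalSpace X] {x₀ : X}

namespace LiftedSimplex

theorem mk_eq_mk {n : ℕ} {ψ τ : C(stdSimplex ℝ (Fin (n + 1)), X)} (h : ψ = τ)
    {c : Path.Homotopic.Quotient x₀ (ψ (stdSimplex.vertex 0))}
    {c' : Path.Homotopic.Quotient x₀ (τ (stdSimplex.vertex 0))} (hc : HEq c c') :
    mk ψ c = mk τ c' := by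
  subst h
  cases hc
  rfl

/-- The point of the universal cover in which a lifted simplex takes the value of `v`. -/
def point {n : ℕ} (s : LiftedSimplex x₀ n) (v : stdSimplex ℝ (Fin (n + 1))) :
    LiftedSimplex x₀ 0 :=
  ⟨ContinuousMap.const _ (s.simplex v), s.path.trans (Path.Homotopic.Quotient.mk
    ((simplexSegment (stdSimplex.vertex 0) v).map s.simplex.continuous))⟩

theorem point_act {n : ℕ} (s : LiftedSimplex x₀ n) (v : stdSimplex ℝ (Fin (n + 1)))
    (g : FundamentalGroup X x₀) : (s.act g).point v = (s.point v).act g :=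
  congrArg (LiftedSimplex.mk _) (Path.Homotopic.Quotient.trans_assoc _ _ _)

theorem simplexSegment_self {n : ℕ} (v : stdSimplex ℝ (Fin (n + 1))) :
    simplexSegment v v = Path.refl v := by
  exact Path.ext (funext fun t => Subtype.ext (AffineMap.lineMap_same_apply (k := ℝ) v.1 _))

theorem point_vertex_zero {n : ℕ} (s : LiftedSimplex x₀ n) :
    s.point (stdSimplex.vertex 0) = ⟨ContinuousMap.const _ (s.simplex _), s.path⟩ := by
  refine congrArg (LiftedSimplex.mk _) ?_
  rw [simplexSegment_self]
  exact Path.Homotopic.Quotient.trans_refl _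

theorem point_eq_self (p : LiftedSimplex x₀ 0) : p.point (stdSimplex.vertex 0) = p := by
  rw [point_vertex_zero]
  refine mk_eq_mk ?_ HEq.rfl
  exact ContinuousMap.ext fun v => congrArg p.simplex
    (Subsingleton.elim (α := stdSimplex ℝ (Fin 1)) _ _)

theorem stdSimplex_quotient_eq {n : ℕ} {a b : stdSimplex ℝ (Fin (n + 1))} (p q : Path a b) :
    Path.Homotopic.Quotient.mk p = Path.Homotopic.Quotient.mk q := by
  have : ContractibleSpace (stdSimplex ℝ (Fin (n + 1))) :=
    (convex_stdSimplex ℝ (Fin (n + 1))).contractibleSpace ⟨_, (stdSimplex.vertex 0).2⟩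
  exact Subsingleton.elim _ _

/-- A simplex is contractible, so the two routes from its first vertex to the given point are
homotopic. -/
theorem point_face {n : ℕ} (s : LiftedSimplex x₀ (n + 1)) (i : Fin (n + 2))
    (v : stdSimplex ℝ (Fin (n + 1))) : (s.face i).point v = s.point (simplexFace n i v) := by
  refine congrArg (LiftedSimplex.mk _) ?_
  refine (Path.Homotopic.Quotient.trans_assoc _ _ _).trans (congrArg _ ?_)
  let A := simplexSegment (stdSimplex.vertex 0) (simplexFace n i (stdSimplex.vertex 0))
  let B := (simplexSegment (stdSimplex.vertex 0) v).map (simplexFace n i).continuous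
  have h := congrArg (fun c => Path.Homotopic.Quotient.map c s.simplex)
    (stdSimplex_quotient_eq (A.trans B)
      (simplexSegment (stdSimplex.vertex 0) (simplexFace n i v)))
  exact (congrArg Path.Homotopic.Quotient.mk (Path.map_trans A B s.simplex.continuous)).symm.trans h

theorem simplexFace_vertex (n : ℕ) (i : Fin (n + 2)) (j : Fin (n + 1)) :
    simplexFace n i (stdSimplex.vertex j) = stdSimplex.vertex (i.succAbove j) :=
  stdSimplex.map_vertex _ _

theorem face_eq_point (s : LiftedSimplex x₀ 1) (i : Fin 2) :
    s.face i = s.point (stdSimplex.vertex (i.succAbove 0)) := by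
  rw [← point_eq_self (s.face i), point_face, simplexFace_vertex]

/-- The singular `1`-simplex of the universal cover that belongs to a path. -/
def edge {x y : X} (γ : Path x y) (c : Path.Homotopic.Quotient x₀ x) : LiftedSimplex x₀ 1 :=
  ⟨γ.toContinuousMap.comp (stdSimplexHomeomorphUnitInterval : C(stdSimplex ℝ (Fin 2), I)),
    c.cast rfl (by
      refine (congrArg γ stdSimplexHomeomorphUnitInterval_zero).trans γ.source)⟩

theorem trans_cast {x y z z' : X} (a : Path.Homotopic.Quotient x y)
    (b : Path.Homotopic.Quotient y z) (h : z' = z) :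
    a.trans (b.cast rfl h) = (a.trans b).cast rfl h := by
  subst h
  simp

theorem edge_act {x y : X} (γ : Path x y) (c : Path.Homotopic.Quotient x₀ x)
    (g : FundamentalGroup X x₀) :
    (edge γ c).act g = edge γ ((FundamentalGroup.toPath g).trans c) := by
  exact congrArg (LiftedSimplex.mk _) (trans_cast _ _ _)

theorem eq_edge (s : LiftedSimplex x₀ 1) :
    s = edge ((simplexSegment (stdSimplex.vertex 0) (stdSimplex.vertex 1)).map
      s.simplex.continuous) s.path := by
  refine mk_eq_mk ?_ (Path.Homotopic.Quotient.cast_heq _ _).symm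
  ext v
  refine congrArg s.simplex (stdSimplex.ext (funext fun i => ?_))
  change _ = AffineMap.lineMap (k := ℝ) (stdSimplex.vertex (S := ℝ) (0 : Fin 2)).1
    (stdSimplex.vertex (S := ℝ) (1 : Fin 2)).1 (v 1) i
  have h := stdSimplex.add_eq_one v
  rw [AffineMap.lineMap_apply_module, ← h, add_sub_cancel_right]
  fin_cases i <;> simp

end LiftedSimplex

end LiftedSimplices

/-! ### Classes of 1-chains modulo boundaries depend on homotopy classes of paths -/

section TwistedClasses

variable {X : Type*} [TopologicalSpace X] {x₀ : X}

/-- The straight path between two points of the plane. -/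
def planeSegment (a b : ℝ × ℝ) : Path a b where
  toFun s := AffineMap.lineMap (k := ℝ) a b (s : ℝ)
  continuous_toFun := by
    simp only [AffineMap.lineMap_apply_module]
    fun_prop
  source' := by simp
  target' := by simp

/-- The affine map from a standard simplex to the plane with the given values at the vertices. -/
def planeSimplex {n : ℕ} (v : Fin (n + 1) → ℝ × ℝ) : C(stdSimplex ℝ (Fin (n + 1)), ℝ × ℝ) where
  toFun x := ∑ i, x.1 i • v i
  continuous_toFun := continuous_finsetSum _ fun i _ =>
    ((continuous_apply i).comp continuous_subtype_val).smul continuous_const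

theorem planeSimplex_vertex {n : ℕ} (v : Fin (n + 1) → ℝ × ℝ) (i : Fin (n + 1)) :
    planeSimplex v (stdSimplex.vertex i) = v i := by
  change ∑ j, (Pi.single i (1 : ℝ) : Fin (n + 1) → ℝ) j • v j = v i
  rw [Finset.sum_eq_single i (fun j _ hj => by simp [hj]) (by simp)]
  simp

theorem planeSimplex_simplexSegment {n : ℕ} (v : Fin (n + 1) → ℝ × ℝ)
    (a b : stdSimplex ℝ (Fin (n + 1))) (t : I) :
    planeSimplex v (simplexSegment a b t) =
      AffineMap.lineMap (k := ℝ) (planeSimplex v a) (planeSimplex v b) (t : ℝ) := by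
  change ∑ i, (AffineMap.lineMap (k := ℝ) a.1 b.1 (t : ℝ) : Fin (n + 1) → ℝ) i • v i =
    AffineMap.lineMap (k := ℝ) (∑ i, a.1 i • v i) (∑ i, b.1 i • v i) (t : ℝ)
  simp only [AffineMap.lineMap_apply_module, Pi.add_apply, Pi.smul_apply, smul_eq_mul, add_smul,
    Finset.sum_add_distrib, Finset.smul_sum, mul_smul]

theorem planeSimplex_simplexFace {n : ℕ} (v : Fin (n + 2) → ℝ × ℝ) (i : Fin (n + 2))
    (x : stdSimplex ℝ (Fin (n + 1))) :
    planeSimplex v (simplexFace n i x) = planeSimplex (fun j => v (i.succAbove j)) x := by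
  change ∑ j, (stdSimplex.map i.succAbove x) j • v j = ∑ j, x.1 j • v (i.succAbove j)
  rw [Fin.sum_univ_succAbove _ i]
  have h (j : Fin (n + 2)) : (stdSimplex.map i.succAbove x) j =
      ∑ k ∈ Finset.univ.filter (fun k => i.succAbove k = j), x.1 k := by
    rw [stdSimplex.map_coe, FunOnFinite.linearMap_apply_apply]
    rfl
  simp only [h, Fin.succAbove_ne, Finset.filter_false, Finset.sum_empty, zero_smul, zero_add]
  refine Finset.sum_congr rfl fun j _ => ?_
  simp only [Fin.succAbove_right_inj, Finset.filter_eq', Finset.mem_univ, if_true,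
    Finset.sum_singleton]

namespace LiftedSimplex

/-- The singular `2`-simplex of the universal cover that belongs to a map from the plane and a
triangle in the plane. -/
def triangle (F : C(ℝ × ℝ, X)) (v : Fin 3 → ℝ × ℝ)
    (c : Path.Homotopic.Quotient x₀ (F (v 0))) : LiftedSimplex x₀ 2 :=
  ⟨F.comp (planeSimplex v), c.cast rfl (congrArg F (planeSimplex_vertex v 0))⟩

theorem face_triangle (F : C(ℝ × ℝ, X)) (v : Fin 3 → ℝ × ℝ)
    (c : Path.Homotopic.Quotient x₀ (F (v 0))) (i : Fin 3) :
    (triangle F v c).face i =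
      edge ((planeSegment (v (i.succAbove 0)) (v (i.succAbove 1))).map F.continuous)
        (c.trans (Path.Homotopic.Quotient.mk
          ((planeSegment (v 0) (v (i.succAbove 0))).map F.continuous))) := by
  obtain ⟨γ, rfl⟩ := Path.Homotopic.Quotient.mk_surjective c
  refine mk_eq_mk ?_ ?_
  · ext x
    refine congrArg F ?_
    refine (planeSimplex_simplexFace v i x).trans ?_
    have h := stdSimplex.add_eq_one x
    change ∑ j : Fin 2, x j • v (i.succAbove j) =
      AffineMap.lineMap (k := ℝ) (v (i.succAbove 0)) (v (i.succAbove 1)) (x 1)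
    rw [AffineMap.lineMap_apply_module, Fin.sum_univ_two, ← h, add_sub_cancel_right]
  · refine HEq.trans ?_ (Path.Homotopic.Quotient.cast_heq _ _).symm
    -- The end points agree only propositionally, so the two paths are compared pointwise.
    refine Path.Homotopic.hpath_hext
      (p₁ := (γ.cast rfl (congrArg F (planeSimplex_vertex v 0))).trans
      ((simplexSegment (stdSimplex.vertex 0) (simplexFace 1 i (stdSimplex.vertex 0))).map
        (F.comp (planeSimplex v)).continuous))
      (p₂ := γ.trans ((planeSegment (v 0) (v (i.succAbove 0))).map F.continuous)) fun t => ?_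
    rw [Path.trans_apply, Path.trans_apply]
    split_ifs with h
    · rfl
    · refine congrArg F ?_
      refine (planeSimplex_simplexSegment v _ _ _).trans ?_
      rw [simplexFace_vertex, planeSimplex_vertex, planeSimplex_vertex]
      rfl

end LiftedSimplex

variable {R W : Type*} [CommRing R] [AddCommGroup W] [Module R W]
variable (ρ : Representation R (FundamentalGroup X x₀) W)

/-- Twisted `1`-chains modulo boundaries. -/
abbrev TwistedChainClass : Type _ := TwistedChains ρ 1 ⧸ LinearMap.range (twistedBoundary ρ 1)

namespace TwistedChainClass

/-- The class of a chain. -/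
def mk : (LiftedSimplex x₀ 1 →₀ W) →ₗ[R] TwistedChainClass ρ :=
  Submodule.mkQ _ ∘ₗ Submodule.mkQ _

theorem mk_single_act (s : LiftedSimplex x₀ 1) (g : FundamentalGroup X x₀) (w : W) :
    mk ρ (Finsupp.single (s.act g) w) = mk ρ (Finsupp.single s (ρ g w)) := by
  refine congrArg (Submodule.mkQ _) ?_
  rw [← sub_eq_zero, ← map_sub]
  exact (Submodule.Quotient.mk_eq_zero _).2 (Submodule.subset_span ⟨s, g, w, rfl⟩)

theorem liftedBoundary_one_single (s : LiftedSimplex x₀ 2) (w : W) :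
    liftedBoundary R W x₀ 1 (Finsupp.single s w) = Finsupp.single (s.face 0) w -
      Finsupp.single (s.face 1) w + Finsupp.single (s.face 2) w := by
  refine (LinearMap.sum_apply _ _ _).trans ((Fin.sum_univ_three _).trans ?_)
  simp [sub_eq_add_neg]

theorem mk_face (s : LiftedSimplex x₀ 2) (w : W) :
    mk ρ (Finsupp.single (s.face 1) w) =
      mk ρ (Finsupp.single (s.face 2) w) + mk ρ (Finsupp.single (s.face 0) w) := by
  have h : mk ρ (liftedBoundary R W x₀ 1 (Finsupp.single s w)) = 0 :=
    (Submodule.Quotient.mk_eq_zero _).2 ⟨Submodule.Quotient.mk (Finsupp.single s w), rfl⟩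
  rw [liftedBoundary_one_single, map_add, map_sub] at h
  rw [← sub_eq_zero, ← neg_eq_zero, ← h]
  abel

/-- The class of the singular simplex that belongs to a path. -/
def path {x y : X} (γ : Path x y) (c : Path.Homotopic.Quotient x₀ x) :
    W →ₗ[R] TwistedChainClass ρ :=
  mk ρ ∘ₗ Finsupp.lsingle (LiftedSimplex.edge γ c)

/-- The boundary of the triangle vanishes. The later relations between paths all come from suitable
maps of the plane. -/
theorem path_eq_add_of_triangle (F : C(ℝ × ℝ, X)) (a b e : ℝ × ℝ) {x y z : X} (α : Path x y)
    (β : Path y z) (γ : Path x z)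
    (hα : ∀ t : I, F (AffineMap.lineMap (k := ℝ) a b (t : ℝ)) = α t)
    (hβ : ∀ t : I, F (AffineMap.lineMap (k := ℝ) b e (t : ℝ)) = β t)
    (hγ : ∀ t : I, F (AffineMap.lineMap (k := ℝ) a e (t : ℝ)) = γ t)
    (c : Path.Homotopic.Quotient x₀ x) :
    path ρ γ c = path ρ α c + path ρ β (c.trans (Path.Homotopic.Quotient.mk α)) := by
  obtain rfl : F a = x := by simpa using hα 0
  obtain rfl : F b = y := by simpa using hβ 0
  obtain rfl : F e = z := by simpa using hβ 1
  obtain rfl : α = (planeSegment a b).map F.continuous := Path.ext (funext fun t => (hα t).symm)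
  obtain rfl : β = (planeSegment b e).map F.continuous := Path.ext (funext fun t => (hβ t).symm)
  obtain rfl : γ = (planeSegment a e).map F.continuous := Path.ext (funext fun t => (hγ t).symm)
  refine LinearMap.ext fun w => ?_
  have h (i : Fin 3) := congrArg (fun s => mk ρ (Finsupp.single s w))
    (LiftedSimplex.face_triangle F ![a, b, e] c i)
  replace h := (h 1).symm.trans ((mk_face ρ (LiftedSimplex.triangle F ![a, b, e] c) w).trans
    (congrArg₂ (· + ·) (h 2) (h 0)))
  -- Two of the three faces start at the first vertex, where the lift is `c` up to a constant path.
  have h' : c.trans (Path.Homotopic.Quotient.mk ((planeSegment a a).map F.continuous)) = c := by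
    have : planeSegment a a = Path.refl a :=
      Path.ext (funext fun t => AffineMap.lineMap_same_apply (k := ℝ) a _)
    rw [this]
    exact Path.Homotopic.Quotient.trans_refl _
  change mk ρ (Finsupp.single (LiftedSimplex.edge ((planeSegment a e).map F.continuous)
    (c.trans (Path.Homotopic.Quotient.mk ((planeSegment a a).map F.continuous)))) w) =
    mk ρ (Finsupp.single (LiftedSimplex.edge ((planeSegment a b).map F.continuous)
    (c.trans (Path.Homotopic.Quotient.mk ((planeSegment a a).map F.continuous)))) w) + _ at h
  rw [h'] at h
  exact h

theorem path_refl (x : X) (c : Path.Homotopic.Quotient x₀ x) : path ρ (Path.refl x) c = 0 := by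
  have h := path_eq_add_of_triangle ρ (ContinuousMap.const _ x) 0 0 0 (Path.refl x) (Path.refl x)
    (Path.refl x) (fun _ => rfl) (fun _ => rfl) (fun _ => rfl) c
  rw [Path.Homotopic.Quotient.mk_refl, Path.Homotopic.Quotient.trans_refl] at h
  exact left_eq_add.1 h

/-- Cut the square of the homotopy along its diagonal `δ`. The two constant sides contribute zero,
so both paths have the class of `δ`. -/
theorem path_eq_of_homotopic {x y : X} {γ γ' : Path x y} (h : γ.Homotopic γ')
    (c : Path.Homotopic.Quotient x₀ x) : path ρ γ c = path ρ γ' c := by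
  obtain ⟨H⟩ := h
  let F : C(ℝ × ℝ, X) := ⟨fun z => H (Set.projIcc 0 1 zero_le_one z.1,
    Set.projIcc 0 1 zero_le_one z.2), by fun_prop⟩
  have hF (a b : I) : F ((a : ℝ), (b : ℝ)) = H (a, b) := by
    change H (Set.projIcc 0 1 zero_le_one (a : ℝ), Set.projIcc 0 1 zero_le_one (b : ℝ)) = _
    rw [Set.projIcc_val, Set.projIcc_val]
  let δ : Path x y := ⟨⟨fun t => H (t, t), by fun_prop⟩, H.source 0, H.target 1⟩
  have hline (a b : ℝ × ℝ) (t : I) : AffineMap.lineMap (k := ℝ) a b (t : ℝ) =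
      ((1 - t) * a.1 + t * b.1, (1 - t) * a.2 + t * b.2) := by
    rw [AffineMap.lineMap_apply_module]
    rfl
  have hδ (t : I) : F (AffineMap.lineMap (k := ℝ) (0, 0) (1, 1) (t : ℝ)) = δ t := by
    rw [hline]
    simp only [mul_zero, mul_one, zero_add]
    exact hF t t
  have h₁ := path_eq_add_of_triangle ρ F (0, 0) (1, 0) (1, 1) (Path.refl x) γ' δ
    (fun t => by
      rw [hline]
      simpa using hF t 0)
    (fun t => by
      rw [hline]
      simpa using hF 1 t) hδ c
  have h₂ := path_eq_add_of_triangle ρ F (0, 0) (0, 1) (1, 1) γ (Path.refl y) δ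
    (fun t => by
      rw [hline]
      simpa using hF 0 t)
    (fun t => by
      rw [hline]
      simpa using hF t 1) hδ c
  rw [path_refl, Path.Homotopic.Quotient.mk_refl, Path.Homotopic.Quotient.trans_refl, zero_add]
    at h₁
  rw [path_refl, add_zero] at h₂
  rw [← h₁, ← h₂]

/-- Use a degenerate triangle with collinear vertices at `0`, `1 / 2` and `1`. -/
theorem path_trans {x y z : X} (α : Path x y) (β : Path y z)
    (c : Path.Homotopic.Quotient x₀ x) :
    path ρ (α.trans β) c = path ρ α c + path ρ β (c.trans (Path.Homotopic.Quotient.mk α)) := by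
  have hline (a b : ℝ × ℝ) (t : I) : AffineMap.lineMap (k := ℝ) a b (t : ℝ) =
      ((1 - t) * a.1 + t * b.1, (1 - t) * a.2 + t * b.2) := by
    rw [AffineMap.lineMap_apply_module]
    rfl
  let F : C(ℝ × ℝ, X) := ⟨fun z => (α.trans β).extend z.1, by fun_prop⟩
  have hF (a : I) (b : ℝ) : F ((a : ℝ), b) = α.trans β a := (α.trans β).extend_extends' a
  refine path_eq_add_of_triangle ρ F (0, 0) (1 / 2, 0) (1, 0) α β _ (fun t => ?_) (fun t => ?_)
    (fun t => ?_) c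
  · have ht : (t : ℝ) / 2 ∈ I := ⟨by linarith [t.2.1], by linarith [t.2.2]⟩
    rw [hline]
    have : (1 - (t : ℝ)) * 0 + t * (1 / 2) = (⟨(t : ℝ) / 2, ht⟩ : I) := by
      simp; ring
    simp only
    rw [this, hF, Path.trans_apply, dif_pos (by simp; linarith [t.2.2])]
    exact congrArg α (Subtype.ext (by simp; ring))
  · have ht : (1 + (t : ℝ)) / 2 ∈ I := ⟨by linarith [t.2.1], by linarith [t.2.2]⟩
    rw [hline]
    have : (1 - (t : ℝ)) * (1 / 2) + t * 1 = (⟨(1 + (t : ℝ)) / 2, ht⟩ : I) := by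
      simp; ring
    simp only
    rw [this, hF]
    by_cases h0 : (t : ℝ) = 0
    · obtain rfl : t = 0 := Subtype.ext h0
      rw [Path.trans_apply, dif_pos (by simp)]
      simp
    · have : 0 < (t : ℝ) := lt_of_le_of_ne t.2.1 (Ne.symm h0)
      rw [Path.trans_apply, dif_neg (by simp; linarith)]
      exact congrArg β (Subtype.ext (by simp; ring))
  · rw [hline]
    simpa using hF t ((1 - t) * 0 + t * 0)

end TwistedChainClass

end TwistedClasses

/-! ### Closing up paths, and cones over the vertices of a chain -/

section OrbitDecomposition

variable {X : Type*} [TopologicalSpace X] {x₀ : X}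

/-- Close up a path from the base point to a loop, equivariantly with respect to the action of the
fundamental group on such paths. -/
def FundamentalGroup.closeUp {x : X} (c : Path.Homotopic.Quotient x₀ x) : FundamentalGroup X x₀ :=
  -- By proof irrelevance the chosen return path depends only on the end point of `c'`, not on `c'`;
  -- this gives equivariance.
  let b {y : X} (c' : Path.Homotopic.Quotient x₀ y) : FundamentalGroup X x₀ :=
    fromPath (c'.trans (Classical.choice ⟨c'⟩ : Path.Homotopic.Quotient x₀ y).symm)
  -- The first factor normalizes the value at the constant path to `1`.
  (b (.refl x₀))⁻¹ * b c

namespace FundamentalGroup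

theorem closeUp_trans {x : X} (g : FundamentalGroup X x₀) (c : Path.Homotopic.Quotient x₀ x) :
    closeUp ((toPath g).trans c) = closeUp c * g := by
  rw [closeUp, closeUp, mul_assoc]
  exact congrArg _ (Path.Homotopic.Quotient.trans_assoc _ _ _)

theorem closeUp_refl : closeUp (.refl x₀) = (1 : FundamentalGroup X x₀) := inv_mul_cancel _

theorem closeUp_toPath (g : FundamentalGroup X x₀) : closeUp (toPath g) = g := by
  have h := closeUp_trans g (.refl x₀)
  rwa [closeUp_refl, one_mul, Path.Homotopic.Quotient.trans_refl] at h

theorem closeUp_congr {x y : X} (h : x = y) {c : Path.Homotopic.Quotient x₀ x}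
    {c' : Path.Homotopic.Quotient x₀ y} (hc : HEq c c') : closeUp c = closeUp c' := by
  subst h
  cases hc
  rfl

end FundamentalGroup

namespace LiftedSimplex

theorem closeUp_point_edge_zero {x y : X} (γ : Path x y) (c : Path.Homotopic.Quotient x₀ x) :
    FundamentalGroup.closeUp ((edge γ c).point (stdSimplex.vertex 0)).path =
      FundamentalGroup.closeUp c := by
  rw [point_vertex_zero]
  exact FundamentalGroup.closeUp_congr
    ((congrArg γ stdSimplexHomeomorphUnitInterval_zero).trans γ.source)
    (Path.Homotopic.Quotient.cast_heq _ _)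

theorem path_point_edge_one_heq {x y : X} (γ : Path x y) (c : Path.Homotopic.Quotient x₀ x) :
    HEq ((edge γ c).point (stdSimplex.vertex 1)).path
      (c.trans (Path.Homotopic.Quotient.mk γ)) := by
  obtain ⟨δ, rfl⟩ := Path.Homotopic.Quotient.mk_surjective c
  have h0 : (edge γ (Path.Homotopic.Quotient.mk δ)).simplex (stdSimplex.vertex 0) = x :=
    (congrArg γ stdSimplexHomeomorphUnitInterval_zero).trans γ.source
  refine Path.Homotopic.hpath_hext (p₁ := (δ.cast rfl h0).trans
    ((simplexSegment (stdSimplex.vertex 0) (stdSimplex.vertex 1)).map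
      (edge γ (Path.Homotopic.Quotient.mk δ)).simplex.continuous)) (p₂ := δ.trans γ) fun t => ?_
  rw [Path.trans_apply, Path.trans_apply]
  split_ifs with h
  · rfl
  · refine congrArg γ (Subtype.ext ?_)
    change (AffineMap.lineMap (k := ℝ) (stdSimplex.vertex (S := ℝ) (0 : Fin 2)).1
      (stdSimplex.vertex (S := ℝ) (1 : Fin 2)).1 (2 * (t : ℝ) - 1) : Fin 2 → ℝ) 1 = 2 * (t : ℝ) - 1
    rw [AffineMap.lineMap_apply_module]
    simp

theorem closeUp_point_edge_one {x y : X} (γ : Path x y) (c : Path.Homotopic.Quotient x₀ x) :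
    FundamentalGroup.closeUp ((edge γ c).point (stdSimplex.vertex 1)).path =
      FundamentalGroup.closeUp (c.trans (Path.Homotopic.Quotient.mk γ)) :=
  FundamentalGroup.closeUp_congr
    ((congrArg γ stdSimplexHomeomorphUnitInterval_one).trans γ.target)
    (path_point_edge_one_heq γ c)

/-- The ends of a lifted loop differ by the action of its class, so with a coefficient fixed by that
class the edge is a twisted cycle. -/
theorem point_edge_one (γ : Path x₀ x₀) :
    (edge γ (.refl x₀)).point (stdSimplex.vertex 1) =
      ((edge γ (.refl x₀)).point (stdSimplex.vertex 0)).act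
        (FundamentalGroup.fromPath (Path.Homotopic.Quotient.mk γ)) := by
  rw [point_vertex_zero]
  have h : (edge γ (.refl x₀)).simplex (stdSimplex.vertex 0) = x₀ :=
    (congrArg γ stdSimplexHomeomorphUnitInterval_zero).trans γ.source
  have h' : (edge γ (.refl x₀)).simplex (stdSimplex.vertex 1) = x₀ :=
    (congrArg γ stdSimplexHomeomorphUnitInterval_one).trans γ.target
  refine mk_eq_mk (congrArg (ContinuousMap.const _) (h'.trans h.symm)) ?_
  refine HEq.trans (path_point_edge_one_heq γ (.refl x₀)) ?_
  refine HEq.trans ?_ (heq_of_eq (trans_cast (Path.Homotopic.Quotient.mk γ) (.refl x₀) h)).symm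
  rw [Path.Homotopic.Quotient.refl_trans, Path.Homotopic.Quotient.trans_refl]
  exact (Path.Homotopic.Quotient.cast_heq _ _).symm

end LiftedSimplex

variable {R W : Type*} [CommRing R] [AddCommGroup W] [Module R W]
variable (ρ : Representation R (FundamentalGroup X x₀) W)

namespace TwistedChainClass

/-- The class of the singular simplex that belongs to a homotopy class of paths. -/
def pathClass {x y : X} (a : Path.Homotopic.Quotient x y) (c : Path.Homotopic.Quotient x₀ x) :
    W →ₗ[R] TwistedChainClass ρ :=
  path ρ (Path.Homotopic.Quotient.mk_surjective a).choose c

theorem pathClass_mk {x y : X} (γ : Path x y) (c : Path.Homotopic.Quotient x₀ x) :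
    pathClass ρ (Path.Homotopic.Quotient.mk γ) c = path ρ γ c :=
  path_eq_of_homotopic ρ (Path.Homotopic.Quotient.exact
    (Path.Homotopic.Quotient.mk_surjective (Path.Homotopic.Quotient.mk γ)).choose_spec) c

theorem pathClass_trans {x y z : X} (a : Path.Homotopic.Quotient x y)
    (b : Path.Homotopic.Quotient y z) (c : Path.Homotopic.Quotient x₀ x) :
    pathClass ρ (a.trans b) c = pathClass ρ a c + pathClass ρ b (c.trans a) := by
  obtain ⟨α, rfl⟩ := Path.Homotopic.Quotient.mk_surjective a
  obtain ⟨β, rfl⟩ := Path.Homotopic.Quotient.mk_surjective b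
  rw [← Path.Homotopic.Quotient.mk_trans, pathClass_mk, pathClass_mk, pathClass_mk, path_trans]

theorem pathClass_act {x y : X} (a : Path.Homotopic.Quotient x y)
    (g : FundamentalGroup X x₀) (c : Path.Homotopic.Quotient x₀ x) (w : W) :
    pathClass ρ a ((FundamentalGroup.toPath g).trans c) w = pathClass ρ a c (ρ g w) := by
  refine Eq.trans ?_ (mk_single_act ρ _ g w)
  rw [LiftedSimplex.edge_act]
  rfl

/-- The class of a path that starts at the base point. -/
def cone {x : X} (c : Path.Homotopic.Quotient x₀ x) : W →ₗ[R] TwistedChainClass ρ :=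
  pathClass ρ c (.refl x₀)

theorem cone_trans {x y : X} (c : Path.Homotopic.Quotient x₀ x)
    (a : Path.Homotopic.Quotient x y) : cone ρ (c.trans a) = cone ρ c + pathClass ρ a c := by
  rw [cone, pathClass_trans, Path.Homotopic.Quotient.refl_trans, cone]

theorem cone_act {x : X} (g : FundamentalGroup X x₀) (c : Path.Homotopic.Quotient x₀ x) (w : W) :
    cone ρ ((FundamentalGroup.toPath g).trans c) w =
      cone ρ (FundamentalGroup.toPath g) w + cone ρ c (ρ g w) := by
  have h := pathClass_act ρ c g (.refl x₀) w
  rw [Path.Homotopic.Quotient.trans_refl] at h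
  rw [cone_trans, LinearMap.add_apply, h]
  rfl

/-- A crossed homomorphism; on elements that fix `w` it is additive. -/
theorem cone_mul (g h : FundamentalGroup X x₀) (w : W) :
    cone ρ (FundamentalGroup.toPath (g * h)) w =
      cone ρ (FundamentalGroup.toPath h) w + cone ρ (FundamentalGroup.toPath g) (ρ h w) :=
  cone_act ρ h (FundamentalGroup.toPath g) w

/-- Modulo boundaries, going to the first vertex and then along the edge is the same as going to the
last vertex. -/
theorem mk_single (s : LiftedSimplex x₀ 1) (w : W) :
    mk ρ (Finsupp.single s w) = cone ρ (s.point (stdSimplex.vertex 1)).path w -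
      cone ρ (s.point (stdSimplex.vertex 0)).path w := by
  have h₁ : mk ρ (Finsupp.single s w) = pathClass ρ (Path.Homotopic.Quotient.mk
      ((simplexSegment (stdSimplex.vertex 0) (stdSimplex.vertex 1)).map s.simplex.continuous))
      s.path w := by
    rw [pathClass_mk]
    exact congrArg (fun s => mk ρ (Finsupp.single s w)) s.eq_edge
  rw [h₁, LiftedSimplex.point_vertex_zero, eq_sub_iff_add_eq']
  exact (LinearMap.congr_fun (cone_trans ρ _ _) w).symm

end TwistedChainClass

/-- The inclusion of first homology into chains modulo boundaries. -/
def TwistedH1.toClass : TwistedH1 ρ →ₗ[R] TwistedChainClass ρ :=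
  Submodule.mapQ _ _ (LinearMap.ker (twistedBoundary ρ 0)).subtype le_rfl

theorem TwistedH1.toClass_injective : Function.Injective (TwistedH1.toClass ρ) := by
  rw [← LinearMap.ker_eq_bot, TwistedH1.toClass, Submodule.ker_mapQ]
  rw [← le_bot_iff, Submodule.map_le_iff_le_comap]
  exact fun x hx => (Submodule.mem_bot R).2 ((Submodule.Quotient.mk_eq_zero _).2 hx)

theorem liftedBoundary_zero_single (s : LiftedSimplex x₀ 1) (w : W) :
    liftedBoundary R W x₀ 0 (Finsupp.single s w) =
      Finsupp.single (s.point (stdSimplex.vertex 1)) w -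
        Finsupp.single (s.point (stdSimplex.vertex 0)) w := by
  refine (LinearMap.sum_apply _ _ _).trans ((Fin.sum_univ_two _).trans ?_)
  have h (i : Fin 2) := congrArg (Finsupp.single · w) (s.face_eq_point i)
  simp only [sub_eq_add_neg]
  refine Eq.trans ?_ (congrArg₂ (fun a b => a + -b) (h 0) (h 1))
  simp

theorem TwistedH1.mk_mem_range_toClass {z : LiftedSimplex x₀ 1 →₀ W}
    (hz : liftedBoundary R W x₀ 0 z ∈ twistedRelations ρ 0) :
    ∃ h, TwistedH1.toClass ρ h = TwistedChainClass.mk ρ z :=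
  ⟨Submodule.Quotient.mk ⟨Submodule.Quotient.mk z, (Submodule.Quotient.mk_eq_zero _).2 hz⟩, rfl⟩

theorem TwistedH1.exists_mk_eq_toClass (h : TwistedH1 ρ) :
    ∃ z, liftedBoundary R W x₀ 0 z ∈ twistedRelations ρ 0 ∧
      TwistedChainClass.mk ρ z = TwistedH1.toClass ρ h := by
  obtain ⟨⟨y, hy⟩, rfl⟩ := Submodule.mkQ_surjective _ h
  obtain ⟨z, rfl⟩ := Submodule.mkQ_surjective _ y
  exact ⟨z, (Submodule.Quotient.mk_eq_zero _).1 hy, rfl⟩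

theorem TwistedChainClass.mk_eq_zero_iff (z : LiftedSimplex x₀ 1 →₀ W) :
    TwistedChainClass.mk ρ z = 0 ↔ ∃ y, z - liftedBoundary R W x₀ 1 y ∈ twistedRelations ρ 1 := by
  refine (Submodule.Quotient.mk_eq_zero _).trans ⟨?_, ?_⟩
  · rintro ⟨y, hy⟩
    obtain ⟨y, rfl⟩ := Submodule.mkQ_surjective _ y
    exact ⟨y, (Submodule.Quotient.eq _).1 hy.symm⟩
  · rintro ⟨y, hy⟩
    exact ⟨Submodule.Quotient.mk y, ((Submodule.Quotient.eq _).2 hy).symm⟩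

/-- An additive map on twisted chains that is compatible with the action of the fundamental group
vanishes on the relations. -/
theorem twistedRelations_le_ker {n : ℕ} {U : Type*} [AddCommGroup U]
    (Ψ : (LiftedSimplex x₀ n →₀ W) →+ U)
    (hΨ : ∀ s g w, Ψ (Finsupp.single (s.act g) w) = Ψ (Finsupp.single s (ρ g w)))
    {z : LiftedSimplex x₀ n →₀ W} (hz : z ∈ twistedRelations ρ n) : Ψ z = 0 := by
  -- The relations form an `R`-span while `Ψ` is only additive, so the scalar is carried through the
  -- induction.
  suffices ∀ r : R, Ψ (r • z) = 0 by simpa using this 1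
  induction hz using Submodule.span_induction with
  | mem z hz =>
    obtain ⟨s, g, w, rfl⟩ := hz
    intro r
    rw [smul_sub, Finsupp.smul_single, Finsupp.smul_single, ← map_smul, map_sub, hΨ, sub_self]
  | zero => simp
  | add x y _ _ hx hy =>
    intro r
    rw [smul_add, map_add, hx, hy, add_zero]
  | smul a x _ hx =>
    intro r
    rw [smul_smul, hx]

end OrbitDecomposition

/-! ### Shapiro's lemma for a permuted basis with constant stabilizers -/

section OrbitBasis

variable {X : Type*} [TopologicalSpace X] {x₀ : X}
variable {R W : Type*} [CommRing R] [AddCommGroup W] [Module R W] [Module ℚ W]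

/-- A rational basis of a representation that is permuted by the group, such that all stabilizers
are equal to `K`, with a choice of representatives of the orbits. -/
structure OrbitBasis (ρ : Representation R (FundamentalGroup X x₀) W)
    (K : Subgroup (FundamentalGroup X x₀)) (Ω O : Type*) where
  /-- the basis -/
  basis : (Ω →₀ ℚ) ≃ₗ[ℚ] W
  /-- the action on the basis -/
  act : FundamentalGroup X x₀ →* Equiv.Perm Ω
  apply_basis : ∀ g ω, ρ g (basis (Finsupp.single ω 1)) = basis (Finsupp.single (act g ω) 1)
  /-- the orbit of a basis vector -/
  orbit : Ω → O
  /-- the representative of an orbit -/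
  rep : O → Ω
  /-- an element that moves a basis vector to the representative of its orbit -/
  toRep : Ω → FundamentalGroup X x₀
  act_toRep : ∀ ω, act (toRep ω) ω = rep (orbit ω)
  toRep_rep : ∀ j, toRep (rep j) = 1
  orbit_rep : ∀ j, orbit (rep j) = j
  orbit_act : ∀ g ω, orbit (act g ω) = orbit ω
  act_eq_self_iff : ∀ g ω, act g ω = ω ↔ g ∈ K

namespace OrbitBasis

open TwistedChainClass FundamentalGroup

variable {ρ : Representation R (FundamentalGroup X x₀) W}
  {K : Subgroup (FundamentalGroup X x₀)} {Ω O : Type*} (B : OrbitBasis ρ K Ω O)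

/-- The basis vector of a representation that belongs to an element of the index set. -/
def vec (ω : Ω) : W := B.basis (Finsupp.single ω 1)

theorem apply_vec (g : FundamentalGroup X x₀) (ω : Ω) : ρ g (B.vec ω) = B.vec (B.act g ω) :=
  B.apply_basis g ω

/-- Linear maps that agree on the basis are equal. -/
theorem hom_ext {U : Type*} [AddCommGroup U] [Module ℚ U] {a b : W →ₗ[ℚ] U}
    (h : ∀ ω, a (B.vec ω) = b (B.vec ω)) : a = b := by
  have : a ∘ₗ B.basis.toLinearMap = b ∘ₗ B.basis.toLinearMap :=
    Finsupp.lhom_ext' fun ω => LinearMap.ext_ring (h ω)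
  refine LinearMap.ext fun w => ?_
  simpa using LinearMap.congr_fun this (B.basis.symm w)

/-- An equivariant choice of group elements, for the vertices of the universal cover and the
basis vectors. -/
def shift (p : LiftedSimplex x₀ 0) (ω : Ω) : FundamentalGroup X x₀ :=
  B.toRep (B.act (closeUp p.path) ω) * closeUp p.path

theorem shift_act (p : LiftedSimplex x₀ 0) (g : FundamentalGroup X x₀) (ω : Ω) :
    B.shift (p.act g) ω = B.shift p (B.act g ω) * g := by
  rw [shift, shift, LiftedSimplex.act, closeUp_trans, map_mul, Equiv.Perm.mul_apply, mul_assoc]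

theorem act_shift (p : LiftedSimplex x₀ 0) (ω : Ω) :
    B.act (B.shift p ω) ω = B.rep (B.orbit ω) := by
  rw [shift, map_mul, Equiv.Perm.mul_apply, B.act_toRep, B.orbit_act]

/-- Both shifts move `ω` to the representative of its orbit, so the quotient fixes that
representative. -/
theorem mul_inv_mem (p p' : LiftedSimplex x₀ 0) (ω : Ω) :
    B.shift p' ω * (B.shift p ω)⁻¹ ∈ K := by
  rw [← B.act_eq_self_iff _ (B.rep (B.orbit ω)), map_mul, Equiv.Perm.mul_apply, map_inv]
  nth_rw 1 [← B.act_shift p ω]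
  rw [← Equiv.Perm.mul_apply (B.act (B.shift p ω))⁻¹, inv_mul_cancel, Equiv.Perm.one_apply,
    B.act_shift]

/-- The element of `K` that is the difference of two vertices. -/
def diff (p p' : LiftedSimplex x₀ 0) (ω : Ω) : K := ⟨_, B.mul_inv_mem p p' ω⟩

theorem diff_act (p p' : LiftedSimplex x₀ 0) (g : FundamentalGroup X x₀) (ω : Ω) :
    B.diff (p.act g) (p'.act g) ω = B.diff p p' (B.act g ω) := by
  refine Subtype.ext ?_
  change B.shift _ _ * (B.shift _ _)⁻¹ = B.shift _ _ * (B.shift _ _)⁻¹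
  rw [shift_act, shift_act]
  group

theorem diff_mul_diff (p p' p'' : LiftedSimplex x₀ 0) (ω : Ω) :
    B.diff p' p'' ω * B.diff p p' ω = B.diff p p'' ω := by
  refine Subtype.ext ?_
  change B.shift _ _ * (B.shift _ _)⁻¹ * (B.shift _ _ * (B.shift _ _)⁻¹) =
    B.shift _ _ * (B.shift _ _)⁻¹
  group

/-- The value of a chain of the form `s ⊗ w` in the homology of `K`. -/
def simplexValue (p p' : LiftedSimplex x₀ 0) : W →ₗ[ℚ] O →₀ RationalH1 K :=
  Finsupp.linearCombination ℚ (fun ω => Finsupp.single (B.orbit ω) (RationalH1.of (B.diff p p' ω)))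
    ∘ₗ B.basis.symm.toLinearMap

theorem simplexValue_vec (p p' : LiftedSimplex x₀ 0) (ω : Ω) :
    B.simplexValue p p' (B.vec ω) =
      Finsupp.single (B.orbit ω) (RationalH1.of (B.diff p p' ω)) := by
  simp [simplexValue, vec]

theorem simplexValue_act [Algebra ℚ R] [IsScalarTower ℚ R W] (p p' : LiftedSimplex x₀ 0)
    (g : FundamentalGroup X x₀) (w : W) :
    B.simplexValue (p.act g) (p'.act g) w = B.simplexValue p p' (ρ g w) := by
  refine LinearMap.congr_fun (g := B.simplexValue p p' ∘ₗ (ρ g).restrictScalars ℚ)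
    (B.hom_ext fun ω => ?_) w
  change _ = B.simplexValue p p' (ρ g (B.vec ω))
  rw [simplexValue_vec, B.apply_vec, simplexValue_vec, B.orbit_act, diff_act]

theorem simplexValue_add (p p' p'' : LiftedSimplex x₀ 0) (w : W) :
    B.simplexValue p p'' w = B.simplexValue p' p'' w + B.simplexValue p p' w := by
  refine LinearMap.congr_fun (g := B.simplexValue p' p'' + B.simplexValue p p')
    (B.hom_ext fun ω => ?_) w
  rw [LinearMap.add_apply, simplexValue_vec, simplexValue_vec, simplexValue_vec,
    ← Finsupp.single_add, ← RationalH1.of_mul, diff_mul_diff]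

/-- The value of a chain in the homology of `K`. -/
def chainValue : (LiftedSimplex x₀ 1 →₀ W) →ₗ[ℚ] O →₀ RationalH1 K :=
  Finsupp.lsum ℚ fun s => B.simplexValue (s.point (stdSimplex.vertex 0))
    (s.point (stdSimplex.vertex 1))

theorem chainValue_single (s : LiftedSimplex x₀ 1) (w : W) :
    B.chainValue (Finsupp.single s w) = B.simplexValue (s.point (stdSimplex.vertex 0))
      (s.point (stdSimplex.vertex 1)) w := by
  simp [chainValue]

/-- The differences along the edges of a triangle satisfy the cocycle identity `diff_mul_diff`. -/
theorem chainValue_liftedBoundary (y : LiftedSimplex x₀ 2 →₀ W) :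
    B.chainValue (liftedBoundary R W x₀ 1 y) = 0 := by
  induction y using Finsupp.induction_linear with
  | zero => simp
  | add x y hx hy => rw [map_add, map_add, hx, hy, add_zero]
  | single s w =>
    rw [liftedBoundary_one_single, map_add, map_sub, chainValue_single, chainValue_single,
      chainValue_single]
    have h (i : Fin 3) (j : Fin 2) : (s.face i).point (stdSimplex.vertex j) =
        s.point (stdSimplex.vertex (i.succAbove j)) := by
      rw [LiftedSimplex.point_face, LiftedSimplex.simplexFace_vertex]
    have h' (i : Fin 3) := congrArg₂ (fun p p' => B.simplexValue p p' w) (h i 0) (h i 1)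
    refine (congrArg₂ (· + ·) (congrArg₂ (· - ·) (h' 0) (h' 1)) (h' 2)).trans ?_
    have h'' := B.simplexValue_add (s.point (stdSimplex.vertex 0)) (s.point (stdSimplex.vertex 1))
      (s.point (stdSimplex.vertex 2)) w
    exact (sub_add_eq_add_sub _ _ _).trans (sub_eq_zero.2 h''.symm)

variable [Algebra ℚ R] [IsScalarTower ℚ R W]

theorem chainValue_eq_zero {z : LiftedSimplex x₀ 1 →₀ W} (hz : TwistedChainClass.mk ρ z = 0) :
    B.chainValue z = 0 := by
  obtain ⟨y, hy⟩ := (mk_eq_zero_iff ρ z).1 hz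
  have h := twistedRelations_le_ker ρ B.chainValue.toAddMonoidHom (fun s g w => ?_) hy
  · rw [map_sub] at h
    exact (sub_eq_zero.1 h).trans (B.chainValue_liftedBoundary y)
  · change B.chainValue _ = B.chainValue _
    rw [chainValue_single, chainValue_single, LiftedSimplex.point_act, LiftedSimplex.point_act,
      simplexValue_act]

/-- The inclusion of the homology of `K` that belongs to a basis vector. -/
def inclusion (ω : Ω) : RationalH1 K →ₗ[ℚ] TwistedChainClass ρ :=
  -- Elements of `K` fix every basis vector, so the crossed homomorphism `cone` is a homomorphism on
  -- `K`.
  RationalH1.lift (fun k => cone ρ (toPath (k : FundamentalGroup X x₀)) (B.vec ω)) fun k l => by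
    rw [Subgroup.coe_mul, cone_mul, B.apply_vec, (B.act_eq_self_iff _ ω).2 l.2, add_comm]

theorem inclusion_of (ω : Ω) (k : K) : B.inclusion ω (RationalH1.of k) =
    cone ρ (toPath (k : FundamentalGroup X x₀)) (B.vec ω) :=
  RationalH1.lift_of _ _ k

/-- Expand the cone of `k * g = g * (g⁻¹ * k * g)` in both ways; the cone of `g` cancels. This is
where the monodromy enters. -/
theorem inclusion_act [K.Normal] (g : FundamentalGroup X x₀) (ω : Ω) (z : RationalH1 K) :
    B.inclusion (B.act g ω) z = B.inclusion ω (monodromyH1 K g z) := by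
  refine LinearMap.congr_fun (g := B.inclusion ω ∘ₗ monodromyH1 K g)
    (RationalH1.hom_ext fun k => ?_) z
  rw [LinearMap.comp_apply, monodromyH1_of, inclusion_of, inclusion_of, MulAut.conjNormal_apply,
    inv_inv, ← B.apply_vec]
  have h := cone_mul ρ (k : FundamentalGroup X x₀) g (B.vec ω)
  have h' := cone_mul ρ g (g⁻¹ * k * g) (B.vec ω)
  have hk : g⁻¹ * k * g ∈ K := by
    simpa using (inferInstance : K.Normal).conj_mem k k.2 g⁻¹
  rw [B.apply_vec, (B.act_eq_self_iff _ ω).2 hk, show g * (g⁻¹ * k * g) = k * g by group, h] at h'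
  rw [add_comm] at h'
  exact add_right_cancel h'

theorem smul_inclusion (c : R) {ω ω' : Ω} (h : c • B.vec ω = B.vec ω') (z : RationalH1 K) :
    c • B.inclusion ω z = B.inclusion ω' z := by
  induction z using RationalH1.induction with
  | hof k => rw [inclusion_of, inclusion_of, ← h, map_smul]
  | hadd x y hx hy => rw [map_add, map_add, smul_add, hx, hy]
  | hsmul a x hx => rw [map_smul, map_smul, smul_comm, hx]

/-- The map from the homology of `K` to twisted chains modulo boundaries. -/
def toClass : (O →₀ RationalH1 K) →ₗ[ℚ] TwistedChainClass ρ :=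
  Finsupp.lsum ℚ fun j => B.inclusion (B.rep j)

theorem toClass_single (j : O) (z : RationalH1 K) :
    B.toClass (Finsupp.single j z) = B.inclusion (B.rep j) z := by
  simp [toClass]

/-- Loops at the base point provide cycles. That `chainValue` recovers `u` gives injectivity of
`toClass`; the cycle condition puts its image inside the twisted homology. -/
theorem exists_mk_eq_toClass (u : O →₀ RationalH1 K) :
    ∃ z, TwistedChainClass.mk ρ z = B.toClass u ∧ B.chainValue z = u ∧
      liftedBoundary R W x₀ 0 z ∈ twistedRelations ρ 0 := by
  induction u using Finsupp.induction_linear with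
  | zero => exact ⟨0, by simp⟩
  | add u v hu hv =>
    obtain ⟨z, h₁, h₂, h₃⟩ := hu
    obtain ⟨y, h₁', h₂', h₃'⟩ := hv
    exact ⟨z + y, by rw [map_add, map_add, h₁, h₁'], by rw [map_add, h₂, h₂'], by
      rw [map_add]
      exact add_mem h₃ h₃'⟩
  | single j u =>
    simp only [toClass_single]
    induction u using RationalH1.induction with
    | hadd u v hu hv =>
      obtain ⟨z, h₁, h₂, h₃⟩ := hu
      obtain ⟨y, h₁', h₂', h₃'⟩ := hv
      exact ⟨z + y, by rw [map_add, map_add, h₁, h₁'], by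
        rw [map_add, h₂, h₂', Finsupp.single_add], by
        rw [map_add]
        exact add_mem h₃ h₃'⟩
    | hsmul a u hu =>
      obtain ⟨z, h₁, h₂, h₃⟩ := hu
      refine ⟨algebraMap ℚ R a • z, ?_, ?_, ?_⟩
      · rw [map_smul, map_smul, h₁, algebraMap_smul]
      · rw [algebraMap_smul, map_smul, h₂, Finsupp.smul_single]
      · rw [map_smul]
        exact Submodule.smul_mem _ _ h₃
    | hof k =>
      obtain ⟨γ, hγ⟩ := Path.Homotopic.Quotient.mk_surjective (toPath (k : FundamentalGroup X x₀))
      have hk : B.act k (B.rep j) = B.rep j := (B.act_eq_self_iff _ _).2 k.2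
      -- Since `toRep` is `1` on representatives, the shifts at the two ends are `1` and `k`.
      refine ⟨Finsupp.single (LiftedSimplex.edge γ (.refl x₀)) (B.vec (B.rep j)), ?_, ?_, ?_⟩
      · rw [inclusion_of, cone, ← hγ, pathClass_mk]
        rfl
      · rw [chainValue_single, simplexValue_vec, B.orbit_rep]
        refine congrArg (fun x => Finsupp.single j (RationalH1.of x)) (Subtype.ext ?_)
        change B.shift _ _ * (B.shift _ _)⁻¹ = k
        rw [shift, shift, LiftedSimplex.closeUp_point_edge_zero,
          LiftedSimplex.closeUp_point_edge_one, hγ, Path.Homotopic.Quotient.refl_trans,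
          closeUp_refl, closeUp_toPath, hk, map_one, Equiv.Perm.one_apply, B.toRep_rep]
        group
      · rw [liftedBoundary_zero_single, LiftedSimplex.point_edge_one]
        refine Submodule.subset_span ⟨_, _, B.vec (B.rep j), congrArg _ (congrArg _ ?_)⟩
        rw [hγ]
        exact (B.apply_vec k _).trans (congrArg B.vec hk) |>.symm

theorem toClass_injective : Function.Injective B.toClass := by
  rw [injective_iff_map_eq_zero]
  intro u hu
  obtain ⟨z, h, rfl, -⟩ := B.exists_mk_eq_toClass u
  exact B.chainValue_eq_zero (h.trans hu)

/-- The correction term in the reduction of a chain to loops at the base point. -/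
def correction : (LiftedSimplex x₀ 0 →₀ W) →ₗ[ℚ] TwistedChainClass ρ :=
  Finsupp.lsum ℚ fun p => Finsupp.linearCombination ℚ (fun ω =>
    cone ρ (p.act (B.shift p ω)⁻¹).path (B.vec (B.act (B.shift p ω) ω))) ∘ₗ
      B.basis.symm.toLinearMap

theorem correction_single_vec (p : LiftedSimplex x₀ 0) (ω : Ω) :
    B.correction (Finsupp.single p (B.vec ω)) =
      cone ρ (p.act (B.shift p ω)⁻¹).path (B.vec (B.act (B.shift p ω) ω)) := by
  simp [correction, vec]

/-- The path to `p` is the loop `shift p ω` followed by the path to the translated vertex. -/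
theorem cone_vec (p : LiftedSimplex x₀ 0) (ω : Ω) : cone ρ p.path (B.vec ω) =
    cone ρ (toPath (B.shift p ω)) (B.vec ω) + B.correction (Finsupp.single p (B.vec ω)) := by
  have h : (toPath (B.shift p ω)).trans (p.act (B.shift p ω)⁻¹).path = p.path := by
    refine (Path.Homotopic.Quotient.trans_assoc _ _ _).symm.trans ?_
    have h : (toPath (B.shift p ω)).trans (toPath (B.shift p ω)⁻¹) = .refl x₀ :=
      inv_mul_cancel (B.shift p ω)
    exact (congrArg (fun c => Path.Homotopic.Quotient.trans c p.path) h).trans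
      (Path.Homotopic.Quotient.refl_trans _)
  rw [correction_single_vec, ← B.apply_vec, ← cone_act, h]
  rfl

/-- A chain homotopy formula: up to a term depending only on the boundary, a chain is a sum of loops
with classes in `K`. -/
theorem mk_eq (z : LiftedSimplex x₀ 1 →₀ W) :
    TwistedChainClass.mk ρ z =
      B.toClass (B.chainValue z) + B.correction (liftedBoundary R W x₀ 0 z) := by
  refine LinearMap.congr_fun (f := (TwistedChainClass.mk ρ).restrictScalars ℚ)
    (g := B.toClass ∘ₗ B.chainValue + B.correction ∘ₗ (liftedBoundary R W x₀ 0).restrictScalars ℚ)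
    (Finsupp.lhom_ext' fun s => B.hom_ext fun ω => ?_) z
  change TwistedChainClass.mk ρ (Finsupp.single s (B.vec ω)) =
    B.toClass (B.chainValue (Finsupp.single s (B.vec ω))) +
    B.correction (liftedBoundary R W x₀ 0 (Finsupp.single s (B.vec ω)))
  rw [liftedBoundary_zero_single, chainValue_single, simplexValue_vec, toClass_single, inclusion_of,
    mk_single, map_sub, cone_vec, cone_vec]
  set p := s.point (stdSimplex.vertex 0)
  set p' := s.point (stdSimplex.vertex 1)
  have h := cone_mul ρ (B.diff p p' ω : FundamentalGroup X x₀) (B.shift p ω) (B.vec ω)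
  rw [B.apply_vec, B.act_shift, show (B.diff p p' ω : FundamentalGroup X x₀) * B.shift p ω =
    B.shift p' ω from inv_mul_cancel_right _ _] at h
  rw [h]
  abel

/-- Translating `p` by the inverse of its shift is invariant under the group, so the correction
descends to the tensor product. -/
theorem correction_eq_zero {z : LiftedSimplex x₀ 0 →₀ W} (hz : z ∈ twistedRelations ρ 0) :
    B.correction z = 0 := by
  refine twistedRelations_le_ker ρ B.correction.toAddMonoidHom (fun p g w => ?_) hz
  refine LinearMap.congr_fun (f := B.correction ∘ₗ Finsupp.lsingle (p.act g))
    (g := B.correction ∘ₗ Finsupp.lsingle p ∘ₗ (ρ g).restrictScalars ℚ) (B.hom_ext fun ω => ?_) w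
  change B.correction (Finsupp.single (p.act g) (B.vec ω)) =
    B.correction (Finsupp.single p (ρ g (B.vec ω)))
  rw [B.apply_vec, correction_single_vec, correction_single_vec, shift_act, ← LiftedSimplex.act_mul,
    map_mul, Equiv.Perm.mul_apply, mul_inv_rev, mul_inv_cancel_left]

/-- Both sides inject into chain classes with the same image. The action of `c` can therefore be
compared there, generator by generator. -/
theorem exists_addEquiv (c : R) (τ : Module.End ℚ (O →₀ RationalH1 K))
    (hτ : ∀ j z, c • B.inclusion (B.rep j) z = B.toClass (τ (Finsupp.single j z))) :
    ∃ e : TwistedH1 ρ ≃+ (O →₀ RationalH1 K), ∀ x, e (c • x) = τ (e x) := by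
  have hτ' (u) : c • B.toClass u = B.toClass (τ u) := by
    induction u using Finsupp.induction_linear with
    | zero => simp
    | add u v hu hv => rw [map_add, smul_add, hu, hv, map_add, map_add]
    | single j z => rw [toClass_single, hτ]
  have hj := TwistedH1.toClass_injective ρ
  have h₁ (x : TwistedH1 ρ) : ∃ u, B.toClass u = TwistedH1.toClass ρ x := by
    obtain ⟨z, hz, h⟩ := TwistedH1.exists_mk_eq_toClass ρ x
    exact ⟨B.chainValue z, by rw [← h, B.mk_eq, B.correction_eq_zero hz, add_zero]⟩
  have h₂ (u) : ∃ x, TwistedH1.toClass ρ x = B.toClass u := by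
    obtain ⟨z, h, -, hz⟩ := B.exists_mk_eq_toClass u
    obtain ⟨x, hx⟩ := TwistedH1.mk_mem_range_toClass ρ hz
    exact ⟨x, hx.trans h⟩
  choose a ha using h₁
  choose b hb using h₂
  refine ⟨⟨⟨a, b, fun x => hj (by rw [hb, ha]), fun u => B.toClass_injective (by rw [ha, hb])⟩,
    fun x y => B.toClass_injective (by rw [ha, map_add, map_add, ha, ha])⟩, fun x => ?_⟩
  refine B.toClass_injective ?_
  change B.toClass (a _) = B.toClass (τ (a _))
  rw [ha, map_smul, ← hτ', ha]

end OrbitBasis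

end OrbitBasis

/-! ### Twisted homology with coefficients in a regular representation -/

section InducedModules

variable {X V : Type*} [TopologicalSpace X] {x₀ : X} [AddCommGroup V] [Module ℚ V]
variable {G : Type*} [Group G]

/-- The basis `t ^ n ⊗ b x` is indexed by `ℤ × G`, and `g` fixes an index exactly when `φ` and `f`
both kill it. Orbits are classified by the residue modulo `d` of `n` minus the degree of a lift of
`x`; two lifts differ in degree by a multiple of `d`. -/
theorem exists_orbitBasis_twistByLaurent (φ : FundamentalGroup X x₀ →* Multiplicative ℤ)
    (f : FundamentalGroup X x₀ →* G) (hf : Function.Surjective f)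
    (α : Representation ℚ (FundamentalGroup X x₀) V) (b : Module.Basis G ℚ V)
    (hα : ∀ g x, α g (b x) = b (f g * x)) (K : Subgroup (FundamentalGroup X x₀))
    (hK : ∀ g, g ∈ K ↔ f g = 1 ∧ φ g = 1) {d : ℕ} (hd : 0 < d)
    (hker : f.ker.map φ = Subgroup.zpowers (Multiplicative.ofAdd (d : ℤ)))
    {s : FundamentalGroup X x₀} (hsf : s ∈ f.ker) (hs : φ s = Multiplicative.ofAdd (d : ℤ)) :
    ∃ B : OrbitBasis (twistByLaurent α φ) K (ℤ × G) (Fin d),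
      (∀ n x, B.vec (n, x) = (LaurentPolynomial.T n : ℚ[T;T⁻¹]) ⊗ₜ b x) ∧
      (∀ g n x, B.act g (n, x) = (n + Multiplicative.toAdd (φ g), f g * x)) ∧
      ∀ i, B.rep i = ((i : ℤ), 1) := by
  choose u hu using hf
  have hdvd {g : FundamentalGroup X x₀} (hg : f g = 1) : (d : ℤ) ∣ Multiplicative.toAdd (φ g) := by
    have h : φ g ∈ f.ker.map φ := ⟨g, hg, rfl⟩
    rw [hker] at h
    obtain ⟨k, hk⟩ := Subgroup.mem_zpowers_iff.1 h
    refine ⟨k, ?_⟩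
    rw [← hk, toAdd_zpow, toAdd_ofAdd, smul_eq_mul, mul_comm]
  have hmod (z : ℤ) : (z % d).toNat < d := by
    have := Int.emod_lt_of_pos z (Int.natCast_pos.2 hd)
    have := Int.emod_nonneg z (Int.natCast_pos.2 hd).ne'
    omega
  let c (ω : ℤ × G) : ℤ := ω.1 - Multiplicative.toAdd (φ (u ω.2))
  let orbit (ω : ℤ × G) : Fin d := ⟨(c ω % d).toNat, hmod _⟩
  have horbit (ω : ℤ × G) : (orbit ω : ℤ) = c ω % d :=
    Int.toNat_of_nonneg (Int.emod_nonneg _ (Int.natCast_pos.2 hd).ne')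
  have horbit_eq {ω : ℤ × G} {i : Fin d} (h : (d : ℤ) ∣ c ω - i) : orbit ω = i := by
    refine Fin.ext (Nat.cast_injective (R := ℤ) ?_)
    rw [horbit, (Int.emod_emod_of_dvd _ dvd_rfl).symm, Int.emod_emod_of_dvd _ dvd_rfl,
      (Int.emod_eq_emod_iff_emod_sub_eq_zero.2 (Int.emod_eq_zero_of_dvd h)),
      Int.emod_eq_of_lt (by positivity) (by exact_mod_cast i.2)]
  let act : FundamentalGroup X x₀ →* Equiv.Perm (ℤ × G) :=
    { toFun := fun g => (Equiv.addRight (Multiplicative.toAdd (φ g))).prodCongr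
        (Equiv.mulLeft (f g))
      map_one' := Equiv.ext fun x => by
        rw [map_one φ, map_one f]
        exact Prod.ext (add_zero _) (one_mul _)
      map_mul' := fun g h => Equiv.ext fun x => by
        rw [map_mul φ, map_mul f, mul_comm (φ g)]
        exact Prod.ext (add_assoc _ _ _).symm (mul_assoc _ _ _) }
  have hact (g n x) : act g (n, x) = (n + Multiplicative.toAdd (φ g), f g * x) := rfl
  have hrep (ω : ℤ × G) : ∃ g, act g ω = ((orbit ω : ℤ), 1) := by
    obtain ⟨n, x⟩ := ω
    -- The inverse lift moves the index to `(c, 1)`; the power of `s` then reduces `c` to its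
    -- remainder modulo `d`.
    refine ⟨s ^ (-(c (n, x) / d)) * (u x)⁻¹, ?_⟩
    rw [hact, horbit]
    refine Prod.ext ?_ ?_
    · simp only [map_mul, map_zpow, hs, map_inv, toAdd_mul, toAdd_zpow, toAdd_ofAdd, toAdd_inv,
        smul_eq_mul]
      rw [Int.emod_def]
      simp only [c]
      ring
    · simp only
      rw [map_mul f, map_zpow f, MonoidHom.mem_ker.1 hsf, map_inv f, hu, one_zpow,
        one_mul, inv_mul_cancel]
  choose v hv using hrep
  let bs : Module.Basis (ℤ × G) ℚ (ℚ[T;T⁻¹] ⊗[ℚ] V) :=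
    (AddMonoidAlgebra.basis ℤ ℚ).tensorProduct b
  have hbs (n x) : bs (n, x) = (LaurentPolynomial.T n : ℚ[T;T⁻¹]) ⊗ₜ b x :=
    Module.Basis.tensorProduct_apply _ _ n x
  have hvec (ω) : bs.repr.symm (Finsupp.single ω 1) = bs ω := bs.repr_symm_single_one ω
  have hrep (i : Fin d) : orbit ((i : ℤ), 1) = i := by
    refine horbit_eq ?_
    have : c ((i : ℤ), 1) - i = -Multiplicative.toAdd (φ (u 1)) := by
      simp only [c]
      ring
    rw [this, dvd_neg]
    exact hdvd (hu 1)
  classical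
  refine ⟨{
    basis := bs.repr.symm
    act := act
    apply_basis := fun g ⟨n, x⟩ => ?_
    orbit := orbit
    rep := fun i => ((i : ℤ), 1)
    -- The case distinction enforces the value `1` on representatives.
    toRep := fun ω => if ω = ((orbit ω : ℤ), 1) then 1 else v ω
    act_toRep := fun ω => ?_
    toRep_rep := fun i => ?_
    orbit_rep := hrep
    orbit_act := fun g ⟨n, x⟩ => ?_
    act_eq_self_iff := fun g ⟨n, x⟩ => ?_ }, fun n x => ?_, hact, fun i => rfl⟩
  · rw [hvec, hvec, hact, hbs, hbs]
    change (LaurentPolynomial.T (Multiplicative.toAdd (φ g)) : ℚ[T;T⁻¹]) •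
      ((LaurentPolynomial.T n : ℚ[T;T⁻¹]) ⊗ₜ[ℚ] α g (b x)) = _
    rw [TensorProduct.smul_tmul', smul_eq_mul, ← LaurentPolynomial.T_add, hα, add_comm]
  · split_ifs with h
    · rw [map_one]
      exact h
    · exact hv ω
  · rw [if_pos (by rw [hrep])]
  · refine horbit_eq ?_
    rw [hact, horbit, Int.emod_def]
    have h : f (g * u x * (u (f g * x))⁻¹) = 1 := by
      rw [map_mul, map_mul, map_inv, hu, hu, mul_inv_cancel]
    have h' := hdvd h
    rw [map_mul φ, map_mul φ, map_inv φ, toAdd_mul, toAdd_mul, toAdd_inv] at h'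
    have : c (n + Multiplicative.toAdd (φ g), f g * x) - (c (n, x) - d * (c (n, x) / d)) =
        (Multiplicative.toAdd (φ g) + Multiplicative.toAdd (φ (u x)) +
          -Multiplicative.toAdd (φ (u (f g * x)))) + d * (c (n, x) / d) := by
      simp only [c]
      ring
    rw [this]
    exact dvd_add h' (dvd_mul_right _ _)
  · rw [hact, hK, Prod.ext_iff]
    simp [and_comm]
  · exact (hvec _).trans (hbs n x)

/-- If the group permutes a rational basis of a representation transitively, via a homomorphism
to a group `G` that acts freely on the basis, then the characteristic polynomial of `t` on the
twisted homology is determined by the monodromy of the cover that belongs to the kernel. -/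
theorem TwistedH1.exists_addEquiv_of_basis
    (φ : FundamentalGroup X x₀ →* Multiplicative ℤ)
    (f : FundamentalGroup X x₀ →* G) (hf : Function.Surjective f)
    (α : Representation ℚ (FundamentalGroup X x₀) V) (b : Module.Basis G ℚ V)
    (hα : ∀ g x, α g (b x) = b (f g * x)) (K : Subgroup (FundamentalGroup X x₀)) [K.Normal]
    (hK : ∀ g, g ∈ K ↔ f g = 1 ∧ φ g = 1) [FiniteDimensional ℚ (RationalH1 K)] {d : ℕ}
    (hd : 0 < d) (hker : f.ker.map φ = Subgroup.zpowers (Multiplicative.ofAdd (d : ℤ)))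
    {s : FundamentalGroup X x₀} (hsf : s ∈ f.ker) (hs : φ s = Multiplicative.ofAdd (d : ℤ)) :
    ∃ (e : TwistedH1 (twistByLaurent α φ) ≃+ (Fin d → RationalH1 K))
      (τ : Module.End ℚ (Fin d → RationalH1 K)),
      (∀ x, e ((LaurentPolynomial.T 1 : ℚ[T;T⁻¹]) • x) = τ (e x)) ∧
      τ.charpoly = Polynomial.expand ℚ d (monodromyH1 K s).charpoly := by
  obtain ⟨B, hvec, hact, hrep⟩ :=
    exists_orbitBasis_twistByLaurent φ f hf α b hα K hK hd hker hsf hs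
  let A := monodromyH1 K s
  -- Multiplication by `t` sends `(i, 1)` to `(i + 1, 1)`, and `(d, 1)` is the image of `(0, 1)`
  -- under `s`, which brings in the monodromy.
  let τ : Module.End ℚ (Fin d → RationalH1 K) := LinearMap.pi fun i =>
    if (i : ℕ) = 0 then A ∘ₗ LinearMap.proj ⟨d - 1, Nat.sub_lt hd one_pos⟩
      else LinearMap.proj ⟨i - 1, by omega⟩
  have hτ₀ (u) (i : Fin d) (hi : (i : ℕ) = 0) :
      τ u i = A (u ⟨d - 1, Nat.sub_lt hd one_pos⟩) := by
    simp only [τ, LinearMap.pi_apply, if_pos hi]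
    rfl
  have hτ₁ (u) (i : Fin d) (hi : (i : ℕ) ≠ 0) : τ u i = u ⟨i - 1, by omega⟩ := by
    simp only [τ, LinearMap.pi_apply, if_neg hi]
    rfl
  let E : (Fin d →₀ RationalH1 K) ≃ₗ[ℚ] (Fin d → RationalH1 K) :=
    Finsupp.linearEquivFunOnFinite ℚ _ _
  have hE (j : Fin d) (z) (i : Fin d) : E (Finsupp.single j z) i = if j = i then z else 0 := by
    classical
    exact Finsupp.single_apply
  have hsmul (n : ℤ) (x : G) : (LaurentPolynomial.T 1 : ℚ[T;T⁻¹]) • B.vec (n, x) =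
      B.vec (n + 1, x) := by
    rw [hvec, hvec, TensorProduct.smul_tmul', smul_eq_mul, ← LaurentPolynomial.T_add, add_comm]
  obtain ⟨e, he⟩ := B.exists_addEquiv (LaurentPolynomial.T 1) (E.symm.conj τ) fun j z => by
    rw [LinearEquiv.conj_apply_apply, LinearEquiv.symm_symm]
    by_cases hj : (j : ℕ) + 1 < d
    · have h : E.symm (τ (E (Finsupp.single j z))) = Finsupp.single ⟨j + 1, hj⟩ z := by
        rw [LinearEquiv.symm_apply_eq]
        funext i
        rw [hE]
        by_cases hi : (i : ℕ) = 0
        · rw [hτ₀ _ _ hi, hE, if_neg, if_neg, map_zero]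
          · exact fun h => absurd (congrArg Fin.val h) (by simp [hi])
          · exact fun h => absurd (congrArg Fin.val h) (by simp; omega)
        · rw [hτ₁ _ _ hi, hE]
          refine if_congr ?_ rfl rfl
          simp only [Fin.ext_iff]
          omega
      rw [h, B.toClass_single]
      refine B.smul_inclusion _ ?_ z
      rw [hrep, hrep, hsmul]
      simp
    · have h : E.symm (τ (E (Finsupp.single j z))) = Finsupp.single ⟨0, hd⟩ (A z) := by
        rw [LinearEquiv.symm_apply_eq]
        funext i
        rw [hE]
        by_cases hi : (i : ℕ) = 0
        · rw [hτ₀ _ _ hi, hE, if_pos (Fin.ext (by simp; omega)), if_pos (Fin.ext hi.symm)]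
        · rw [hτ₁ _ _ hi, hE, if_neg, if_neg]
          · exact fun h => hi (congrArg Fin.val h).symm
          · exact fun h => absurd (congrArg Fin.val h) (by simp; omega)
      rw [h, B.toClass_single, ← B.inclusion_act]
      refine B.smul_inclusion _ ?_ z
      rw [hrep, hrep, hsmul, hact, hs, MonoidHom.mem_ker.1 hsf]
      refine congrArg B.vec (Prod.ext ?_ (mul_one _).symm)
      simp
      omega
  refine ⟨e.trans E.toAddEquiv, τ, fun x => ?_,
    LinearMap.charpoly_eq_expand_of_cyclic A hd τ hτ₀ hτ₁⟩
  change E (e _) = τ (E (e x))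
  rw [he, LinearEquiv.conj_apply_apply, LinearEquiv.symm_symm, LinearEquiv.apply_symm_apply]

end InducedModules

/-! ### Functoriality of twisted homology in the coefficients -/

section Functoriality

variable {X : Type*} [TopologicalSpace X] {x₀ : X}
variable {R W W' : Type*} [CommRing R] [AddCommGroup W] [Module R W] [AddCommGroup W'] [Module R W']
variable (ρ : Representation R (FundamentalGroup X x₀) W)
  (ρ' : Representation R (FundamentalGroup X x₀) W')

theorem twistedRelations_map_le (θ : W →ₗ[R] W') (hθ : ∀ g w, θ (ρ g w) = ρ' g (θ w)) (n : ℕ) :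
    twistedRelations ρ n ≤ (twistedRelations ρ' n).comap (Finsupp.mapRange.linearMap θ) := by
  refine Submodule.span_le.2 ?_
  rintro _ ⟨s, g, w, rfl⟩
  refine Submodule.subset_span ⟨s, g, θ w, (map_sub _ _ _).trans ?_⟩
  simp [hθ]

theorem liftedBoundary_mapRange (θ : W →ₗ[R] W') (n : ℕ) (z : LiftedSimplex x₀ (n + 1) →₀ W) :
    liftedBoundary R W' x₀ n (Finsupp.mapRange.linearMap θ z) =
      Finsupp.mapRange.linearMap θ (liftedBoundary R W x₀ n z) := by
  induction z using Finsupp.induction_linear with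
  | zero => simp
  | add x y hx hy => rw [map_add, map_add, map_add, map_add, hx, hy]
  | single s w =>
    simp [liftedBoundary, LinearMap.sum_apply, Finsupp.mapDomain_single]

/-- The induced map is characterized through chain classes, so that composites can be computed on
representatives. -/
theorem TwistedH1.exists_map (θ : W →ₗ[R] W') (hθ : ∀ g w, θ (ρ g w) = ρ' g (θ w)) :
    ∃ Θ : TwistedH1 ρ →ₗ[R] TwistedH1 ρ', ∀ h z, TwistedChainClass.mk ρ z = TwistedH1.toClass ρ h →
      TwistedH1.toClass ρ' (Θ h) = TwistedChainClass.mk ρ' (Finsupp.mapRange.linearMap θ z) := by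
  let c (n : ℕ) : TwistedChains ρ n →ₗ[R] TwistedChains ρ' n :=
    Submodule.mapQ _ _ _ (twistedRelations_map_le ρ ρ' θ hθ n)
  have hc (n : ℕ) (y) : twistedBoundary ρ' n (c (n + 1) y) = c n (twistedBoundary ρ n y) := by
    obtain ⟨y, rfl⟩ := Submodule.mkQ_surjective _ y
    exact congrArg (Submodule.mkQ _) (liftedBoundary_mapRange θ n y)
  let c' : TwistedChainClass ρ →ₗ[R] TwistedChainClass ρ' := Submodule.mapQ _ _ (c 1) <| by
    rintro _ ⟨y, rfl⟩
    exact ⟨c 2 y, hc 1 y⟩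
  have hc' (z) : c' (TwistedChainClass.mk ρ z) =
    TwistedChainClass.mk ρ' (Finsupp.mapRange.linearMap θ z) := rfl
  have hmem (h : TwistedH1 ρ) : c' (TwistedH1.toClass ρ h) ∈
      LinearMap.range (TwistedH1.toClass ρ') := by
    obtain ⟨z, hz, hzh⟩ := TwistedH1.exists_mk_eq_toClass ρ h
    rw [← hzh, hc']
    refine TwistedH1.mk_mem_range_toClass ρ' ?_
    rw [liftedBoundary_mapRange]
    exact twistedRelations_map_le ρ ρ' θ hθ 0 hz
  let e := LinearEquiv.ofInjective (TwistedH1.toClass ρ') (TwistedH1.toClass_injective ρ')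
  refine ⟨e.symm.toLinearMap ∘ₗ LinearMap.codRestrict _ (c' ∘ₗ TwistedH1.toClass ρ) hmem,
    fun h z hz => ?_⟩
  rw [← hc', hz]
  exact congrArg Subtype.val (e.apply_symm_apply ⟨c' (TwistedH1.toClass ρ h), hmem h⟩)

/-- A decomposition of the identity of a representation into maps that factor through another
representation gives generators of the twisted homology. -/
theorem TwistedH1.exists_surjective {m : ℕ} (p : Fin m → W →ₗ[R] W') (i : Fin m → W' →ₗ[R] W)
    (hp : ∀ j g w, p j (ρ g w) = ρ' g (p j w)) (hi : ∀ j g w, i j (ρ' g w) = ρ g (i j w))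
    (hpi : ∀ w, ∑ j, p j (i j w) = w) :
    ∃ Θ : (Fin m → TwistedH1 ρ) →ₗ[R] TwistedH1 ρ', Function.Surjective Θ := by
  choose P hP using fun j => TwistedH1.exists_map ρ ρ' (p j) (hp j)
  choose Q hQ using fun j => TwistedH1.exists_map ρ' ρ (i j) (hi j)
  refine ⟨∑ j, P j ∘ₗ LinearMap.proj j, fun h => ⟨fun j => Q j h, ?_⟩⟩
  refine TwistedH1.toClass_injective ρ' ?_
  obtain ⟨z, -, hz⟩ := TwistedH1.exists_mk_eq_toClass ρ' h
  have h₁ (j) := hP j _ _ (hQ j h z hz).symm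
  rw [LinearMap.sum_apply, map_sum]
  simp only [LinearMap.comp_apply, LinearMap.proj_apply, h₁]
  rw [← map_sum, ← hz]
  congr 1
  ext s
  simp [hpi]

end Functoriality

/-! ### Representations that factor through a finite group -/

section FiniteImage

variable {X V : Type*} [TopologicalSpace X] {x₀ : X} [AddCommGroup V] [Module ℚ V]
variable {G : Type*} [Group G]

theorem twistByLaurent_baseChange {P V' : Type*} [Group P] [AddCommGroup V'] [Module ℚ V']
    (α : Representation ℚ P V) (α' : Representation ℚ P V') (φ : P →* Multiplicative ℤ)
    (θ : V →ₗ[ℚ] V') (hθ : ∀ g v, θ (α g v) = α' g (θ v)) (g : P) (w : ℚ[T;T⁻¹] ⊗[ℚ] V) :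
    θ.baseChange ℚ[T;T⁻¹] (twistByLaurent α φ g w) =
      twistByLaurent α' φ g (θ.baseChange ℚ[T;T⁻¹] w) := by
  have h : θ ∘ₗ α g = α' g ∘ₗ θ := LinearMap.ext (hθ g)
  have h' := congrArg (LinearMap.baseChange ℚ[T;T⁻¹]) h
  rw [LinearMap.baseChange_comp, LinearMap.baseChange_comp] at h'
  change θ.baseChange ℚ[T;T⁻¹] ((LaurentPolynomial.T (Multiplicative.toAdd (φ g)) : ℚ[T;T⁻¹]) •
    (α g).baseChange ℚ[T;T⁻¹] w) = (LaurentPolynomial.T (Multiplicative.toAdd (φ g)) : ℚ[T;T⁻¹]) •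
    (α' g).baseChange ℚ[T;T⁻¹] (θ.baseChange ℚ[T;T⁻¹] w)
  rw [map_smul]
  exact congrArg _ (LinearMap.congr_fun h' w)

theorem leftRegular_basis (g x : G) : Representation.leftRegular ℚ G g (MonoidAlgebra.basis G ℚ x) =
    MonoidAlgebra.basis G ℚ (g * x) := by
  simp [MonoidAlgebra.basis]

/-- Every finite-dimensional representation of a finite group is a direct summand of a multiple
of the regular representation. -/
theorem Representation.exists_sum_comp_leftRegular [Finite G] [FiniteDimensional ℚ V]
    (ρ : Representation ℚ G V) :
    ∃ (p : Fin (Module.finrank ℚ V) → MonoidAlgebra ℚ G →ₗ[ℚ] V)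
      (i : Fin (Module.finrank ℚ V) → V →ₗ[ℚ] MonoidAlgebra ℚ G),
      (∀ j g w, p j (Representation.leftRegular ℚ G g w) = ρ g (p j w)) ∧
      (∀ j g w, i j (ρ g w) = Representation.leftRegular ℚ G g (i j w)) ∧
      ∀ w, ∑ j, p j (i j w) = w := by
  have := Fintype.ofFinite G
  let b := Module.finBasis ℚ V
  let B := MonoidAlgebra.basis G ℚ
  have hp (j) (x : G) : B.constr ℚ (fun x => ρ x (b j)) (B x) = ρ x (b j) := B.constr_basis ℚ _ x
  -- The `j`-th projection evaluates on the `j`-th basis vector; the `j`-th inclusion sends `w` to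
  -- the average of `b j ^* (x⁻¹ w) x` over `G`. Summing the composites over `j` averages `x x⁻¹ w =
  -- w`.
  refine ⟨fun j => B.constr ℚ fun x => ρ x (b j), fun j => (Fintype.card G : ℚ)⁻¹ •
    ∑ x : G, ((b.coord j) ∘ₗ ρ x⁻¹).smulRight (B x), fun j g w => ?_, fun j g w => ?_,
    fun w => ?_⟩
  · refine LinearMap.congr_fun (f := B.constr ℚ (fun x => ρ x (b j)) ∘ₗ
      Representation.leftRegular ℚ G g) (g := ρ g ∘ₗ B.constr ℚ fun x => ρ x (b j))
      (B.ext fun x => ?_) w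
    rw [LinearMap.comp_apply, LinearMap.comp_apply, leftRegular_basis, hp, hp, map_mul]
    rfl
  · simp only [LinearMap.smul_apply, LinearMap.sum_apply, LinearMap.smulRight_apply,
      LinearMap.comp_apply, map_smul, map_sum, B, leftRegular_basis]
    congr 1
    refine (Fintype.sum_equiv (Equiv.mulLeft g) _ _ fun x => ?_).symm
    rw [Equiv.coe_mulLeft, mul_inv_rev, map_mul ρ, Module.End.mul_apply,
      ← Module.End.mul_apply (ρ g⁻¹),
      ← map_mul ρ, inv_mul_cancel, map_one, Module.End.one_apply]
  · simp only [LinearMap.smul_apply, LinearMap.sum_apply, LinearMap.smulRight_apply,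
      LinearMap.comp_apply, map_smul, map_sum, hp]
    rw [← Finset.smul_sum, Finset.sum_comm]
    have h (x : G) : ∑ j, b.coord j (ρ x⁻¹ w) • ρ x (b j) = w := by
      simp only [← map_smul]
      rw [← map_sum]
      simp only [Module.Basis.coord_apply]
      rw [b.sum_repr, ← Module.End.mul_apply, ← map_mul, mul_inv_cancel, map_one,
        Module.End.one_apply]
    simp only [h]
    rw [Finset.sum_const, Finset.card_univ, ← Nat.cast_smul_eq_nsmul ℚ, inv_smul_smul₀]
    exact_mod_cast Fintype.card_ne_zero

theorem charpoly_mulT_pi {H : Type*} [AddCommGroup H] [Module ℚ H] [Module ℚ[T;T⁻¹] H]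
    [IsScalarTower ℚ ℚ[T;T⁻¹] H] [FiniteDimensional ℚ H] (m : ℕ) :
    (mulT (Fin m → H)).charpoly = (mulT H).charpoly ^ m := by
  induction m with
  | zero =>
    rw [pow_zero]
    refine (LinearMap.charpoly_monic _).natDegree_eq_zero.1 ?_
    rw [LinearMap.charpoly_natDegree, Module.finrank_zero_of_subsingleton]
  | succ m ih =>
    rw [← charpoly_mulT_congr (Fin.consLinearEquiv ℚ[T;T⁻¹] fun _ : Fin (m + 1) => H),
      charpoly_mulT_prod, ih, pow_succ']

/-- If a module is generated over `ℚ[t, t⁻¹]` by `m` copies of a module that is finite-dimensional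
over `ℚ`, then its order divides the `m`-th power of the order of the latter. -/
theorem isModuleOrder_of_surjective {H U H' : Type*} [AddCommGroup H] [Module ℚ[T;T⁻¹] H]
    [AddCommGroup U] [Module ℚ U] [FiniteDimensional ℚ U] [AddCommGroup H'] [Module ℚ[T;T⁻¹] H']
    (e : H ≃+ U) (τ : Module.End ℚ U)
    (he : ∀ x, e ((LaurentPolynomial.T 1 : ℚ[T;T⁻¹]) • x) = τ (e x)) {m : ℕ}
    (Θ : (Fin m → H) →ₗ[ℚ[T;T⁻¹]] H') (hΘ : Function.Surjective Θ) :
    (∃ P, IsModuleOrder H' P) ∧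
      ∀ P, IsModuleOrder H' P → P ∣ τ.charpoly.toLaurent ^ m := by
  let _ : Module ℚ H := Module.compHom H (algebraMap ℚ ℚ[T;T⁻¹])
  have : IsScalarTower ℚ ℚ[T;T⁻¹] H := IsScalarTower.of_algebraMap_smul fun _ _ => rfl
  let _ : Module ℚ H' := Module.compHom H' (algebraMap ℚ ℚ[T;T⁻¹])
  have : IsScalarTower ℚ ℚ[T;T⁻¹] H' := IsScalarTower.of_algebraMap_smul fun _ _ => rfl
  let e' : H ≃ₗ[ℚ] U := { e with map_smul' := map_rat_smul e.toAddMonoidHom }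
  have := Module.Finite.equiv e'.symm
  have : FiniteDimensional ℚ H' := Module.Finite.of_surjective (Θ.restrictScalars ℚ) hΘ
  refine ⟨⟨_, (isModuleOrder_iff_of_finiteDimensional _).2 (Associated.refl _)⟩, fun P hP => ?_⟩
  have h := (isModuleOrder_iff_charpoly e τ he _).1
    ((isModuleOrder_iff_of_finiteDimensional (H := H) _).2 (Associated.refl _))
  refine ((isModuleOrder_iff_of_finiteDimensional P).1 hP).dvd.trans
    (dvd_trans ?_ (h.pow_pow (n := m)).dvd)
  rw [← map_pow, ← charpoly_mulT_pi]
  refine map_dvd _ (LinearMap.charpoly_dvd_of_surjective (Θ.restrictScalars ℚ) hΘ _ _ ?_)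
  exact LinearMap.ext fun x => Θ.map_smul _ x

end FiniteImage

end

/-! ### The theorem -/

theorem theorem2 {M S : Type*}
    [TopologicalSpace M] [T2Space M] [CompactSpace M] [ChartedSpace (EuclideanHalfSpace 3) M]
    [TopologicalSpace S] [T2Space S] [CompactSpace S] [ConnectedSpace S]
    [ChartedSpace (EuclideanHalfSpace 2) S]
    (q : C(M, AddCircle (1 : ℝ))) (hq : IsFiberBundleOverCircle S q) (x₀ : M)
    (φ : FundamentalGroup M x₀ →* Multiplicative ℤ) (hφ : IsInducedByMapToCircle q φ)
    [LinearOrder (FundamentalGroup M x₀)]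
    [MulLeftMono (FundamentalGroup M x₀)] [MulRightMono (FundamentalGroup M x₀)]
    {G V : Type*} [Group G] [Finite G]
    (f : FundamentalGroup M x₀ →* G) (hf : Function.Surjective f)
    [AddCommGroup V] [Module ℚ V] [FiniteDimensional ℚ V]
    (β : Representation ℚ (FundamentalGroup M x₀) V) (hβ : ∃ ρ : Representation ℚ G V, β = ρ.comp f)
    (t : FundamentalGroup M x₀) (ht : φ t = Multiplicative.ofAdd 1)
    (d : ℕ) (hd : f.ker.map φ = Subgroup.zpowers (Multiplicative.ofAdd (d : ℤ)))
    (s : FundamentalGroup M x₀) (hsf : s ∈ f.ker) (hs : φ s = Multiplicative.ofAdd (d : ℤ)) :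
    (Function.Injective (fiberInclusion q x₀) ∧ (fiberInclusion q x₀).range = φ.ker) ∧
    ∃ (_ : FiniteDimensional ℚ (RationalH1 φ.ker))
      (_ : FiniteDimensional ℚ (RationalH1 ↥(f.ker ⊓ φ.ker)))
      (_ : FiniteDimensional ℚ (RationalA φ.ker))
      (_ : FiniteDimensional ℚ (RationalA ↥(f.ker ⊓ φ.ker))),
      let Δ : Polynomial ℚ := (monodromyH1 φ.ker t).charpoly
      let Δ' : Polynomial ℚ := (monodromyH1 (f.ker ⊓ φ.ker) s).charpoly
      let χ : Polynomial ℚ := (monodromyA φ.ker t).charpoly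
      let χ' : Polynomial ℚ := (monodromyA (f.ker ⊓ φ.ker) s).charpoly
      (∀ P, IsTwistedAlexanderPolynomial (Representation.trivial ℚ (FundamentalGroup M x₀) ℚ) φ P ↔
        Associated P Δ.toLaurent) ∧
      (∀ P, IsTwistedAlexanderPolynomial ((Representation.leftRegular ℚ G).comp f) φ P ↔
        Associated P (Polynomial.expand ℚ d Δ').toLaurent) ∧
      (∃ P, IsTwistedAlexanderPolynomial β φ P) ∧
      (∀ P, IsTwistedAlexanderPolynomial β φ P →
        P ∣ (Polynomial.expand ℚ d Δ').toLaurent ^ Module.finrank ℚ V) ∧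
      χ ∣ Δ ∧
      χ' ∣ Δ' ∧
      (Polynomial.expand ℚ d χ').map (algebraMap ℚ ℂ) =
        ((χ.aroots ℂ).map fun z => (Polynomial.X ^ d - Polynomial.C (z ^ d) : Polynomial ℂ)).prod ∧
      χ ∣ Polynomial.expand ℚ d χ' ∧
      Δ ∣ Polynomial.expand ℚ d Δ' := by
  have hfg : Group.FG φ.ker := hq.fg_ker (n := 2) hφ
  have : f.ker.FiniteIndex := inferInstance
  have hfgK : Group.FG ↥(f.ker ⊓ φ.ker) := by
    have hfi : ((f.ker ⊓ φ.ker).subgroupOf φ.ker).FiniteIndex := by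
      rw [Subgroup.inf_subgroupOf_right]
      infer_instance
    exact Group.fg_of_surjective
      (f := (Subgroup.subgroupOfEquivOfLe (inf_le_right : f.ker ⊓ φ.ker ≤ φ.ker)).toMonoidHom)
      (MulEquiv.surjective _)
  have hF : FiniteDimensional ℚ (RationalH1 φ.ker) := RationalH1.finiteDimensional
  have hK : FiniteDimensional ℚ (RationalH1 ↥(f.ker ⊓ φ.ker)) := RationalH1.finiteDimensional
  have hAF : FiniteDimensional ℚ (RationalA φ.ker) :=
    Module.Finite.of_surjective _ (RationalA.ofH1_surjective _)
  have hAK : FiniteDimensional ℚ (RationalA ↥(f.ker ⊓ φ.ker)) :=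
    Module.Finite.of_surjective _ (RationalA.ofH1_surjective _)
  have hn : Nat.card G ≠ 0 := Nat.card_pos.ne'
  have hpow (x : FundamentalGroup M x₀) : x ^ Nat.card G ∈ f.ker := by
    rw [MonoidHom.mem_ker, map_pow f, pow_card_eq_one']
  have hpowK (x) (hx : x ∈ φ.ker) : x ^ Nat.card G ∈ f.ker ⊓ φ.ker :=
    ⟨hpow x, pow_mem hx _⟩
  -- The power `t ^ |G|` lies in `ker f` and has nonzero degree.
  have hd₀ : 0 < d := by
    refine Nat.pos_of_ne_zero fun h => hn ?_
    have h' : φ (t ^ Nat.card G) ∈ f.ker.map φ := ⟨_, hpow t, rfl⟩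
    rw [hd, h, Nat.cast_zero, ofAdd_zero, Subgroup.zpowers_one_eq_bot, Subgroup.mem_bot,
      map_pow φ, ht, ← ofAdd_nsmul, ← ofAdd_zero] at h'
    simpa using Multiplicative.ofAdd.injective h'
  have hst : (t ^ d)⁻¹ * s ∈ φ.ker := by
    rw [MonoidHom.mem_ker, map_mul φ, map_inv φ, map_pow φ, ht, hs, ← ofAdd_nsmul]
    simp
  refine ⟨⟨fiberInclusion_injective hq, fiberInclusion_range_eq_ker hq hφ⟩, hF, hK, hAF, hAK,
    fun P => ?_, fun P => ?_, ?_⟩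
  -- The trivial representation is the regular representation of the trivial group, with `d = 1`.
  · obtain ⟨e, τ, he, hτ⟩ := TwistedH1.exists_addEquiv_of_basis (G := Unit) φ 1
      (fun x => ⟨1, rfl⟩) (Representation.trivial ℚ (FundamentalGroup M x₀) ℚ)
      (Module.Basis.singleton Unit ℚ) (fun g x => by simp) φ.ker
      (fun g => by simp [MonoidHom.mem_ker]) one_pos (s := t)
      (by
        refine le_antisymm ?_ ((Subgroup.zpowers_le).2 ⟨t, rfl, ht⟩)
        rintro _ ⟨x, -, rfl⟩
        exact Subgroup.mem_zpowers_iff.2 ⟨Multiplicative.toAdd (φ x), by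
          rw [← ofAdd_zsmul]; simp⟩)
      rfl ht
    rw [Polynomial.expand_one] at hτ
    rw [← hτ]
    exact isModuleOrder_iff_charpoly e τ he P
  all_goals
    obtain ⟨e, τ, he, hτ⟩ := TwistedH1.exists_addEquiv_of_basis φ f hf
      ((Representation.leftRegular ℚ G).comp f) (MonoidAlgebra.basis G ℚ)
      (fun g x => leftRegular_basis (f g) x) (f.ker ⊓ φ.ker) (fun g => Iff.rfl) hd₀ hd hsf hs
  · rw [← hτ]
    exact isModuleOrder_iff_charpoly e τ he P
  -- Existence of the polynomial for `β` and its divisibility are grouped, since one surjection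
  -- yields both.
  rw [and_assoc.symm]
  refine ⟨?_, charpoly_monodromyA_dvd_charpoly_monodromyH1 t,
    charpoly_monodromyA_dvd_charpoly_monodromyH1 s, ?_, ?_,
    charpoly_monodromyH1_dvd_expand inf_le_right hn hpowK hst⟩
  · obtain ⟨ρ, rfl⟩ := hβ
    obtain ⟨p, i, hp, hi, hpi⟩ := ρ.exists_sum_comp_leftRegular
    obtain ⟨Θ, hΘ⟩ := TwistedH1.exists_surjective
      (twistByLaurent ((Representation.leftRegular ℚ G).comp f) φ) (twistByLaurent (ρ.comp f) φ)
      (fun j => (p j).baseChange ℚ[T;T⁻¹]) (fun j => (i j).baseChange ℚ[T;T⁻¹])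
      (fun j => twistByLaurent_baseChange _ _ φ _ fun g => hp j (f g))
      (fun j => twistByLaurent_baseChange _ _ φ _ fun g => hi j (f g))
      (fun w => by
        induction w using TensorProduct.induction_on with
        | zero => simp
        | tmul a v =>
          simp only [LinearMap.baseChange_tmul]
          rw [← TensorProduct.tmul_sum, hpi]
        | add x y hx hy => simp only [map_add, Finset.sum_add_distrib, hx, hy])
    rw [← hτ]
    exact isModuleOrder_of_surjective e τ he Θ hΘ
  · rw [charpoly_monodromyA_eq_charpoly_pow inf_le_right hn hpowK hst]
    exact LinearMap.map_expand_charpoly_pow_eq_prod _ hd₀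
  · rw [charpoly_monodromyA_eq_charpoly_pow inf_le_right hn hpowK hst]
    exact LinearMap.charpoly_dvd_expand_charpoly_pow _ d
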